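/- Conventions. For $f:\mathbb R\to\mathbb C$ let $\mathbb H f(\alpha)=\frac1{i\pi}\,\mathrm{p.v.}\!\int_{\mathbb R}\frac{f(\beta)}{\alpha-\beta}\,d\beta$, the principal value being taken symmetrically at $\beta=\alpha$ and at infinity (so $\mathbb H1=0$), $[a,\mathbb H]f=a\,\mathbb Hf-\mathbb H(af)$, $\hat f(\xi)=\frac1{\sqrt{2\pi}}\int e^{-ix\xi}f(x)\,dx$, $\|f\|_{H^2}=\|(1+\xi^2)\hat f\|_{L^2}$ and $\|f\|_{\dot H^{1/2}}=\||\xi|^{1/2}\hat f\|_{L^2}$. Let $P_-=\{z: \operatorname{Im} z<0\}$ and $K_\epsilon(x)=\frac{\epsilon}{\pi(\epsilon^2+x^2)}$. Let $T>0$ and let $Z_{,\alpha'}:\mathbb R\times[0,T]\to\mathbb C\setminus\{0\}$ be a regular solution on $[0,T]$ of the conformal formulation of the one-phase Muskat problem, that is: (i) $Z_{,\alpha'}(\cdot,t)$ is continuous for each $t\in[0,T]$, and $\sup_{t\in[0,T]}\big(\|Z_{,\alpha'}(\cdot,t)-1\|_{H^2}+\|\tfrac1{Z_{,\alpha'}}(\cdot,t)-1\|_{H^2}\big)<\infty$;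 (ii) for each $t\in[0,T]$ the harmonic extension $\Psi_{z'}(\cdot+iy,t)=K_{-y}*Z_{,\alpha'}(\cdot,t)$, $y<0$, is holomorphic and nowhere zero in $P_-$ and tends to $1$ as $|z'|\to\infty$ in $P_-$; (iii) for all $t\in[0,T]$ and $\alpha'\in\mathbb R$ the derivative $\partial_t\frac1{Z_{,\alpha'}}$ exists (relative to $[0,T]$) and $$(\partial_t+b\,\partial_{\alpha'})\frac1{Z_{,\alpha'}}=-\frac{i}{|Z_{,\alpha'}|^2}\,\partial_{\alpha'}\frac1{Z_{,\alpha'}}+\frac{B_1}{Z_{,\alpha'}},\qquad b=-i\,\mathbb H\Big(\frac1{|Z_{,\alpha'}|^2}\Big),\qquad B_1=-2\operatorname{Im}\Big(\Big[\frac1{\overline{Z}_{,\alpha'}},\mathbb H\Big]\partial_{\alpha'}\frac1{Z_{,\alpha'}}\Big).$$ Then for each $t\in[0,T]$ the interface angle $g(\cdot,t)=\operatorname{Im}\log Z_{,\alpha'}(\cdot,t)$ is well defined, where $\log Z_{,\alpha'}$ is the boundary value of the continuous logarithm of $\Psi_{z'}$ on $\overline{P_-}$ (with $\Psi_{z'}=Z_{,\alpha'}$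 on $\mathbb R$) that tends to $0$ at infinity; $B_1\ge0$ everywhere; the functions $|Z_{,\alpha'}|^2g^2$ and $|Z_{,\alpha'}|^2g^2B_1$ are integrable in $\alpha'$ and $\|g(\cdot,t)\|_{\dot H^{1/2}}<\infty$ for every $t\in[0,T]$; the function $t\mapsto\int|Z_{,\alpha'}|^2g^2\,d\alpha'$ is differentiable on $[0,T]$ (one-sidedly at the end points) and $$\frac{d}{dt}\int|Z_{,\alpha'}|^2g^2\,d\alpha'+\int|Z_{,\alpha'}|^2g^2B_1\,d\alpha'+2\|g\|_{\dot H^{1/2}}^2=0\qquad\text{for every }t\in[0,T].$$ Moreover the second and third terms are integrable in time on $[0,T]$, and for every $t\in[0,T]$ $$\int|Z_{,\alpha'}|^2g^2\,d\alpha'\,\Big|_{t}+\int_0^t\!\!\int|Z_{,\alpha'}|^2g^2B_1\,d\alpha'\,ds+2\int_0^t\|g(\cdot,s)\|_{\dot H^{1/2}}^2\,ds=\int|Z_{,\alpha'}|^2g^2\,d\alpha'\,\Big|_{0};$$ in particular $$2\int_0^T\|g(\cdot,s)\|^2_{\dot H^{1/2}}\,ds\le\int|Z_{,\alpha'}(\alpha',0)|^2g(\alpha',0)^2\,d\alpha'.$$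 -/

import Mathlib

open MeasureTheory Filter Set
open scoped Topology ENNReal NNReal FourierTransform

noncomputable section

namespace Muskat

/-- `∫ w(ξ) |f̂(ξ)|² dξ` for `f ∈ L²(ℝ)`, where `f̂(ξ) = (2π)^(-1/2) ∫ e^(-ixξ) f(x) dx`.
In terms of Mathlib's transform `𝓕 f (η) = ∫ e^(-2πixη) f(x) dx` one has
`f̂(2πη) = (2π)^(-1/2) 𝓕 f (η)`, and the substitution `ξ = 2πη` gives the integral below.
The value is `∞` if `f` is not in `L²(ℝ)`. -/
def weightedFourierSq (w : ℝ → ℝ) (f : ℝ → ℂ) : ℝ≥0∞ :=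
  open Classical in
  if h : MemLp f 2 (volume : Measure ℝ) then
    ∫⁻ η : ℝ, ENNReal.ofReal (w (2 * Real.pi * η)) *
      ‖(𝓕 (h.toLp f : Lp ℂ 2 (volume : Measure ℝ)) : Lp ℂ 2 (volume : Measure ℝ)) η‖ₑ ^ 2
  else ⊤

/-- The norm of `H^s(ℝ)`, `s ≥ 0`: `‖f‖_{H^s} = ‖(1 + ξ²)^(s/2) f̂‖_{L²}`. -/
def sobolevNorm (s : ℝ) (f : ℝ → ℂ) : ℝ≥0∞ :=
  (weightedFourierSq (fun ξ => (1 + ξ ^ 2) ^ s) f) ^ (1 / 2 : ℝ)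

/-- The norm of `Ḣ^(1/2)(ℝ)`, for functions in `L²(ℝ)`: `‖f‖ = ‖|ξ|^(1/2) f̂‖_{L²}`. -/
def homHalfNorm (f : ℝ → ℂ) : ℝ≥0∞ :=
  (weightedFourierSq (fun ξ => |ξ|) f) ^ (1 / 2 : ℝ)

/-- The Hilbert transform `ℍ f (α) = (1 / (iπ)) p.v. ∫ f(β) / (α - β) dβ`; the principal value is
taken symmetrically at `β = α` and at infinity, so that `ℍ 1 = 0`. -/
def hilbert (f : ℝ → ℂ) (α : ℝ) : ℂ :=
  1 / (Complex.I * Real.pi) *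
    limUnder (𝓝[>] (0 : ℝ)) (fun ε : ℝ =>
      ∫ β in {β : ℝ | ε < |α - β| ∧ |α - β| < ε⁻¹}, f β / ((α - β : ℝ) : ℂ))

/-- The commutator `[a, ℍ] f = a ℍ f - ℍ (a f)`. -/
def hilbertCommutator (a f : ℝ → ℂ) (α : ℝ) : ℂ :=
  a α * hilbert f α - hilbert (fun β => a β * f β) α

/-- The open lower half plane. -/
def lowerHalfPlane : Set ℂ := {z | z.im < 0}

/-- The closed lower half plane. -/
def closedLowerHalfPlane : Set ℂ := {z | z.im ≤ 0}

/-- The Poisson kernel `K_ε(x) = ε / (π (ε² + x²))`. -/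
def poissonKernel (ε x : ℝ) : ℝ := ε / (Real.pi * (ε ^ 2 + x ^ 2))

/-- The harmonic extension of `f` to the lower half plane: at `x + iy`, `y < 0`, its value is
`(K_{-y} * f)(x)`. -/
def poissonExtension (f : ℝ → ℂ) (z : ℂ) : ℂ :=
  ∫ β : ℝ, (poissonKernel (-z.im) (z.re - β) : ℂ) * f β

/- In what follows `ζ : ℝ → ℂ` stands for the derivative `Z_{,α'}` of the conformal
parametrization of the interface at a fixed time. -/

/-- `∂_{α'} (1 / Z_{,α'})`. -/
def dInv (ζ : ℝ → ℂ) (α : ℝ) : ℂ := deriv (fun β => 1 / ζ β) α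

/-- `b = -i ℍ (1 / |Z_{,α'}|²)`. -/
def driftB (ζ : ℝ → ℂ) (α : ℝ) : ℂ :=
  -Complex.I * hilbert (fun β => 1 / ((‖ζ β‖ ^ 2 : ℝ) : ℂ)) α

/-- `B₁ = -2 Im ([1 / conj Z_{,α'}, ℍ] ∂_{α'} (1 / Z_{,α'}))`. -/
def coeffB1 (ζ : ℝ → ℂ) (α : ℝ) : ℝ :=
  -2 * (hilbertCommutator (fun β => 1 / (starRingEnd ℂ) (ζ β)) (dInv ζ) α).im

/-- `ζ t α = Z_{,α'}(α, t)` is a regular (classical, `H²`) solution on `[0, T]` of the conformal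
formulation of the one-phase Muskat problem. -/
structure IsRegularSolution (T : ℝ) (ζ : ℝ → ℝ → ℂ) : Prop where
  continuous : ∀ t ∈ Icc 0 T, Continuous (ζ t)
  ne_zero : ∀ t ∈ Icc 0 T, ∀ α, ζ t α ≠ 0
  /-- `(Z_{,α'} - 1, 1 / Z_{,α'} - 1) ∈ L^∞([0, T], H² × H²)`. -/
  sobolev : ∃ M : ℝ≥0, ∀ t ∈ Icc 0 T,
    sobolevNorm 2 (fun α => ζ t α - 1) ≤ M ∧ sobolevNorm 2 (fun α => 1 / ζ t α - 1) ≤ M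
  /-- The harmonic extension `Ψ_{z'}` of `Z_{,α'}` is holomorphic in the lower half plane. -/
  holomorphic : ∀ t ∈ Icc 0 T, DifferentiableOn ℂ (poissonExtension (ζ t)) lowerHalfPlane
  /-- `Ψ_{z'} → 1` at infinity. -/
  tendsto_one : ∀ t ∈ Icc 0 T,
    Tendsto (poissonExtension (ζ t)) (Bornology.cobounded ℂ ⊓ 𝓟 lowerHalfPlane) (𝓝 1)
  extension_ne_zero : ∀ t ∈ Icc 0 T, ∀ z ∈ lowerHalfPlane, poissonExtension (ζ t) z ≠ 0
  /-- `(∂_t + b ∂_{α'}) (1 / Z_{,α'}) = -i |Z_{,α'}|⁻² ∂_{α'} (1 / Z_{,α'}) + B₁ / Z_{,α'}`. -/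
  evolution : ∀ t ∈ Icc 0 T, ∀ α, ∃ d : ℂ,
    HasDerivWithinAt (fun s => 1 / ζ s α) d (Icc 0 T) t ∧
      d + driftB (ζ t) α * dInv (ζ t) α =
        -Complex.I * (1 / ((‖ζ t α‖ ^ 2 : ℝ) : ℂ)) * dInv (ζ t) α + (coeffB1 (ζ t) α : ℂ) / ζ t α

/-- `γ = Im (log Z_{,α'})`, where `log` is the boundary value of the continuous logarithm `L` of
the harmonic extension `Ψ_{z'}` of `Z_{,α'}` that tends to `0` at infinity. -/
def IsInterfaceAngle (ζ : ℝ → ℂ) (γ : ℝ → ℝ) : Prop :=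
  ∃ L : ℂ → ℂ, ContinuousOn L closedLowerHalfPlane ∧
    Tendsto L (Bornology.cobounded ℂ ⊓ 𝓟 closedLowerHalfPlane) (𝓝 0) ∧
    (∀ z ∈ lowerHalfPlane, Complex.exp (L z) = poissonExtension ζ z) ∧
    (∀ α : ℝ, Complex.exp (L α) = ζ α) ∧
    ∀ α : ℝ, γ α = (L α).im

/-- The weighted energy `∫ |Z_{,α'}|² g² dα'`. -/
def energy (ζ : ℝ → ℂ) (γ : ℝ → ℝ) : ℝ := ∫ α : ℝ, ‖ζ α‖ ^ 2 * γ α ^ 2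

/-- `∫ |Z_{,α'}|² g² B₁ dα'`. -/
def dissipationB1 (ζ : ℝ → ℂ) (γ : ℝ → ℝ) : ℝ := ∫ α : ℝ, ‖ζ α‖ ^ 2 * γ α ^ 2 * coeffB1 ζ α

/-- `‖g‖²_{Ḣ^(1/2)}` as a real number; meaningful when `homHalfNorm` is finite. -/
def halfNormSq (γ : ℝ → ℝ) : ℝ := (homHalfNorm (fun α => (γ α : ℂ))).toReal ^ 2

end Muskat

end

open Muskat

noncomputable section

namespace Muskat

/-! ### The Fourier transform on `L²(ℝ)` -/

/-! Fix a time and write `f = 1/ζ`, `l = log ζ`, `g = Im l`, `p = f'ζ = -l'`. Since `f = e^{-l}`,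
the evolution equation becomes `∂_t l = (b + i|f|²) p - B₁`, and the energy density is `e^{2 Re l}
g²`. Because `|ζ|²|f|² = 1` and `b` is real, its time derivative is `-b ∂(|ζ|²g²) - 2g² Im p + 2g Re
p - 2|ζ|²g²B₁` (`LogSlice.energyRate_eq`). Three facts turn the integral of this into the
dissipation.

(a) `B₁` is a Gagliardo quotient, `B₁(α) = (1/π) ∫ |f(α) - f(β)|²/(α - β)² dβ ≥ 0`, by integration
by parts in the commutator (`coeffB1_eq_gagliardo`).

(b) `f'` is the boundary value of a function holomorphic in the lower half plane, hence fixed by the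
Hilbert transform. Combined with (a) this gives, in the weak sense, `b' = B₁ + 2 Im(f̄ f')`
(`two_re_pvIntegral`). Integrating the transport term by parts produces `∫|ζ|²g²B₁ + 2∫g² Im p`,
which cancels the cubic term and half of the `B₁` term (`LogSlice.integral_driftB_mul`).

(c) `l` is itself such a boundary value, so its Fourier transform is one-sided and `∂ Re l = |D| g`;
therefore `-∫ g Re p = ∫ g ∂ Re l = ‖g‖²` in the homogeneous norm of order 1/2 (`homHalfNorm_im`).

Hence `∫ ∂_t(|ζ|²g²) = -∫|ζ|²g²B₁ - 2‖g‖²` (`LogSlice.integral_energyRate`). For the derivative of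
the energy, uniform sup and `L¹` bounds of the rate give, by Fubini, the identity integrated in time
(`integral_sub_integral_eq`). Both dissipation terms are continuous in time, so the fundamental
theorem of calculus yields the derivative at every time. This continuity rests on `L²` continuity of
`f`, on interpolation with the uniform `H²` bound to reach `f'`, and on a connectedness argument
showing that the logarithms, chosen separately at each time, do not jump by multiples of `2πi`
(`norm_le_of_norm_exp_sub_one_lt`). -/

theorem continuous_fourierInv_of_integrable {F : ℝ → ℂ} (h1 : Integrable F) :
    Continuous (𝓕⁻ F) := by
  have : (𝓕⁻ F) = 𝓕 (fun x => F (-x)) := Real.fourierInv_eq_fourier_comp_neg F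
  rw [this]
  exact VectorFourier.fourierIntegral_continuous Real.continuous_fourierChar
    (by fun_prop) h1.comp_neg

theorem integral_schwartz_mul_fourierInv (f : Lp ℂ 2 (volume : Measure ℝ)) (ψ : SchwartzMap ℝ ℂ) :
    ∫ x, ψ x • (𝓕⁻ f : Lp ℂ 2 (volume : Measure ℝ)) x = ∫ x, (𝓕⁻ ψ) x • f x := by
  have h := DFunLike.congr_fun (Lp.fourierInv_toTemperedDistribution_eq f) ψ
  rw [TemperedDistribution.fourierInv_apply] at h
  simpa using h.symm

theorem integral_schwartz_mul_fourier (f : Lp ℂ 2 (volume : Measure ℝ)) (ψ : SchwartzMap ℝ ℂ) :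
    ∫ x, ψ x • (𝓕 f : Lp ℂ 2 (volume : Measure ℝ)) x = ∫ x, (𝓕 ψ) x • f x := by
  have h := DFunLike.congr_fun (Lp.fourier_toTemperedDistribution_eq f) ψ
  rw [TemperedDistribution.fourier_apply] at h
  simpa using h.symm

/-- The transform on `L²` is accessible through duality with Schwartz functions, so the identities
below are all checked by pairing. Smooth compactly supported functions are already enough to
separate locally integrable functions. -/
theorem ae_eq_of_integral_schwartz_mul {F G : ℝ → ℂ} (hF : LocallyIntegrable F)
    (hG : LocallyIntegrable G)
    (h : ∀ ψ : SchwartzMap ℝ ℂ, ∫ x, ψ x • F x = ∫ x, ψ x • G x) : F =ᵐ[volume] G := by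
  refine ae_eq_of_integral_contDiff_smul_eq hF hG fun g g_smooth g_cpt => ?_
  have hg₁ : HasCompactSupport (Complex.ofRealCLM ∘ g) := g_cpt.comp_left rfl
  have hg₂ : ContDiff ℝ ((⊤ : ℕ∞) : WithTop ℕ∞) (Complex.ofRealCLM ∘ g) := by fun_prop
  simpa using h (hg₁.toSchwartzMap hg₂)

/-- On `L¹ ∩ L²` the inverse transform of `L²` is given by the integral. -/
theorem fourierInv_toLp_ae_eq {F : ℝ → ℂ} (h2 : MemLp F 2) (h1 : Integrable F) :
    ((𝓕⁻ (h2.toLp F : Lp ℂ 2 (volume : Measure ℝ)) : Lp ℂ 2 (volume : Measure ℝ)) : ℝ → ℂ)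
      =ᵐ[volume] 𝓕⁻ F := by
  refine ae_eq_of_integral_schwartz_mul
    ((Lp.memLp _).locallyIntegrable (by norm_num))
    (continuous_fourierInv_of_integrable h1).locallyIntegrable fun ψ => ?_
  rw [integral_schwartz_mul_fourierInv]
  have h := VectorFourier.integral_fourierIntegral_smul_eq_flip (e := Real.fourierChar)
    (L := -innerₗ ℝ) (μ := volume) (ν := volume) (f := ψ) (g := F)
    Real.continuous_fourierChar (by fun_prop) ψ.integrable h1
  have hL : (-innerₗ ℝ : ℝ →ₗ[ℝ] ℝ →ₗ[ℝ] ℝ).flip = -innerₗ ℝ := by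
    ext; simp
  rw [hL] at h
  calc ∫ x, (𝓕⁻ ψ) x • (h2.toLp F) x = ∫ x, (𝓕⁻ ψ) x • F x := by
        refine integral_congr_ae ?_
        filter_upwards [h2.coeFn_toLp] with x hx
        rw [hx]
    _ = ∫ x, ψ x • (𝓕⁻ F) x := by
        rw [SchwartzMap.fourierInv_coe]
        exact h

/-- The transform of a derivative. -/
theorem fourier_toLp_deriv {F F' : ℝ → ℂ} (hF : MemLp F 2) (hF' : MemLp F' 2)
    (hd : ∀ x, HasDerivAt F (F' x) x) :
    ((𝓕 (hF'.toLp F' : Lp ℂ 2 (volume : Measure ℝ)) : Lp ℂ 2 (volume : Measure ℝ)) : ℝ → ℂ)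
      =ᵐ[volume] fun η => (2 * Real.pi * η * Complex.I) *
        (𝓕 (hF.toLp F : Lp ℂ 2 (volume : Measure ℝ)) : Lp ℂ 2 (volume : Measure ℝ)) η := by
  have hloc : LocallyIntegrable (fun η => (2 * Real.pi * η * Complex.I) *
        (𝓕 (hF.toLp F : Lp ℂ 2 (volume : Measure ℝ)) : Lp ℂ 2 (volume : Measure ℝ)) η) := by
    have : LocallyIntegrable
      ((𝓕 (hF.toLp F : Lp ℂ 2 (volume : Measure ℝ)) : Lp ℂ 2 (volume : Measure ℝ)) : ℝ → ℂ)
      volume := (Lp.memLp _).locallyIntegrable (by norm_num)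
    rw [← locallyIntegrableOn_univ] at this ⊢
    exact this.continuousOn_mul (g := fun η : ℝ => (2 * Real.pi * η * Complex.I : ℂ))
      (by fun_prop) isOpen_univ.isLocallyClosed
  refine ae_eq_of_integral_schwartz_mul
    ((Lp.memLp _).locallyIntegrable (by norm_num)) hloc fun ψ => ?_
  -- The multiplier `m` is moved onto the test function, where `(𝓕 ψ)' = -𝓕 (m ψ)`; integration by
  -- parts then carries the derivative over to `F`.
  set m : ℝ → ℂ := fun η => (2 * Real.pi * η * Complex.I : ℂ) with hm
  have hmt : m.HasTemperateGrowth := by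
    rw [hm]; fun_prop
  set ψ' : SchwartzMap ℝ ℂ := SchwartzMap.smulLeftCLM ℂ m ψ with hψ'
  have hψ'v : ∀ x, ψ' x = m x * ψ x := fun x => by
    rw [hψ', SchwartzMap.smulLeftCLM_apply_apply hmt, smul_eq_mul]
  have hder : ∀ x, HasDerivAt (𝓕 ψ : SchwartzMap ℝ ℂ) (-((𝓕 ψ' : SchwartzMap ℝ ℂ) x)) x := by
    intro x
    have h := Real.hasDerivAt_fourier (f := ψ) ψ.integrable
      (by
        have : Integrable (fun x => (2 * Real.pi * Complex.I : ℂ)⁻¹ * ψ' x) :=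
          ψ'.integrable.const_mul _
        refine this.congr (Eventually.of_forall fun x => ?_)
        simp only [hψ'v, hm, Complex.real_smul]
        field_simp) x
    rw [SchwartzMap.fourier_coe, SchwartzMap.fourier_coe]
    refine h.congr_deriv ?_
    rw [Real.fourier_real_eq, Real.fourier_real_eq, ← integral_neg]
    congr 1
    ext v
    rw [← smul_neg]
    congr 1
    simp only [hψ'v, hm, smul_eq_mul]
    ring
  have e1 : ∫ x, (𝓕 ψ) x • F' x = ∫ x, (𝓕 ψ') x • F x := by
    have h := integral_mul_deriv_eq_deriv_mul_of_integrable
      (u := (𝓕 ψ : SchwartzMap ℝ ℂ)) (v := F)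
      (u' := fun x => -((𝓕 ψ' : SchwartzMap ℝ ℂ) x)) (v' := F') (fun x _ => hder x) (fun x _ => hd x)
      (by exact MemLp.integrable_mul ((𝓕 ψ : SchwartzMap ℝ ℂ).memLp 2) hF')
      (by
        have : MemLp (fun x => -((𝓕 ψ' : SchwartzMap ℝ ℂ) x)) 2 := ((𝓕 ψ' : SchwartzMap ℝ ℂ).memLp 2).neg
        exact MemLp.integrable_mul this hF)
      (by exact MemLp.integrable_mul ((𝓕 ψ : SchwartzMap ℝ ℂ).memLp 2) hF)
    simp only [smul_eq_mul]
    rw [h, ← integral_neg]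
    congr 1
    ext x
    ring
  rw [integral_schwartz_mul_fourier]
  calc ∫ x, (𝓕 ψ) x • (hF'.toLp F') x = ∫ x, (𝓕 ψ) x • F' x := by
        refine integral_congr_ae ?_
        filter_upwards [hF'.coeFn_toLp] with x hx
        rw [hx]
    _ = ∫ x, (𝓕 ψ') x • F x := e1
    _ = ∫ x, (𝓕 ψ') x • (hF.toLp F) x := by
        refine integral_congr_ae ?_
        filter_upwards [hF.coeFn_toLp] with x hx
        rw [hx]
    _ = _ := by
        rw [← integral_schwartz_mul_fourier]
        congr 1
        ext x
        simp only [hψ'v, smul_eq_mul, hm]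
        ring

/-- The Fourier transform of an `L²` function, as a function. -/
def l2Fourier {φ : ℝ → ℂ} (h : MemLp φ 2) : ℝ → ℂ :=
  (𝓕 (h.toLp φ : Lp ℂ 2 (volume : Measure ℝ)) : Lp ℂ 2 (volume : Measure ℝ))

theorem memLp_l2Fourier {φ : ℝ → ℂ} (h : MemLp φ 2) : MemLp (l2Fourier h) 2 := Lp.memLp _

theorem integral_norm_sq_coe (f : Lp ℂ 2 (volume : Measure ℝ)) : ∫ x, ‖f x‖ ^ 2 = ‖f‖ ^ 2 := by
  have h := L2.inner_def (𝕜 := ℂ) f f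
  rw [inner_self_eq_norm_sq_to_K] at h
  have h2 : ∀ a, inner ℂ (f a) (f a) = ((‖f a‖ ^ 2 : ℝ) : ℂ) := fun a => by
    rw [inner_self_eq_norm_sq_to_K]; norm_cast
  simp_rw [h2] at h
  rw [integral_complex_ofReal] at h
  exact Complex.ofReal_injective (by rw [← h]; simp)

theorem integral_norm_sq_toLp {φ : ℝ → ℂ} (h : MemLp φ 2) :
    ‖(h.toLp φ : Lp ℂ 2 (volume : Measure ℝ))‖ ^ 2 = ∫ x, ‖φ x‖ ^ 2 := by
  rw [← integral_norm_sq_coe]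
  refine integral_congr_ae ?_
  filter_upwards [h.coeFn_toLp] with x hx
  rw [hx]

theorem integral_norm_sq_l2Fourier {φ : ℝ → ℂ} (h : MemLp φ 2) :
    ∫ η, ‖l2Fourier h η‖ ^ 2 = ∫ x, ‖φ x‖ ^ 2 := by
  rw [l2Fourier, integral_norm_sq_coe, Lp.norm_fourier_eq, integral_norm_sq_toLp]

/-! ### Sobolev embedding and interpolation for `H²` -/

theorem memLp_of_sobolevNorm_le {s : ℝ} {φ : ℝ → ℂ} {M : ℝ≥0} (h : sobolevNorm s φ ≤ M) :
    MemLp φ 2 := by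
  by_contra hn
  rw [sobolevNorm, weightedFourierSq, dif_neg hn, ENNReal.top_rpow_of_pos (by norm_num)] at h
  simp at h

theorem integral_weight_le {φ : ℝ → ℂ} {M : ℝ≥0} (h : sobolevNorm 2 φ ≤ M) (h2 : MemLp φ 2) :
    Integrable (fun η : ℝ => (1 + (2 * Real.pi * η) ^ 2) ^ 2 * ‖l2Fourier h2 η‖ ^ 2) ∧
      ∫ η : ℝ, (1 + (2 * Real.pi * η) ^ 2) ^ 2 * ‖l2Fourier h2 η‖ ^ 2 ≤ (M : ℝ) ^ 2 := by
  rw [sobolevNorm, weightedFourierSq, dif_pos h2] at h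
  have h' := ENNReal.rpow_le_rpow h (z := 2) (by norm_num)
  rw [← ENNReal.rpow_mul] at h'
  norm_num at h'
  have he : ∀ η : ℝ, ENNReal.ofReal ((1 + (2 * Real.pi * η) ^ 2) ^ 2) *
      ‖(𝓕 (h2.toLp φ : Lp ℂ 2 (volume : Measure ℝ)) : Lp ℂ 2 (volume : Measure ℝ)) η‖ₑ ^ 2
      = ENNReal.ofReal ((1 + (2 * Real.pi * η) ^ 2) ^ 2 * ‖l2Fourier h2 η‖ ^ 2) := fun η => by
    rw [ENNReal.ofReal_mul (by positivity), l2Fourier, ← ofReal_norm,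
      ENNReal.ofReal_pow (norm_nonneg _)]
  simp_rw [he] at h'
  have hm : AEStronglyMeasurable
      (fun η : ℝ => (1 + (2 * Real.pi * η) ^ 2) ^ 2 * ‖l2Fourier h2 η‖ ^ 2) :=
    AEStronglyMeasurable.mul (by fun_prop) ((memLp_l2Fourier h2).1.norm.pow 2)
  have hnn : 0 ≤ᵐ[volume] (fun η : ℝ => (1 + (2 * Real.pi * η) ^ 2) ^ 2 * ‖l2Fourier h2 η‖ ^ 2) :=
    Eventually.of_forall fun η => by positivity
  refine ⟨⟨hm, ?_⟩, ?_⟩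
  · rw [hasFiniteIntegral_iff_ofReal hnn]
    exact h'.trans_lt (by simp)
  · rw [integral_eq_lintegral_of_nonneg_ae hnn hm]
    refine ENNReal.toReal_le_of_le_ofReal (by positivity) (h'.trans ?_)
    rw [ENNReal.ofReal_pow (by positivity)]
    simp

/-- Regularity of a function of class `H²`, with all bounds given by one constant. -/
structure HTwoBound (A : ℝ) (φ : ℝ → ℂ) : Prop where
  hasDerivAt : ∀ x, HasDerivAt φ (deriv φ x) x
  norm_le : ∀ x, ‖φ x‖ ≤ A
  norm_deriv_le : ∀ x, ‖deriv φ x‖ ≤ A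
  holder : ∀ x y, ‖φ x - φ y‖ ≤ A * |x - y| ^ (1 / 4 : ℝ)
  holder_deriv : ∀ x y, ‖deriv φ x - deriv φ y‖ ≤ A * |x - y| ^ (1 / 4 : ℝ)
  memLp : MemLp φ 2
  memLp_deriv : MemLp (deriv φ) 2
  integral_sq_le : ∫ x, ‖φ x‖ ^ 2 ≤ A
  integral_deriv_sq_le : ∫ x, ‖deriv φ x‖ ^ 2 ≤ A
  tendsto_zero : Tendsto φ (cocompact ℝ) (𝓝 0)

/-- Interpolates between the two trivial bounds `2` and `|a - b|` for a difference of unimodular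
exponentials. Any Hölder exponent below `1/2` could be reached from `H²` for the first derivative;
`1/4` is the choice made throughout. -/
theorem min_le_rpow {x : ℝ} (hx : 0 ≤ x) : min 2 x ≤ 2 * x ^ (1 / 4 : ℝ) := by
  rcases le_total x 1 with h | h
  · refine (min_le_right _ _).trans ?_
    have := Real.rpow_le_rpow_of_exponent_ge' hx h (by norm_num) (show (1 / 4 : ℝ) ≤ 1 by norm_num)
    rw [Real.rpow_one] at this
    linarith [Real.rpow_nonneg hx (1 / 4)]
  · refine (min_le_left _ _).trans ?_
    have := Real.one_le_rpow h (show (0 : ℝ) ≤ 1 / 4 by norm_num)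
    linarith

theorem norm_exp_sub_exp_le (a b : ℝ) :
    ‖Complex.exp (a * Complex.I) - Complex.exp (b * Complex.I)‖ ≤ 2 * |a - b| ^ (1 / 4 : ℝ) := by
  refine le_trans (le_min ?_ ?_) (min_le_rpow (abs_nonneg (a - b)))
  · refine (norm_sub_le _ _).trans ?_
    rw [Complex.norm_exp_ofReal_mul_I, Complex.norm_exp_ofReal_mul_I]; norm_num
  · have : Complex.exp (a * Complex.I) - Complex.exp (b * Complex.I)
        = Complex.exp (b * Complex.I) * (Complex.exp (Complex.I * ((a - b : ℝ) : ℂ)) - 1) := by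
      rw [mul_sub, ← Complex.exp_add]
      push_cast
      ring_nf
    rw [this, norm_mul, Complex.norm_exp_ofReal_mul_I, one_mul]
    exact Real.norm_exp_I_mul_ofReal_sub_one_le

theorem norm_fourierInv_sub_le {G : ℝ → ℂ} (hG : Integrable G)
    (hG' : Integrable fun η : ℝ => |2 * Real.pi * η| ^ (1 / 4 : ℝ) * ‖G η‖) (x y : ℝ) :
    ‖(𝓕⁻ G) x - (𝓕⁻ G) y‖ ≤
      2 * (∫ η : ℝ, |2 * Real.pi * η| ^ (1 / 4 : ℝ) * ‖G η‖) * |x - y| ^ (1 / 4 : ℝ) := by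
  rw [Real.fourierInv_eq', Real.fourierInv_eq']
  have hint : ∀ x : ℝ, Integrable fun v : ℝ =>
      Complex.exp (((2 * Real.pi * inner ℝ v x : ℝ) : ℂ) * Complex.I) • G v := fun x => by
    refine Integrable.bdd_smul
      (φ := fun v : ℝ => Complex.exp (((2 * Real.pi * inner ℝ v x : ℝ) : ℂ) * Complex.I)) hG 1
      (Continuous.aestronglyMeasurable (by fun_prop)) ?_
    exact Eventually.of_forall fun v => by rw [Complex.norm_exp_ofReal_mul_I]
  rw [← integral_sub (hint x) (hint y), mul_assoc, mul_comm _ (|x - y| ^ (1 / 4 : ℝ)),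
    ← integral_const_mul, ← integral_const_mul]
  refine norm_integral_le_of_norm_le ((hG'.const_mul _).const_mul _) (Eventually.of_forall fun v => ?_)
  rw [← sub_smul, norm_smul]
  have h := norm_exp_sub_exp_le (2 * Real.pi * inner ℝ v x) (2 * Real.pi * inner ℝ v y)
  have e : 2 * Real.pi * inner ℝ v x - 2 * Real.pi * inner ℝ v y = (2 * Real.pi * v) * (x - y) := by
    simp; ring
  rw [e, abs_mul, Real.mul_rpow (abs_nonneg _) (abs_nonneg _)] at h
  calc _ ≤ (2 * (|2 * Real.pi * v| ^ (1 / 4 : ℝ) * |x - y| ^ (1 / 4 : ℝ))) * ‖G v‖ := by gcongr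
    _ = _ := by ring

theorem norm_fourierInv_le {G : ℝ → ℂ} (x : ℝ) : ‖(𝓕⁻ G) x‖ ≤ ∫ η, ‖G η‖ := by
  rw [Real.fourierInv_eq']
  refine (norm_integral_le_integral_norm _).trans (le_of_eq ?_)
  congr 1
  ext v
  rw [norm_smul, Complex.norm_exp_ofReal_mul_I, one_mul]

theorem hasDerivAt_fourierInv {G : ℝ → ℂ} (hG : Integrable G)
    (hG' : Integrable fun η : ℝ => (2 * Real.pi * η * Complex.I) * G η) (x : ℝ) :
    HasDerivAt (𝓕⁻ G) ((𝓕⁻ fun η : ℝ => (2 * Real.pi * η * Complex.I) * G η) x) x := by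
  have e : ∀ H : ℝ → ℂ, 𝓕⁻ H = 𝓕 (fun x => H (-x)) := Real.fourierInv_eq_fourier_comp_neg
  rw [e, e]
  have h := Real.hasDerivAt_fourier (f := fun x => G (-x)) hG.comp_neg (by
    have := (hG'.const_mul (2 * Real.pi * Complex.I : ℂ)⁻¹).comp_neg
    have := this.neg
    refine this.congr (Eventually.of_forall fun x => ?_)
    simp only [Pi.neg_apply, Complex.real_smul]
    push_cast
    field_simp) x
  refine h.congr_deriv (congrArg (fun H : ℝ → ℂ => 𝓕 H x) (funext fun v => ?_))
  simp only [smul_eq_mul]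
  push_cast
  ring

theorem exists_integrable_weight : Integrable
    (fun η : ℝ => (1 + (2 * Real.pi * η) ^ 2) ^ (-(3 / 4) : ℝ)) := by
  have h := integrable_rpow_neg_one_add_norm_sq (E := ℝ) (μ := volume) (r := 3 / 2)
    (by simp; norm_num)
  have h2 := h.comp_mul_left' (R := 2 * Real.pi) (by positivity)
  refine h2.congr (Eventually.of_forall fun η => ?_)
  simp only [Real.norm_eq_abs, sq_abs]
  norm_num

/-- The extreme exponent `5/4` is one derivative plus the Hölder exponent `1/4`, so this single
weight dominates every multiplier needed for the embedding. -/
theorem rpow_le_weight (x : ℝ) {p : ℝ} (h0 : 0 ≤ p) (h1 : p ≤ 5 / 4) :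
    |x| ^ p ≤ (1 + x ^ 2) ^ (5 / 8 : ℝ) := by
  have h : |x| ≤ (1 + x ^ 2) ^ (1 / 2 : ℝ) := by
    rw [← Real.sqrt_eq_rpow]
    exact Real.abs_le_sqrt (by linarith)
  calc |x| ^ p ≤ ((1 + x ^ 2) ^ (1 / 2 : ℝ)) ^ p := Real.rpow_le_rpow (abs_nonneg _) h h0
    _ = (1 + x ^ 2) ^ (1 / 2 * p) := by rw [← Real.rpow_mul (by positivity)]
    _ ≤ _ := Real.rpow_le_rpow_of_exponent_le (by nlinarith [sq_nonneg x]) (by linarith)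

/-- Write the left side as `(W a) · W^(-3/8)` with `W = 1 + x²` and use the inequality between
arithmetic and geometric means. The first square is the `H²` density and the second, `W^(-3/4) ~
|x|^(-3/2)`, is integrable. -/
theorem weight_mul_le (x : ℝ) (a : ℝ) :
    (1 + x ^ 2) ^ (5 / 8 : ℝ) * a ≤ (1 + x ^ 2) ^ 2 * a ^ 2 + (1 + x ^ 2) ^ (-(3 / 4) : ℝ) := by
  have hp : 0 < 1 + x ^ 2 := by positivity
  set W := 1 + x ^ 2
  have e1 : W ^ (5 / 8 : ℝ) = W * W ^ (-(3 / 8) : ℝ) := by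
    nth_rewrite 2 [← Real.rpow_one W]
    rw [← Real.rpow_add hp]; norm_num
  have e2 : W ^ (-(3 / 4) : ℝ) = (W ^ (-(3 / 8) : ℝ)) ^ 2 := by
    rw [← Real.rpow_natCast, ← Real.rpow_mul hp.le]; norm_num
  rw [e1, e2]
  nlinarith [sq_nonneg (W * a - W ^ (-(3 / 8) : ℝ)), sq_nonneg (W * a),
    sq_nonneg (W ^ (-(3 / 8) : ℝ))]

/-- The Sobolev embedding `H² ⊂ C^{1,1/4}`. -/
theorem exists_hTwoBound (M : ℝ≥0) : ∃ A : ℝ, 0 ≤ A ∧ ∀ φ : ℝ → ℂ, Continuous φ →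
    sobolevNorm 2 φ ≤ M → HTwoBound A φ := by
  set I := ∫ η : ℝ, (1 + (2 * Real.pi * η) ^ 2) ^ (-(3 / 4) : ℝ) with hI
  have hI0 : 0 ≤ I := integral_nonneg fun η => by positivity
  set K : ℝ := (M : ℝ) ^ 2 + I with hK
  have hK0 : 0 ≤ K := by positivity
  -- `K` bounds all weighted `L¹` norms of the transform; the factor `2` is the one in the Hölder
  -- estimate `norm_fourierInv_sub_le`.
  refine ⟨2 * K, by positivity, fun φ hc hφ => ?_⟩
  have h2 := memLp_of_sobolevNorm_le hφ
  obtain ⟨hw, hwM⟩ := integral_weight_le hφ h2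
  set P := l2Fourier h2 with hP
  have hPm : AEStronglyMeasurable P volume := (memLp_l2Fourier h2).1
  -- weighted `L¹` bounds
  have key : ∀ H : ℝ → ℂ, AEStronglyMeasurable H volume →
      (∀ η : ℝ, ‖H η‖ ≤ (1 + (2 * Real.pi * η) ^ 2) ^ (5 / 8 : ℝ) * ‖P η‖) →
      Integrable H ∧ ∫ η, ‖H η‖ ≤ K := by
    intro H hHm hH
    have hb : ∀ η : ℝ, ‖H η‖ ≤ (1 + (2 * Real.pi * η) ^ 2) ^ 2 * ‖P η‖ ^ 2 +
        (1 + (2 * Real.pi * η) ^ 2) ^ (-(3 / 4) : ℝ) := fun η =>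
      (hH η).trans (weight_mul_le _ _)
    have hi := hw.add exists_integrable_weight
    have hHi : Integrable H := hi.mono' hHm (Eventually.of_forall hb)
    refine ⟨hHi, (integral_mono hHi.norm hi hb).trans ?_⟩
    simp only [Pi.add_apply]
    rw [integral_add hw exists_integrable_weight]
    linarith
  have hone : ∀ x : ℝ, 1 ≤ (1 + x ^ 2) ^ (5 / 8 : ℝ) := fun x => by
    simpa using rpow_le_weight x (p := 0) le_rfl (by norm_num)
  set Q : ℝ → ℂ := fun η : ℝ => (2 * Real.pi * η * Complex.I) * P η with hQ
  have hQn : ∀ η, ‖Q η‖ = |2 * Real.pi * η| * ‖P η‖ := fun η => by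
    rw [hQ]; simp [abs_mul, abs_of_pos Real.pi_pos]
  have hQm : AEStronglyMeasurable Q volume :=
    AEStronglyMeasurable.mul (Continuous.aestronglyMeasurable (by fun_prop)) hPm
  obtain ⟨hP1, hP1K⟩ := key P hPm fun η => le_mul_of_one_le_left (norm_nonneg _) (hone _)
  obtain ⟨hQ1, hQ1K⟩ := key Q hQm fun η => by
    rw [hQn]
    gcongr
    simpa using rpow_le_weight (2 * Real.pi * η) (p := 1) (by norm_num) (by norm_num)
  have holderW : ∀ H : ℝ → ℂ, AEStronglyMeasurable H volume →
      (∀ η : ℝ, |2 * Real.pi * η| ^ (1 / 4 : ℝ) * ‖H η‖ ≤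
        (1 + (2 * Real.pi * η) ^ 2) ^ (5 / 8 : ℝ) * ‖P η‖) →
      Integrable (fun η : ℝ => |2 * Real.pi * η| ^ (1 / 4 : ℝ) * ‖H η‖) ∧
      ∫ η : ℝ, |2 * Real.pi * η| ^ (1 / 4 : ℝ) * ‖H η‖ ≤ K := by
    intro H hHm hH
    have hm : AEStronglyMeasurable (fun η : ℝ => |2 * Real.pi * η| ^ (1 / 4 : ℝ) * ‖H η‖) volume :=
      AEStronglyMeasurable.mul (Measurable.aestronglyMeasurable (by fun_prop)) hHm.norm
    have h := key (fun η : ℝ => ((|2 * Real.pi * η| ^ (1 / 4 : ℝ) * ‖H η‖ : ℝ) : ℂ))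
      (Complex.continuous_ofReal.comp_aestronglyMeasurable hm) fun η => by
        rw [Complex.norm_real, Real.norm_of_nonneg (by positivity)]
        exact hH η
    have e : ∀ η, ‖((|2 * Real.pi * η| ^ (1 / 4 : ℝ) * ‖H η‖ : ℝ) : ℂ)‖ =
        |2 * Real.pi * η| ^ (1 / 4 : ℝ) * ‖H η‖ := fun η => by
      rw [Complex.norm_real, Real.norm_of_nonneg (by positivity)]
    refine ⟨h.1.norm.congr (Eventually.of_forall e), ?_⟩
    have h' := h.2
    simp_rw [e] at h'
    exact h'
  obtain ⟨hPh, hPhK⟩ := holderW P hPm fun η => by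
    gcongr
    exact rpow_le_weight _ (by norm_num) (by norm_num)
  obtain ⟨hQh, hQhK⟩ := holderW Q hQm fun η => by
    rw [hQn, ← mul_assoc]
    gcongr
    refine le_trans (le_of_eq ?_) (rpow_le_weight (2 * Real.pi * η) (p := 5 / 4) (by norm_num) le_rfl)
    nth_rewrite 2 [← Real.rpow_one |2 * Real.pi * η|]
    rw [← Real.rpow_add_of_nonneg (abs_nonneg _) (by norm_num) (by norm_num)]
    norm_num
  -- Inversion in `L²` gives equality almost everywhere; continuity of both sides makes it
  -- pointwise.
  have hφe : φ = 𝓕⁻ P := by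
    refine (Continuous.ae_eq_iff_eq volume hc (continuous_fourierInv_of_integrable hP1)).1 ?_
    have e := fourierInv_toLp_ae_eq (memLp_l2Fourier h2) hP1
    have e2 : (memLp_l2Fourier h2).toLp (l2Fourier h2) =
        (𝓕 (h2.toLp φ : Lp ℂ 2 (volume : Measure ℝ)) : Lp ℂ 2 (volume : Measure ℝ)) :=
      Lp.toLp_coeFn _ _
    rw [e2, FourierTransform.fourierInv_fourier_eq] at e
    exact h2.coeFn_toLp.symm.trans e
  have hder : ∀ x, HasDerivAt φ ((𝓕⁻ Q) x) x := fun x => by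
    rw [hφe]; exact hasDerivAt_fourierInv hP1 hQ1 x
  have hde : deriv φ = 𝓕⁻ Q := funext fun x => (hder x).deriv
  have hxx : ∀ x : ℝ, x ^ 2 ≤ (1 + x ^ 2) ^ 2 := fun x => by nlinarith [sq_nonneg x, sq_nonneg (x ^ 2)]
  have hQsq : ∀ η, ‖Q η‖ ^ 2 ≤ (1 + (2 * Real.pi * η) ^ 2) ^ 2 * ‖P η‖ ^ 2 := fun η => by
    rw [hQn, mul_pow, sq_abs]
    exact mul_le_mul_of_nonneg_right (hxx _) (by positivity)
  have hQ2i : Integrable fun η => ‖Q η‖ ^ 2 :=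
    hw.mono' (hQm.norm.pow 2) (Eventually.of_forall fun η => by
      rw [Real.norm_of_nonneg (by positivity)]; exact hQsq η)
  have hQ2 : MemLp Q 2 := (memLp_two_iff_integrable_sq_norm hQm).2 hQ2i
  have hQe := fourierInv_toLp_ae_eq hQ2 hQ1
  have hd2 : MemLp (deriv φ) 2 := by
    rw [hde]
    exact (Lp.memLp _).ae_eq hQe
  have hle1 : ∀ x : ℝ, (1 : ℝ) ≤ (1 + x ^ 2) ^ 2 := fun x => by nlinarith [sq_nonneg x, sq_nonneg (x ^ 2)]
  refine ⟨fun x => (hder x).differentiableAt.hasDerivAt, fun x => ?_, fun x => ?_, fun x y => ?_,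
    fun x y => ?_, h2, hd2, ?_, ?_, ?_⟩
  · rw [hφe]; exact (norm_fourierInv_le x).trans (by linarith)
  · rw [hde]; exact (norm_fourierInv_le x).trans (by linarith)
  · rw [hφe]; exact (norm_fourierInv_sub_le hP1 hPh x y).trans (by gcongr)
  · rw [hde]; exact (norm_fourierInv_sub_le hQ1 hQh x y).trans (by gcongr)
  · rw [← integral_norm_sq_l2Fourier h2]
    refine (integral_mono ((memLp_two_iff_integrable_sq_norm hPm).1 (memLp_l2Fourier h2)) hw
      fun η => ?_).trans (hwM.trans (by linarith))
    exact le_mul_of_one_le_left (by positivity) (hle1 _)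
  · have e : ∫ x, ‖deriv φ x‖ ^ 2 = ∫ η, ‖Q η‖ ^ 2 := by
      have hn : ‖(𝓕⁻ (hQ2.toLp Q : Lp ℂ 2 (volume : Measure ℝ)) : Lp ℂ 2 (volume : Measure ℝ))‖
          = ‖(hQ2.toLp Q : Lp ℂ 2 (volume : Measure ℝ))‖ := by
        rw [← Lp.norm_fourier_eq, FourierTransform.fourier_fourierInv_eq]
      rw [← integral_norm_sq_toLp hQ2, ← hn, ← integral_norm_sq_coe, hde]
      refine integral_congr_ae ?_
      filter_upwards [hQe] with x hx
      rw [hx]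
    rw [e]
    exact (integral_mono hQ2i hw hQsq).trans (hwM.trans (by linarith))
  · rw [hφe, Real.fourierInv_eq_fourier_comp_neg]
    exact Real.zero_at_infty_fourier _

/-- Interpolation between `L²` and `H²`. -/
theorem integral_deriv_sub_sq_le {M : ℝ≥0} {φ ψ : ℝ → ℂ} {A : ℝ} (hφ : sobolevNorm 2 φ ≤ M)
    (hψ : sobolevNorm 2 ψ ≤ M) (hA : HTwoBound A φ) (hB : HTwoBound A ψ) {ε : ℝ} (hε : 0 < ε) :
    ∫ x, ‖deriv φ x - deriv ψ x‖ ^ 2 ≤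
      4 * (M : ℝ) ^ 2 * ε + 1 / (4 * ε) * ∫ x, ‖φ x - ψ x‖ ^ 2 := by
  have hd2 : MemLp (φ - ψ) 2 := hA.memLp.sub hB.memLp
  have hd2' : MemLp (deriv φ - deriv ψ) 2 := hA.memLp_deriv.sub hB.memLp_deriv
  have hF := fourier_toLp_deriv hd2 hd2' fun x => (hA.hasDerivAt x).sub (hB.hasDerivAt x)
  obtain ⟨hw1, hw1M⟩ := integral_weight_le hφ hA.memLp
  obtain ⟨hw2, hw2M⟩ := integral_weight_le hψ hB.memLp
  have hsub : l2Fourier hd2 =ᵐ[volume] fun η => l2Fourier hA.memLp η - l2Fourier hB.memLp η := by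
    have e : (𝓕 (hd2.toLp (φ - ψ) : Lp ℂ 2 (volume : Measure ℝ)) : Lp ℂ 2 (volume : Measure ℝ)) =
        𝓕 (hA.memLp.toLp φ) - 𝓕 (hB.memLp.toLp ψ) := by
      rw [MemLp.toLp_sub]
      exact map_sub (Lp.fourierTransformₗᵢ ℝ ℂ) _ _
    unfold l2Fourier
    rw [e]
    exact Lp.coeFn_sub _ _
  have h1 : ∫ x, ‖deriv φ x - deriv ψ x‖ ^ 2 = ∫ η, ‖l2Fourier hd2' η‖ ^ 2 :=
    (integral_norm_sq_l2Fourier hd2').symm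
  have h2 : ∫ x, ‖φ x - ψ x‖ ^ 2 = ∫ η, ‖l2Fourier hd2 η‖ ^ 2 :=
    (integral_norm_sq_l2Fourier hd2).symm
  have hi : Integrable fun η => ‖l2Fourier hd2 η‖ ^ 2 :=
    (memLp_two_iff_integrable_sq_norm (memLp_l2Fourier hd2).1).1 (memLp_l2Fourier hd2)
  rw [h1, h2, ← integral_const_mul]
  have hpt : (fun η => ‖l2Fourier hd2' η‖ ^ 2) ≤ᵐ[volume] fun η : ℝ =>
      (2 * ε) * ((1 + (2 * Real.pi * η) ^ 2) ^ 2 * ‖l2Fourier hA.memLp η‖ ^ 2) +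
      (2 * ε) * ((1 + (2 * Real.pi * η) ^ 2) ^ 2 * ‖l2Fourier hB.memLp η‖ ^ 2) +
      1 / (4 * ε) * ‖l2Fourier hd2 η‖ ^ 2 := by
    filter_upwards [hF, hsub] with η h3 h4
    change l2Fourier hd2' η = _ * l2Fourier hd2 η at h3
    rw [h3, norm_mul, mul_pow]
    have e : ‖(2 * Real.pi * η * Complex.I : ℂ)‖ ^ 2 = (2 * Real.pi * η) ^ 2 := by
      simp [mul_pow]
    rw [e]
    set W := 1 + (2 * Real.pi * η) ^ 2 with hW
    -- The multiplier `ξ²` of one derivative squared is split, by completing a square, into a small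
    -- multiple of the `H²` weight and a large multiple of the `L²` weight.
    have hWx : (2 * Real.pi * η) ^ 2 ≤ ε * W ^ 2 + 1 / (4 * ε) := by
      have : (2 * Real.pi * η) ^ 2 ≤ W := by rw [hW]; linarith
      have h5 : ε * W ^ 2 + 1 / (4 * ε) - W = ε * (W - 1 / (2 * ε)) ^ 2 := by field_simp; ring
      have h6 : 0 ≤ ε * (W - 1 / (2 * ε)) ^ 2 := by positivity
      linarith
    have hd : ‖l2Fourier hd2 η‖ ^ 2 ≤ 2 * ‖l2Fourier hA.memLp η‖ ^ 2 + 2 * ‖l2Fourier hB.memLp η‖ ^ 2 := by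
      rw [h4]
      have := norm_sub_le (l2Fourier hA.memLp η) (l2Fourier hB.memLp η)
      nlinarith [norm_nonneg (l2Fourier hA.memLp η - l2Fourier hB.memLp η),
        sq_nonneg (‖l2Fourier hA.memLp η‖ - ‖l2Fourier hB.memLp η‖)]
    calc (2 * Real.pi * η) ^ 2 * ‖l2Fourier hd2 η‖ ^ 2
        ≤ (ε * W ^ 2 + 1 / (4 * ε)) * ‖l2Fourier hd2 η‖ ^ 2 := by gcongr
      _ = ε * W ^ 2 * ‖l2Fourier hd2 η‖ ^ 2 + 1 / (4 * ε) * ‖l2Fourier hd2 η‖ ^ 2 := by ring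
      _ ≤ ε * W ^ 2 * (2 * ‖l2Fourier hA.memLp η‖ ^ 2 + 2 * ‖l2Fourier hB.memLp η‖ ^ 2) +
          1 / (4 * ε) * ‖l2Fourier hd2 η‖ ^ 2 := by gcongr
      _ = _ := by ring
  have hi' : Integrable fun η : ℝ =>
      (2 * ε) * ((1 + (2 * Real.pi * η) ^ 2) ^ 2 * ‖l2Fourier hA.memLp η‖ ^ 2) +
      (2 * ε) * ((1 + (2 * Real.pi * η) ^ 2) ^ 2 * ‖l2Fourier hB.memLp η‖ ^ 2) :=
    (hw1.const_mul (2 * ε)).add (hw2.const_mul (2 * ε))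
  refine (integral_mono_ae ((memLp_two_iff_integrable_sq_norm (memLp_l2Fourier hd2').1).1
    (memLp_l2Fourier hd2')) (hi'.add (hi.const_mul _)) hpt).trans ?_
  simp only [Pi.add_apply]
  rw [integral_add hi' (hi.const_mul _), integral_add (hw1.const_mul _) (hw2.const_mul _),
    integral_const_mul, integral_const_mul]
  have : 0 ≤ 2 * ε := by positivity
  nlinarith

/-! ### Boundary values of holomorphic functions in the lower half plane -/

/-- Holomorphic in the lower half plane, continuous up to the boundary, and vanishing at
infinity. -/
structure IsHolomorphicDecaying (F : ℂ → ℂ) : Prop where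
  continuousOn : ContinuousOn F closedLowerHalfPlane
  differentiableOn : DifferentiableOn ℂ F lowerHalfPlane
  tendsto_zero : Tendsto F (Bornology.cobounded ℂ ⊓ 𝓟 closedLowerHalfPlane) (𝓝 0)

theorem IsHolomorphicDecaying.eventually_le {F : ℂ → ℂ} (hF : IsHolomorphicDecaying F) {ε : ℝ}
    (hε : 0 < ε) : ∀ᶠ R in atTop, ∀ z ∈ closedLowerHalfPlane, R ≤ ‖z‖ → ‖F z‖ ≤ ε := by
  have h := hF.tendsto_zero.eventually (Metric.closedBall_mem_nhds (0 : ℂ) hε)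
  rw [eventually_inf_principal, (hasBasis_cobounded_norm (E := ℂ)).eventually_iff] at h
  obtain ⟨R, -, hR⟩ := h
  filter_upwards [eventually_ge_atTop R] with R' hR' z hz hzR
  simpa using hR (show R ≤ ‖z‖ from hR'.trans hzR) hz

/-- Cauchy's theorem for the lower half plane. -/
theorem IsHolomorphicDecaying.integral_mul_eq_zero {F K : ℂ → ℂ} (hF : IsHolomorphicDecaying F)
    (hKc : ContinuousOn K closedLowerHalfPlane) (hKd : DifferentiableOn ℂ K lowerHalfPlane)
    {C : ℝ} (hK : ∀ z ∈ closedLowerHalfPlane, ‖K z‖ * ‖z‖ ≤ C)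
    (hint : Integrable fun x : ℝ => F x * K x) : ∫ x : ℝ, F x * K x = 0 := by
  have hC : 0 ≤ C := (by positivity : (0 : ℝ) ≤ ‖K 0‖ * ‖(0 : ℂ)‖).trans
    (hK 0 (by simp [closedLowerHalfPlane]))
  have hlim := intervalIntegral_tendsto_integral hint tendsto_neg_atTop_atBot tendsto_id
  refine tendsto_nhds_unique hlim (Metric.tendsto_nhds.2 fun ε hε => ?_)
  -- Cauchy's theorem is applied on the rectangle `[-R, R] × [-R, 0]`. The three sides off the real
  -- axis have total length `4R`, and on them `‖K‖ ≤ C/R` and `‖F‖ ≤ ε/(4C+1)`, so they contribute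
  -- less than `ε`; the `+1` covers `C = 0`.
  have hε' : 0 < ε / (4 * C + 1) := by positivity
  filter_upwards [hF.eventually_le hε', eventually_gt_atTop 0] with R hR hR0
  set f : ℂ → ℂ := fun z => F z * K z with hf
  have hbd : ∀ z ∈ closedLowerHalfPlane, R ≤ ‖z‖ → ‖f z‖ ≤ ε / (4 * C + 1) * (C / R) := by
    intro z hz hzR
    rw [hf, norm_mul]
    refine mul_le_mul (hR z hz hzR) ?_ (norm_nonneg _) hε'.le
    rw [le_div_iff₀ hR0]
    exact (mul_le_mul_of_nonneg_left hzR (norm_nonneg _)).trans (hK z hz)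
  have hrect := Complex.integral_boundary_rect_eq_zero_of_continuousOn_of_differentiableOn f
    (⟨-R, -R⟩ : ℂ) (⟨R, 0⟩ : ℂ)
    ((hF.continuousOn.mul hKc).mono fun z hz => by
      have := hz.2
      simp only [mem_preimage, uIcc_of_le (neg_nonpos.2 hR0.le)] at this
      exact this.2)
    ((hF.differentiableOn.mul hKd).mono fun z hz => by
      have := hz.2
      simp only [mem_preimage, max_eq_right (neg_nonpos.2 hR0.le)] at this
      exact this.2)
  simp only [Complex.ofReal_zero, zero_mul, add_zero] at hrect
  have b1 : ‖∫ x : ℝ in (-R)..R, f (x + (-R : ℝ) * Complex.I)‖ ≤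
      ε / (4 * C + 1) * (C / R) * |R - -R| := by
    refine intervalIntegral.norm_integral_le_of_norm_le_const fun x _ => hbd _ ?_ ?_
    · simp [closedLowerHalfPlane, hR0.le]
    · refine le_trans ?_ (Complex.abs_im_le_norm _)
      simp [abs_of_pos hR0]
  have b2 : ‖∫ y : ℝ in (-R)..0, f ((R : ℝ) + y * Complex.I)‖ ≤
      ε / (4 * C + 1) * (C / R) * |0 - -R| := by
    refine intervalIntegral.norm_integral_le_of_norm_le_const fun x hx => hbd _ ?_ ?_
    · rw [uIoc_of_le (neg_nonpos.2 hR0.le)] at hx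
      simpa [closedLowerHalfPlane] using hx.2
    · refine le_trans ?_ (Complex.abs_re_le_norm _)
      simp [abs_of_pos hR0]
  have b3 : ‖∫ y : ℝ in (-R)..0, f ((-R : ℝ) + y * Complex.I)‖ ≤
      ε / (4 * C + 1) * (C / R) * |0 - -R| := by
    refine intervalIntegral.norm_integral_le_of_norm_le_const fun x hx => hbd _ ?_ ?_
    · rw [uIoc_of_le (neg_nonpos.2 hR0.le)] at hx
      simpa [closedLowerHalfPlane] using hx.2
    · refine le_trans ?_ (Complex.abs_re_le_norm _)
      simp [abs_of_pos hR0]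
  have e1 : |R - -R| = 2 * R := by rw [abs_of_pos (by linarith)]; ring
  have e2 : |0 - -R| = R := by rw [abs_of_pos (by linarith)]; ring
  rw [e1] at b1
  rw [e2] at b2 b3
  have hsol : ∫ x : ℝ in (-R)..R, f x = (∫ x : ℝ in (-R)..R, f (x + (-R : ℝ) * Complex.I)) +
      Complex.I • (∫ y : ℝ in (-R)..0, f ((R : ℝ) + y * Complex.I)) -
      Complex.I • ∫ y : ℝ in (-R)..0, f ((-R : ℝ) + y * Complex.I) := by
    linear_combination -hrect
  rw [dist_zero_right]
  change ‖∫ x : ℝ in (-R)..R, f x‖ < ε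
  rw [hsol]
  refine (norm_sub_le _ _).trans_lt ?_
  have h4 := norm_add_le (∫ x : ℝ in (-R)..R, f (x + (-R : ℝ) * Complex.I))
    (Complex.I • (∫ y : ℝ in (-R)..0, f ((R : ℝ) + y * Complex.I)))
  rw [norm_smul, Complex.norm_I, one_mul] at h4 ⊢
  have h5 : ε / (4 * C + 1) * (C / R) * (2 * R) + ε / (4 * C + 1) * (C / R) * R +
      ε / (4 * C + 1) * (C / R) * R = ε * (4 * C / (4 * C + 1)) := by
    field_simp; ring
  have h6 : 4 * C / (4 * C + 1) < 1 := by
    rw [div_lt_one (by positivity)]; linarith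
  have h7 : ε * (4 * C / (4 * C + 1)) < ε := by nlinarith
  linarith

theorem sub_ne_zero_of_im {z w : ℂ} (hz : z.im ≤ 0) (hw : 0 < w.im) : z - w ≠ 0 := by
  intro h
  have := congrArg Complex.im h
  simp at this
  linarith

theorem norm_inv_sub_mul_le {z w : ℂ} (hz : z.im ≤ 0) (hw : 0 < w.im) :
    ‖(z - w)⁻¹‖ * ‖z‖ ≤ 1 + ‖w‖ / w.im ∧ ‖(z - w)⁻¹‖ ≤ 1 / w.im := by
  have h1 : w.im ≤ ‖z - w‖ := by
    refine le_trans ?_ (Complex.abs_im_le_norm _)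
    rw [Complex.sub_im, abs_of_neg (by linarith)]; linarith
  have h0 : 0 < ‖z - w‖ := hw.trans_le h1
  rw [norm_inv]
  refine ⟨?_, by rw [one_div]; exact inv_anti₀ hw h1⟩
  rw [inv_mul_le_iff₀ h0, mul_add, mul_one]
  have h2 : ‖z‖ ≤ ‖z - w‖ + ‖w‖ := by
    simpa using norm_add_le (z - w) w
  have h3 : ‖w‖ ≤ ‖z - w‖ * (‖w‖ / w.im) := by
    calc ‖w‖ = w.im * (‖w‖ / w.im) := by field_simp
      _ ≤ _ := by gcongr
  linarith

theorem continuous_inv_sub {w : ℂ} (hw : w.im ≠ 0) : Continuous fun x : ℝ => ((x : ℂ) - w)⁻¹ := by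
  refine Continuous.inv₀ (by fun_prop) fun x h => hw ?_
  have := congrArg Complex.im h
  simpa using this

theorem memLp_inv_sub {w : ℂ} (hw : w.im ≠ 0) : MemLp (fun x : ℝ => ((x : ℂ) - w)⁻¹) 2 := by
  rw [memLp_two_iff_integrable_sq_norm (continuous_inv_sub hw).aestronglyMeasurable]
  -- The constant comes from `x² ≤ 2(x - Re w)² + 2(Re w)²` and `1 + 2(Re w)² ≤ ((1 + 2(Re w)²)/(Im
  -- w)²) |x - w|²`.
  refine ((integrable_inv_one_add_sq).const_mul (2 + (1 + 2 * w.re ^ 2) / w.im ^ 2)).mono'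
    ((continuous_inv_sub hw).norm.pow 2).aestronglyMeasurable (Eventually.of_forall fun x => ?_)
  have hi : 0 < w.im ^ 2 := by positivity
  have e : ‖(x : ℂ) - w‖ ^ 2 = (x - w.re) ^ 2 + w.im ^ 2 := by
    rw [Complex.sq_norm, Complex.normSq_apply]; simp; ring
  rw [Real.norm_of_nonneg (by positivity), norm_inv, inv_pow, e, ← div_eq_mul_inv,
    inv_le_comm₀ (by positivity) (by positivity), inv_div, div_le_iff₀ (by positivity)]
  have h1 : (1 + 2 * w.re ^ 2) ≤ ((1 + 2 * w.re ^ 2) / w.im ^ 2) * ((x - w.re) ^ 2 + w.im ^ 2) := by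
    rw [div_mul_eq_mul_div, le_div_iff₀ hi]
    gcongr
    nlinarith [sq_nonneg (x - w.re)]
  nlinarith [sq_nonneg (x - 2 * w.re)]

/-- The Cauchy integrals of `ψ` over the real line vanish at all points of the upper half plane. -/
def CauchyVanishing (ψ : ℝ → ℂ) : Prop :=
  ∀ w : ℂ, 0 < w.im → ∫ x : ℝ, ψ x * ((x : ℂ) - w)⁻¹ = 0

theorem differentiableOn_inv_sub {w : ℂ} (hw : 0 < w.im) {s : Set ℂ}
    (hs : s ⊆ closedLowerHalfPlane) : DifferentiableOn ℂ (fun z => (z - w)⁻¹) s :=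
  DifferentiableOn.inv (by fun_prop) fun _ hz => sub_ne_zero_of_im (hs hz) hw

theorem lowerHalfPlane_subset : lowerHalfPlane ⊆ closedLowerHalfPlane := fun z hz =>
  show z.im ≤ 0 from le_of_lt hz

theorem IsHolomorphicDecaying.cauchyVanishing {F : ℂ → ℂ} (hF : IsHolomorphicDecaying F)
    (h2 : MemLp (fun x : ℝ => F x) 2) : CauchyVanishing fun x : ℝ => F x := fun _ hw =>
  hF.integral_mul_eq_zero (differentiableOn_inv_sub hw le_rfl).continuousOn
    (differentiableOn_inv_sub hw lowerHalfPlane_subset)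
    (fun _ hz => (norm_inv_sub_mul_le hz hw).1)
    (MemLp.integrable_mul h2 (memLp_inv_sub hw.ne'))

/-- Nothing is assumed about the complex derivative of `F` near the boundary. Integration by parts
on the real line moves the derivative to the kernel, and Cauchy's theorem is applied to `F` with the
kernel `(z - w)⁻²`. -/
theorem IsHolomorphicDecaying.cauchyVanishing_deriv {F : ℂ → ℂ} (hF : IsHolomorphicDecaying F)
    (h2 : MemLp (fun x : ℝ => F x) 2) {φ' : ℝ → ℂ} (hd : ∀ x : ℝ, HasDerivAt (fun x : ℝ => F x) (φ' x) x)
    (h2' : MemLp φ' 2) : CauchyVanishing φ' := by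
  intro w hw
  have hm2 : MemLp (fun x : ℝ => (((x : ℂ) - w)⁻¹) ^ 2) 2 := by
    refine ((memLp_inv_sub hw.ne').const_mul ((1 / w.im : ℝ) : ℂ)).mono
      ((continuous_inv_sub hw.ne').pow 2).aestronglyMeasurable (Eventually.of_forall fun x => ?_)
    rw [pow_two, norm_mul, norm_mul, Complex.norm_real, Real.norm_of_nonneg (by positivity)]
    gcongr
    exact (norm_inv_sub_mul_le (by simp) hw).2
  have h0 : ∫ x : ℝ, F x * (((x : ℂ) - w)⁻¹) ^ 2 = 0 := by
    refine hF.integral_mul_eq_zero (K := fun z => ((z - w)⁻¹) ^ 2)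
      (C := 1 / w.im * (1 + ‖w‖ / w.im))
      ((differentiableOn_inv_sub hw le_rfl).pow 2).continuousOn
      ((differentiableOn_inv_sub hw lowerHalfPlane_subset).pow 2) (fun z hz => ?_)
      (MemLp.integrable_mul h2 hm2)
    obtain ⟨h3, h4⟩ := norm_inv_sub_mul_le hz hw
    rw [pow_two, norm_mul, mul_assoc]
    exact mul_le_mul h4 h3 (by positivity) (by positivity)
  have hu : ∀ x : ℝ, HasDerivAt (fun x : ℝ => ((x : ℂ) - w)⁻¹) (-(((x : ℂ) - w)⁻¹) ^ 2) x := by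
    intro x
    have hne : (x : ℂ) - w ≠ 0 := sub_ne_zero_of_im (by simp) hw
    have := ((Complex.ofRealCLM.hasDerivAt (x := x)).sub_const w).inv hne
    refine this.congr_deriv ?_
    simp [inv_pow]
    field_simp
  have hm : MemLp (fun x : ℝ => -(((x : ℂ) - w)⁻¹) ^ 2) 2 := hm2.neg
  have h := integral_mul_deriv_eq_deriv_mul_of_integrable (u := fun x : ℝ => ((x : ℂ) - w)⁻¹)
    (v := fun x : ℝ => F x) (u' := fun x : ℝ => -(((x : ℂ) - w)⁻¹) ^ 2) (v' := φ')
    (fun x _ => hu x) (fun x _ => hd x)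
    (MemLp.integrable_mul (memLp_inv_sub hw.ne') h2')
    (MemLp.integrable_mul hm h2)
    (MemLp.integrable_mul (memLp_inv_sub hw.ne') h2)
  simp_rw [mul_comm (φ' _)]
  rw [h, ← integral_neg, ← h0]
  congr 1
  ext x
  ring

/-! ### One-sided Fourier transforms -/

theorem integral_indicator_exp {σ : ℝ} (hσ : σ = 1 ∨ σ = -1) {c : ℂ} (hc : σ * c.re < 0) :
    Integrable ({η : ℝ | 0 < σ * η}.indicator fun η : ℝ => Complex.exp (c * η)) ∧
      ∫ η : ℝ, {η : ℝ | 0 < σ * η}.indicator (fun η : ℝ => Complex.exp (c * η)) η = -σ / c := by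
  rcases hσ with rfl | rfl
  · have hs : {η : ℝ | 0 < 1 * η} = Ioi 0 := by ext; simp
    have hc' : c.re < 0 := by linarith
    rw [hs, integrable_indicator_iff measurableSet_Ioi, integral_indicator measurableSet_Ioi]
    refine ⟨integrableOn_exp_mul_complex_Ioi hc' 0, ?_⟩
    rw [integral_exp_mul_complex_Ioi hc']
    simp
  · have hs : {η : ℝ | 0 < -1 * η} = Iio 0 := by ext; simp
    have hc' : 0 < c.re := by linarith
    rw [hs, integrable_indicator_iff measurableSet_Iio, integral_indicator measurableSet_Iio,
      ← integral_Iic_eq_integral_Iio, ← integrableOn_Iic_iff_integrableOn_Iio]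
    refine ⟨integrableOn_exp_mul_complex_Iic hc' 0, ?_⟩
    rw [integral_exp_mul_complex_Iic hc']
    simp

theorem measurableSet_half (σ : ℝ) : MeasurableSet {η : ℝ | 0 < σ * η} :=
  measurableSet_lt (by fun_prop) (by fun_prop)

theorem norm_indicator_exp_sq (S : Set ℝ) (c : ℂ) (η : ℝ) :
    ‖S.indicator (fun η : ℝ => Complex.exp (c * η)) η‖ ^ 2 =
      ‖S.indicator (fun η : ℝ => Complex.exp ((2 * c) * η)) η‖ := by
  by_cases h : η ∈ S
  · rw [indicator_of_mem h, indicator_of_mem h, ← norm_pow, ← Complex.exp_nat_mul]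
    congr 2
    push_cast
    ring
  · rw [indicator_of_notMem h, indicator_of_notMem h]; simp

theorem memLp_indicator_exp {σ : ℝ} (hσ : σ = 1 ∨ σ = -1) {c : ℂ} (hc : σ * c.re < 0) :
    MemLp ({η : ℝ | 0 < σ * η}.indicator fun η : ℝ => Complex.exp (c * η)) 2 := by
  rw [memLp_two_iff_integrable_sq_norm (integral_indicator_exp hσ hc).1.1]
  simp_rw [norm_indicator_exp_sq]
  exact (integral_indicator_exp hσ (c := 2 * c) (by simp; linarith)).1.norm

/-- A square integrable boundary value of a holomorphic function in the lower (`σ = 1`) or upper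
(`σ = -1`) half plane has a one-sided Fourier transform. -/
theorem l2Fourier_eq_zero_of_cauchy {σ : ℝ} (hσ : σ = 1 ∨ σ = -1) {ψ : ℝ → ℂ} (h : MemLp ψ 2)
    (hψ : ∀ w : ℂ, 0 < σ * w.im → ∫ x : ℝ, ψ x * ((x : ℂ) - w)⁻¹ = 0) :
    ∀ᵐ η, 0 < σ * η → l2Fourier h η = 0 := by
  have hσ2 : σ * σ = 1 := by rcases hσ with rfl | rfl <;> norm_num
  have hσ0 : σ ≠ 0 := by rintro rfl; simp at hσ2
  have hpi := Real.pi_pos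
  set S := {η : ℝ | 0 < σ * η} with hS
  have hSm : MeasurableSet S := measurableSet_half σ
  -- orthogonality to exponentials
  have key : ∀ w : ℂ, 0 < σ * w.im →
      ∫ η : ℝ, S.indicator (fun η : ℝ => Complex.exp ((2 * Real.pi * Complex.I * w) * η)) η *
        l2Fourier h η = 0 := by
    intro w hw
    -- With this `c`, the inverse transform of the exponential cut off to the half line is a
    -- multiple of `1/(x - w̄)`, whose conjugate is the Cauchy kernel at `w`. By Plancherel the
    -- hypothesis then becomes orthogonality on the Fourier side.
    set c : ℂ := -(2 * Real.pi * Complex.I * (starRingEnd ℂ) w) with hc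
    have hcre : σ * c.re < 0 := by
      have : c.re = -(2 * Real.pi * w.im) := by simp [hc]
      rw [this]
      nlinarith
    have hcc : (starRingEnd ℂ) c = 2 * Real.pi * Complex.I * w := by
      rw [hc, map_neg, map_mul, map_mul, map_mul, Complex.conj_conj, Complex.conj_I,
        Complex.conj_ofReal, map_ofNat]
      ring
    set a : ℝ → ℂ := S.indicator fun η : ℝ => Complex.exp (c * η) with ha
    have ha1 : Integrable a := (integral_indicator_exp hσ hcre).1
    have ha2 : MemLp a 2 := memLp_indicator_exp hσ hcre
    have hFa : ∀ x : ℝ, (𝓕⁻ a) x = -σ / (2 * Real.pi * Complex.I * (x - (starRingEnd ℂ) w)) := by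
      intro x
      have h' : σ * (2 * Real.pi * Complex.I * (x - (starRingEnd ℂ) w)).re < 0 := by
        have : (2 * Real.pi * Complex.I * (x - (starRingEnd ℂ) w)).re = -(2 * Real.pi * w.im) := by
          simp
        rw [this]
        nlinarith
      rw [Real.fourierInv_eq', ← (integral_indicator_exp hσ h').2]
      congr 1
      ext η
      by_cases hη : η ∈ S
      · rw [ha, indicator_of_mem hη, indicator_of_mem hη, smul_eq_mul, ← Complex.exp_add]
        congr 1
        simp [hc]
        ring
      · rw [ha, indicator_of_notMem hη, indicator_of_notMem hη, smul_zero]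
    have hinner := Lp.inner_fourier_eq
      (𝓕⁻ (ha2.toLp a : Lp ℂ 2 (volume : Measure ℝ)) : Lp ℂ 2 (volume : Measure ℝ)) (h.toLp ψ)
    rw [FourierTransform.fourier_fourierInv_eq, L2.inner_def, L2.inner_def] at hinner
    have e1 : ∫ η, inner ℂ ((ha2.toLp a) η)
        ((𝓕 (h.toLp ψ : Lp ℂ 2 (volume : Measure ℝ)) : Lp ℂ 2 (volume : Measure ℝ)) η) =
        ∫ η : ℝ, S.indicator (fun η : ℝ => Complex.exp ((2 * Real.pi * Complex.I * w) * η)) η *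
          l2Fourier h η := by
      refine integral_congr_ae ?_
      filter_upwards [ha2.coeFn_toLp] with η hη
      rw [hη, l2Fourier, RCLike.inner_apply, mul_comm]
      congr 1
      by_cases hη : η ∈ S
      · rw [ha, indicator_of_mem hη, indicator_of_mem hη, ← Complex.exp_conj, map_mul, hcc,
          Complex.conj_ofReal]
      · rw [ha, indicator_of_notMem hη, indicator_of_notMem hη, map_zero]
    have e2 : ∫ x, inner ℂ
        ((𝓕⁻ (ha2.toLp a : Lp ℂ 2 (volume : Measure ℝ)) : Lp ℂ 2 (volume : Measure ℝ)) x)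
        ((h.toLp ψ) x) = (σ / (2 * Real.pi * Complex.I)) * ∫ x : ℝ, ψ x * ((x : ℂ) - w)⁻¹ := by
      rw [← integral_const_mul]
      refine integral_congr_ae ?_
      filter_upwards [fourierInv_toLp_ae_eq ha2 ha1, h.coeFn_toLp] with x h1 h2
      rw [h1, h2, hFa, RCLike.inner_apply]
      simp only [map_div₀, map_neg, map_mul, map_sub, Complex.conj_ofReal, Complex.conj_conj,
        Complex.conj_I, map_ofNat]
      simp only [div_eq_mul_inv, mul_inv_rev, inv_neg, mul_neg, neg_mul, neg_neg]
      ring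
    rw [← e1, hinner, e2, hψ w hw, mul_zero]
  -- Keep `Im w = σ` fixed and let `Re w` run over the real line: orthogonality then says that the
  -- inverse transform of the damped function `m` vanishes identically. The damping makes `m`
  -- integrable and never vanishes on the half line.
  set m : ℝ → ℂ := fun η =>
    S.indicator (fun η : ℝ => Complex.exp (((-(2 * Real.pi * σ) : ℝ) : ℂ) * η)) η * l2Fourier h η with hm
  have hre : σ * (((-(2 * Real.pi * σ) : ℝ) : ℂ)).re < 0 := by
    rw [Complex.ofReal_re]; nlinarith
  have hm1 : Integrable m :=
    MemLp.integrable_mul (memLp_indicator_exp hσ hre) (memLp_l2Fourier h)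
  have hm2 : MemLp m 2 := by
    refine (memLp_l2Fourier h).mono hm1.1 (Eventually.of_forall fun η => ?_)
    rw [hm, norm_mul]
    refine mul_le_of_le_one_left (norm_nonneg _) ?_
    by_cases hη : η ∈ S
    · rw [indicator_of_mem hη, Complex.norm_exp]
      refine Real.exp_le_one_iff.2 ?_
      have : 0 < σ * η := hη
      rw [← Complex.ofReal_mul, Complex.ofReal_re]
      nlinarith
    · rw [indicator_of_notMem hη]; simp
  have hz : ∀ u : ℝ, (𝓕⁻ m) u = 0 := by
    intro u
    have := key (u + σ * Complex.I) (by simp [hσ2])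
    rw [← this, Real.fourierInv_eq']
    congr 1
    ext η
    rw [hm, smul_eq_mul, ← mul_assoc]
    congr 1
    by_cases hη : η ∈ S
    · rw [indicator_of_mem hη, indicator_of_mem hη, ← Complex.exp_add]
      congr 1
      simp only [RCLike.inner_apply, conj_trivial]
      push_cast
      linear_combination (-2 * Real.pi * σ * η : ℂ) * Complex.I_sq
    · rw [indicator_of_notMem hη, indicator_of_notMem hη, mul_zero]
  have hz2 : (𝓕⁻ (hm2.toLp m : Lp ℂ 2 (volume : Measure ℝ)) : Lp ℂ 2 (volume : Measure ℝ)) = 0 := by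
    rw [Lp.eq_zero_iff_ae_eq_zero]
    filter_upwards [fourierInv_toLp_ae_eq hm2 hm1] with x hx
    rw [hx, hz]; rfl
  have hz3 : (hm2.toLp m : Lp ℂ 2 (volume : Measure ℝ)) = 0 := by
    exact (map_eq_zero_iff _ (Lp.fourierTransformₗᵢ ℝ ℂ).symm.injective).1 hz2
  rw [Lp.eq_zero_iff_ae_eq_zero] at hz3
  filter_upwards [hz3, hm2.coeFn_toLp] with η h1 h2 hη
  rw [h1] at h2
  have h3 : m η = 0 := h2.symm
  rw [hm] at h3
  simp only at h3
  rw [indicator_of_mem (show η ∈ S from hη)] at h3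
  exact (mul_eq_zero.1 h3).resolve_left (Complex.exp_ne_zero _)

theorem l2Fourier_add_mul {φ ψ χ : ℝ → ℂ} (hφ : MemLp φ 2) (hψ : MemLp ψ 2) (hχ : MemLp χ 2)
    (c : ℂ) (e : χ = φ + c • ψ) :
    l2Fourier hχ =ᵐ[volume] fun η => l2Fourier hφ η + c * l2Fourier hψ η := by
  subst e
  have e : (𝓕 (hχ.toLp _ : Lp ℂ 2 (volume : Measure ℝ)) : Lp ℂ 2 (volume : Measure ℝ)) =
      𝓕 (hφ.toLp φ) + c • 𝓕 (hψ.toLp ψ) := by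
    have : hχ.toLp (φ + c • ψ) = hφ.toLp φ + c • hψ.toLp ψ := by
      rw [← MemLp.toLp_const_smul, ← MemLp.toLp_add]
    rw [this]
    exact (map_add (Lp.fourierTransformₗᵢ ℝ ℂ) _ _).trans
      (congrArg _ (map_smul (Lp.fourierTransformₗᵢ ℝ ℂ) _ _))
  unfold l2Fourier
  rw [e]
  filter_upwards [Lp.coeFn_add (𝓕 (hφ.toLp φ) : Lp ℂ 2 (volume : Measure ℝ)) (c • 𝓕 (hψ.toLp ψ)),
    Lp.coeFn_smul c (𝓕 (hψ.toLp ψ) : Lp ℂ 2 (volume : Measure ℝ))] with η h1 h2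
  rw [h1, Pi.add_apply, h2, Pi.smul_apply, smul_eq_mul]

theorem CauchyVanishing.conj {ψ : ℝ → ℂ} (h : CauchyVanishing ψ) {w : ℂ} (hw : w.im < 0) :
    ∫ x : ℝ, (starRingEnd ℂ) (ψ x) * ((x : ℂ) - w)⁻¹ = 0 := by
  have := h ((starRingEnd ℂ) w) (by simpa using hw)
  have h2 := congrArg (starRingEnd ℂ) this
  rw [← integral_conj, map_zero] at h2
  rw [← h2]
  congr 1
  ext x
  simp

/-- The `Ḣ^(1/2)` norm of the imaginary part of a boundary value `v + i g`: the operator `|D|`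
takes `g` to `v'`. -/
theorem homHalfNorm_im {g v v' : ℝ → ℝ} (hg : MemLp (fun x => (g x : ℂ)) 2)
    (hv : MemLp (fun x => (v x : ℂ)) 2) (hv' : MemLp (fun x => (v' x : ℂ)) 2)
    (hd : ∀ x, HasDerivAt v (v' x) x) (hc : CauchyVanishing fun x => (v x : ℂ) + Complex.I * g x) :
    homHalfNorm (fun x => (g x : ℂ)) ≠ ⊤ ∧ halfNormSq g = ∫ x, g x * v' x := by
  have hL : MemLp (fun x => (v x : ℂ) + Complex.I * g x) 2 := hv.add (hg.const_mul Complex.I)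
  -- The conjugate `v - i g` has vanishing Cauchy integrals in the lower half plane, so its
  -- transform lives on the opposite half line.
  have hM : MemLp (fun x => (v x : ℂ) + (-Complex.I) * g x) 2 := hv.add (hg.const_mul (-Complex.I))
  have h1 := l2Fourier_eq_zero_of_cauchy (σ := 1) (Or.inl rfl) hL fun w hw => hc w (by linarith)
  have h2 := l2Fourier_eq_zero_of_cauchy (σ := -1) (Or.inr rfl) hM fun w hw => by
    rw [← hc.conj (w := w) (by linarith)]
    congr 1
    ext x
    simp [Complex.conj_ofReal]
  have h3 := l2Fourier_add_mul hv hg hL Complex.I rfl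
  have h4 := l2Fourier_add_mul hv hg hM (-Complex.I) rfl
  have h5 := fourier_toLp_deriv hv hv' fun x => (hd x).ofReal_comp
  -- The transform of `v` is `-i` times that of `g` for `η > 0` and `i` times it for `η < 0`.
  -- Multiplication by `2πiη` therefore gives `|2πη|` in both cases.
  have key : ∀ᵐ η : ℝ, l2Fourier hv' η = ((|2 * Real.pi * η| : ℝ) : ℂ) * l2Fourier hg η := by
    filter_upwards [h1, h2, h3, h4, h5] with η h1 h2 h3 h4 h5
    change l2Fourier hv' η = _ * l2Fourier hv η at h5
    rw [h5]
    rcases lt_trichotomy η 0 with hη | hη | hη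
    · rw [h2 (by linarith)] at h4
      rw [abs_of_neg (by nlinarith [Real.pi_pos])]
      push_cast
      linear_combination (-(2 * Real.pi * η * Complex.I) : ℂ) * h4 +
        (2 * Real.pi * η * l2Fourier hg η : ℂ) * Complex.I_sq
    · simp [hη]
    · rw [h1 (by linarith)] at h3
      rw [abs_of_pos (by positivity)]
      push_cast
      linear_combination (-(2 * Real.pi * η * Complex.I) : ℂ) * h3 -
        (2 * Real.pi * η * l2Fourier hg η : ℂ) * Complex.I_sq
  have hinner := Lp.inner_fourier_eq (hg.toLp _ : Lp ℂ 2 (volume : Measure ℝ)) (hv'.toLp _)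
  rw [L2.inner_def, L2.inner_def] at hinner
  have e1 : ∫ x, inner ℂ ((hg.toLp _ : Lp ℂ 2 (volume : Measure ℝ)) x) ((hv'.toLp _) x) =
      ((∫ x, g x * v' x : ℝ) : ℂ) := by
    rw [← integral_complex_ofReal]
    refine integral_congr_ae ?_
    filter_upwards [hg.coeFn_toLp, hv'.coeFn_toLp] with x h1 h2
    rw [h1, h2, RCLike.inner_apply, Complex.conj_ofReal]
    push_cast
    ring
  have hpt : ∀ᵐ η : ℝ, inner ℂ (l2Fourier hg η) (l2Fourier hv' η) =
      ((|2 * Real.pi * η| * ‖l2Fourier hg η‖ ^ 2 : ℝ) : ℂ) := by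
    filter_upwards [key] with η h
    rw [h, RCLike.inner_apply, mul_assoc, Complex.mul_conj, Complex.normSq_eq_norm_sq]
    push_cast
    ring
  have e2 : ∫ η, inner ℂ (l2Fourier hg η) (l2Fourier hv' η) =
      ((∫ η : ℝ, |2 * Real.pi * η| * ‖l2Fourier hg η‖ ^ 2 : ℝ) : ℂ) := by
    rw [← integral_complex_ofReal]
    exact integral_congr_ae hpt
  have e3 : ∫ η : ℝ, |2 * Real.pi * η| * ‖l2Fourier hg η‖ ^ 2 = ∫ x, g x * v' x :=
    Complex.ofReal_injective (by rw [← e2, ← e1]; exact hinner)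
  have hint : Integrable fun η : ℝ => |2 * Real.pi * η| * ‖l2Fourier hg η‖ ^ 2 := by
    have h6 : Integrable fun η => (inner ℂ (l2Fourier hg η) (l2Fourier hv' η) : ℂ) :=
      L2.integrable_inner (𝕜 := ℂ) (𝓕 (hg.toLp _) : Lp ℂ 2 (volume : Measure ℝ)) (𝓕 (hv'.toLp _))
    refine h6.re.congr ?_
    filter_upwards [hpt] with η h
    rw [h]; exact Complex.ofReal_re _
  have hW : weightedFourierSq (fun ξ => |ξ|) (fun x => (g x : ℂ)) =
      ENNReal.ofReal (∫ x, g x * v' x) := by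
    rw [weightedFourierSq, dif_pos hg, ← e3,
      ofReal_integral_eq_lintegral_ofReal hint (Eventually.of_forall fun η => by positivity)]
    congr 1
    ext η
    rw [ENNReal.ofReal_mul (by positivity), ENNReal.ofReal_pow (norm_nonneg _), ofReal_norm]
    rfl
  have hnn : 0 ≤ ∫ x, g x * v' x := by
    rw [← e3]; exact integral_nonneg fun η => by positivity
  rw [halfNormSq, homHalfNorm, hW]
  refine ⟨ENNReal.rpow_ne_top_of_nonneg (by norm_num) ENNReal.ofReal_ne_top, ?_⟩
  rw [← ENNReal.toReal_rpow, ENNReal.toReal_ofReal hnn, ← Real.sqrt_eq_rpow, Real.sq_sqrt hnn]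

/-! ### The Poisson extension and the interface angle -/

/-- The Poisson extension after rescaling the variable of integration; it makes sense on the closed
half plane. -/
def scaledPoisson (f : ℝ → ℂ) (z : ℂ) : ℂ :=
  ∫ s : ℝ, (((1 + s ^ 2)⁻¹ / Real.pi : ℝ) : ℂ) * f (z.re + z.im * s)

theorem continuous_scaledPoisson {f : ℝ → ℂ} (hf : Continuous f) {C : ℝ} (hC : ∀ x, ‖f x‖ ≤ C) :
    Continuous (scaledPoisson f) := by
  refine continuous_of_dominated (bound := fun s : ℝ => (1 + s ^ 2)⁻¹ / Real.pi * C)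
    (fun z => Continuous.aestronglyMeasurable ?_) (fun z => Eventually.of_forall fun s => ?_)
    ((integrable_inv_one_add_sq.div_const _).mul_const _)
    (Eventually.of_forall fun s => by fun_prop)
  · refine Continuous.mul (Complex.continuous_ofReal.comp (Continuous.div_const
      (Continuous.inv₀ (by fun_prop) fun s => by positivity) _)) (by fun_prop)
  · rw [norm_mul, Complex.norm_real, Real.norm_of_nonneg (by positivity)]
    gcongr
    exact hC _

theorem scaledPoisson_ofReal (f : ℝ → ℂ) (α : ℝ) : scaledPoisson f α = f α := by
  simp only [scaledPoisson, Complex.ofReal_re, Complex.ofReal_im, zero_mul, add_zero]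
  rw [integral_mul_const, integral_complex_ofReal, integral_div, integral_univ_inv_one_add_sq,
    div_self Real.pi_ne_zero]
  simp

theorem poissonExtension_eq_scaledPoisson (f : ℝ → ℂ) {z : ℂ} (hz : z.im < 0) :
    poissonExtension f z = scaledPoisson f z := by
  have h1 : poissonExtension f z = ∫ u : ℝ, (poissonKernel (-z.im) u : ℂ) * f (z.re - u) := by
    rw [poissonExtension, ← integral_sub_left_eq_self
      (fun u : ℝ => (poissonKernel (-z.im) u : ℂ) * f (z.re - u)) volume z.re]
    simp
  have h2 := Measure.integral_comp_mul_left
    (fun u : ℝ => (poissonKernel (-z.im) u : ℂ) * f (z.re - u)) (-z.im)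
  have hp : 0 < -z.im := by linarith
  rw [abs_of_pos (inv_pos.2 hp)] at h2
  have h3 : ∫ u : ℝ, (poissonKernel (-z.im) u : ℂ) * f (z.re - u) = (-z.im) •
      ∫ s : ℝ, (poissonKernel (-z.im) (-z.im * s) : ℂ) * f (z.re - -z.im * s) := by
    rw [h2, smul_smul, mul_inv_cancel₀ hp.ne', one_smul]
  rw [h1, h3, scaledPoisson, ← integral_smul]
  congr 1
  ext s
  have e : z.re - -z.im * s = z.re + z.im * s := by ring
  rw [e, Complex.real_smul, ← mul_assoc, ← Complex.ofReal_mul]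
  congr 2
  rw [poissonKernel]
  have : z.im ≠ 0 := hz.ne
  have h4 : 1 + s ^ 2 ≠ 0 := by positivity
  field_simp

theorem eq_zero_of_exp_eq_one {D : ℂ} (h : Complex.exp D = 1) (h1 : ‖D‖ < 2) : D = 0 := by
  obtain ⟨n, rfl⟩ := Complex.exp_eq_one_iff.1 h
  have hn : n = 0 := by
    by_contra hn
    have h2 : (1 : ℝ) ≤ |(n : ℝ)| := by exact_mod_cast Int.one_le_abs hn
    rw [norm_mul, norm_mul, norm_mul, Complex.norm_intCast, Complex.norm_I,
      Complex.norm_of_nonneg Real.pi_pos.le, Complex.norm_ofNat, mul_one] at h1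
    nlinarith [Real.pi_gt_three]
  simp [hn]

/-- Two continuous logarithms on a connected set that agree in a limit are equal. -/
theorem eqOn_of_exp_eq {X : Type*} [TopologicalSpace X] {S : Set X} (hS : IsPreconnected S)
    {L₁ L₂ : X → ℂ} (h₁ : ContinuousOn L₁ S) (h₂ : ContinuousOn L₂ S)
    (he : ∀ x ∈ S, Complex.exp (L₁ x) = Complex.exp (L₂ x)) {l : Filter X} [l.NeBot]
    (hl : ∀ᶠ x in l, x ∈ S) (hlim : Tendsto (fun x => L₁ x - L₂ x) l (𝓝 0)) : EqOn L₁ L₂ S := by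
  have h1 : ∀ x ∈ S, Complex.exp (L₁ x - L₂ x) = 1 := fun x hx => by
    rw [Complex.exp_sub, he x hx, div_self (Complex.exp_ne_zero _)]
  have hlt : ∀ᶠ x in l, ‖L₁ x - L₂ x‖ < 1 := by
    have := hlim.norm
    rw [norm_zero] at this
    exact this.eventually_lt_const one_pos
  obtain ⟨x₀, hx₀, hx₀'⟩ := (hl.and hlt).exists
  intro x hx
  by_contra hne
  have h2 : ¬ ‖L₁ x - L₂ x‖ < 2 := fun h =>
    hne (sub_eq_zero.1 (eq_zero_of_exp_eq_one (h1 x hx) h))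
  -- The difference takes values in `2πiℤ`, so its norm is `0` or at least `2`; on a connected set
  -- it cannot pass from below `1` to above `2` without taking the excluded value `1`.
  obtain ⟨y, hy, hy'⟩ := hS.intermediate_value hx₀ hx (h₁.sub h₂).norm
    (show (1 : ℝ) ∈ Icc _ _ from ⟨hx₀'.le, by simp only [Pi.sub_apply]; linarith⟩)
  simp only [Pi.sub_apply] at hy'
  have h3 := eq_zero_of_exp_eq_one (h1 y hy) (by rw [hy']; norm_num)
  rw [h3] at hy'
  simp at hy'

theorem isPreconnected_closedLowerHalfPlane : IsPreconnected closedLowerHalfPlane :=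
  (convex_halfSpace_im_le 0).isPreconnected

theorem neBot_infinity : (Bornology.cobounded ℂ ⊓ 𝓟 closedLowerHalfPlane).NeBot := by
  rw [((hasBasis_cobounded_norm (E := ℂ)).inf_principal _).neBot_iff]
  intro R _
  refine ⟨(⟨0, -|R|⟩ : ℂ), ?_, by simp [closedLowerHalfPlane]⟩
  refine le_trans ?_ (Complex.abs_im_le_norm _)
  simpa using le_abs_self R

theorem tendsto_cayley : Tendsto (fun z : ℂ => (z + Complex.I) / (z - Complex.I))
    (Bornology.cobounded ℂ) (𝓝 1) := by
  have h : Tendsto (fun z : ℂ => 1 + 2 * Complex.I * (z - Complex.I)⁻¹)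
      (Bornology.cobounded ℂ) (𝓝 (1 + 2 * Complex.I * 0)) := by
    refine tendsto_const_nhds.add (tendsto_const_nhds.mul ?_)
    have h1 : Tendsto (fun z : ℂ => z - Complex.I) (Bornology.cobounded ℂ) (Bornology.cobounded ℂ) := by
      rw [← tendsto_norm_atTop_iff_cobounded]
      refine tendsto_atTop_mono (fun z => norm_sub_norm_le z Complex.I) ?_
      exact tendsto_atTop_add_const_right _ _ tendsto_norm_cobounded_atTop
    exact tendsto_inv₀_cobounded.comp h1
  rw [mul_zero, add_zero] at h
  refine h.congr' ?_
  have : ∀ᶠ z in Bornology.cobounded ℂ, z ≠ Complex.I :=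
    Bornology.eventually_ne_cobounded _
  filter_upwards [this] with z hz
  have : z - Complex.I ≠ 0 := sub_ne_zero.2 hz
  field_simp
  ring

/-- A continuous nowhere vanishing function on the closed half plane that tends to `1` at infinity
has a continuous logarithm that tends to `0`. -/
theorem exists_log {Ψ : ℂ → ℂ} (hc : ContinuousOn Ψ closedLowerHalfPlane)
    (h0 : ∀ z ∈ closedLowerHalfPlane, Ψ z ≠ 0)
    (h1 : Tendsto Ψ (Bornology.cobounded ℂ ⊓ 𝓟 closedLowerHalfPlane) (𝓝 1)) :
    ∃ L : ℂ → ℂ, ContinuousOn L closedLowerHalfPlane ∧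
      Tendsto L (Bornology.cobounded ℂ ⊓ 𝓟 closedLowerHalfPlane) (𝓝 0) ∧
      ∀ z ∈ closedLowerHalfPlane, Complex.exp (L z) = Ψ z := by
  -- The Cayley transform `c`, with inverse `m`, identifies the closed half plane with the closed
  -- disc minus the point `1`, which plays the role of infinity.
  set m : ℂ → ℂ := fun w => Complex.I * (w + 1) / (w - 1) with hm
  set c : ℂ → ℂ := fun z => (z + Complex.I) / (z - Complex.I) with hcd
  set B := Metric.closedBall (0 : ℂ) 1 with hB
  have hmB : MapsTo m B closedLowerHalfPlane := by
    intro w hw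
    have hw' : ‖w‖ ≤ 1 := by simpa [hB] using hw
    have h2 : w.re * w.re + w.im * w.im ≤ 1 := by
      have h3 := Complex.sq_norm w
      rw [Complex.normSq_apply] at h3
      nlinarith [norm_nonneg w]
    change (m w).im ≤ 0
    rw [hm]
    simp only [Complex.div_im, Complex.mul_im, Complex.mul_re, Complex.I_re, Complex.I_im,
      Complex.add_re, Complex.add_im, Complex.one_re, Complex.one_im, Complex.sub_re,
      Complex.sub_im]
    rw [← sub_div]
    refine div_nonpos_of_nonpos_of_nonneg ?_ (Complex.normSq_nonneg _)
    nlinarith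
  have hmc : ContinuousOn m (B \ {1}) :=
    ContinuousOn.div (by fun_prop) (by fun_prop) fun w hw => sub_ne_zero.2 hw.2
  have hminf : Tendsto m (𝓝[B \ {1}] 1) (Bornology.cobounded ℂ ⊓ 𝓟 closedLowerHalfPlane) := by
    refine tendsto_inf.2 ⟨?_, tendsto_principal.2 ?_⟩
    · have h2 : Tendsto (fun w : ℂ => w - 1) (𝓝[≠] 1) (𝓝[≠] 0) := by
        refine tendsto_nhdsWithin_iff.2 ⟨?_, ?_⟩
        · have : Tendsto (fun w : ℂ => w - 1) (𝓝 1) (𝓝 (1 - 1)) := by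
            exact (continuous_sub_right (1 : ℂ)).tendsto 1
          rw [sub_self] at this
          exact this.mono_left nhdsWithin_le_nhds
        · filter_upwards [self_mem_nhdsWithin] with w hw
          exact sub_ne_zero.2 hw
      have h3 := tendsto_inv₀_nhdsNE_zero.comp h2
      have h4 : Tendsto (fun w : ℂ => Complex.I * (w + 1)) (𝓝[≠] 1) (𝓝 (Complex.I * (1 + 1))) := by
        have h : Continuous fun w : ℂ => Complex.I * (w + 1) := by fun_prop
        exact (h.tendsto 1).mono_left nhdsWithin_le_nhds
      have h5 : Tendsto m (𝓝[≠] 1) (Bornology.cobounded ℂ) := by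
        rw [← tendsto_norm_atTop_iff_cobounded] at h3 ⊢
        have h6 := h4.norm.pos_mul_atTop (by norm_num) h3
        refine h6.congr fun w => ?_
        simp [hm, div_eq_mul_inv]
      exact h5.mono_left (nhdsWithin_mono _ fun w hw => hw.2)
    · filter_upwards [self_mem_nhdsWithin] with w hw
      exact hmB hw.1
  -- The limit `1` at infinity is exactly what makes this extension continuous and nonzero on the
  -- whole closed disc.
  set Φ : ℂ → ℂ := Function.update (Ψ ∘ m) 1 1 with hΦ
  have hΦc : ContinuousOn Φ B := by
    rw [hΦ, continuousOn_update_iff]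
    exact ⟨hc.comp hmc (hmB.mono_left sdiff_subset), fun _ => h1.comp hminf⟩
  have hΦ0 : ∀ w ∈ B, Φ w ≠ 0 := by
    intro w hw
    by_cases h : w = 1
    · simp [hΦ, h]
    · rw [hΦ, Function.update_of_ne h]
      exact h0 _ (hmB hw)
  -- Radial retraction of the plane onto the disc: it replaces the closed disc by an open simply
  -- connected domain, on which a continuous logarithm can be lifted.
  set r : ℂ → ℂ := fun w => (max 1 ‖w‖)⁻¹ • w with hr
  have hrc : Continuous r := by
    have h2 : Continuous fun w : ℂ => max 1 ‖w‖ := by fun_prop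
    exact (h2.inv₀ fun w => (lt_of_lt_of_le one_pos (le_max_left _ _)).ne').smul continuous_id
  have hrB : ∀ w, r w ∈ B := by
    intro w
    have h2 : 0 < max 1 ‖w‖ := lt_of_lt_of_le one_pos (le_max_left _ _)
    simp only [hB, hr, mem_closedBall_zero_iff, norm_smul, norm_inv, Real.norm_of_nonneg h2.le]
    rw [inv_mul_le_iff₀ h2, mul_one]
    exact le_max_right _ _
  have hrid : ∀ w ∈ B, r w = w := by
    intro w hw
    have hw' : ‖w‖ ≤ 1 := by simpa [hB] using hw
    simp [hr, max_eq_left hw']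
  have hsc : IsSimplyConnected (univ : Set ℂ) := by
    have : ContractibleSpace (univ : Set ℂ) := convex_univ.contractibleSpace univ_nonempty
    exact SimplyConnectedSpace.ofContractible _
  obtain ⟨f, hfc, hf⟩ := Complex.exists_continuousOn_eqOn_exp_comp hsc isOpen_univ
    (g := Φ ∘ r) (hΦc.comp_continuous hrc hrB).continuousOn
    (by rintro ⟨w, -, hw⟩; exact hΦ0 _ (hrB w) hw)
  have hfc' : Continuous f := continuousOn_univ.1 hfc
  have hcB : ∀ z ∈ closedLowerHalfPlane, c z ∈ B := by
    intro z hz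
    have hz' : z.im ≤ 0 := hz
    rw [hB, mem_closedBall_zero_iff, hcd]
    simp only [norm_div]
    refine div_le_one_of_le₀ ?_ (norm_nonneg _)
    rw [← sq_le_sq₀ (norm_nonneg _) (norm_nonneg _), Complex.sq_norm, Complex.sq_norm,
      Complex.normSq_apply, Complex.normSq_apply]
    simp
    nlinarith
  have hcne : ∀ z ∈ closedLowerHalfPlane, z - Complex.I ≠ 0 := fun z hz =>
    sub_ne_zero_of_im hz (by simp)
  have hf1 : Complex.exp (f 1) = 1 := by
    have h2 := hf (mem_univ (1 : ℂ))
    simp only [Function.comp_apply] at h2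
    rw [h2, hrid 1 (by simp [hB])]
    simp [hΦ]
  -- Since `exp (f 1) = 1`, subtracting `f 1` keeps a logarithm and normalizes its limit at infinity
  -- to `0`.
  refine ⟨fun z => f (c z) - f 1, ?_, ?_, ?_⟩
  · refine ContinuousOn.sub (hfc'.comp_continuousOn ?_) continuousOn_const
    exact ContinuousOn.div (by fun_prop) (by fun_prop) hcne
  · have h2 := ((hfc'.tendsto 1).comp (tendsto_cayley.mono_left
      (inf_le_left (b := 𝓟 closedLowerHalfPlane)))).sub_const (f 1)
    rw [sub_self] at h2
    exact h2
  · intro z hz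
    have h2 := hf (mem_univ (c z))
    simp only [Function.comp_apply] at h2
    have h3 := hcne z hz
    have hc1 : c z - 1 = 2 * Complex.I / (z - Complex.I) := by
      rw [hcd]; field_simp; ring
    have hc2 : c z - 1 ≠ 0 := by
      rw [hc1]; exact div_ne_zero (by simp) h3
    rw [Complex.exp_sub, hf1, div_one, h2, hrid _ (hcB z hz), hΦ,
      Function.update_of_ne (sub_ne_zero.1 hc2), Function.comp_apply]
    congr 1
    rw [hm]
    simp only
    rw [hc1, hcd]
    field_simp
    ring_nf
    try simp

/-- The limit of the extension is assumed only in the open half plane; along the real axis it comes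
from the decay of `ζ - 1`. This splitting joins the two. -/
theorem cobounded_inf_closed : Bornology.cobounded ℂ ⊓ 𝓟 closedLowerHalfPlane =
    (Bornology.cobounded ℂ ⊓ 𝓟 lowerHalfPlane) ⊔ (Bornology.cobounded ℂ ⊓ 𝓟 {z : ℂ | z.im = 0}) := by
  rw [← inf_sup_left, sup_principal]
  congr 2
  ext z
  exact le_iff_lt_or_eq (a := z.im)

theorem tendsto_re_realLine : Tendsto Complex.re (Bornology.cobounded ℂ ⊓ 𝓟 {z : ℂ | z.im = 0})
    (cocompact ℝ) := by
  rw [← Metric.cobounded_eq_cocompact, ← tendsto_norm_atTop_iff_cobounded]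
  have h : Tendsto (fun z : ℂ => ‖z‖) (Bornology.cobounded ℂ ⊓ 𝓟 {z : ℂ | z.im = 0}) atTop :=
    tendsto_norm_cobounded_atTop.mono_left inf_le_left
  refine h.congr' ?_
  filter_upwards [mem_inf_of_right (mem_principal_self _)] with z hz
  have hz' : z.im = 0 := hz
  have : z = (z.re : ℂ) := Complex.ext rfl (by simp [hz'])
  conv_lhs => rw [this]
  rw [Complex.norm_real]

theorem tendsto_ofReal_infinity : Tendsto (fun x : ℝ => (x : ℂ)) (cocompact ℝ)
    (Bornology.cobounded ℂ ⊓ 𝓟 closedLowerHalfPlane) := by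
  refine tendsto_inf.2 ⟨?_, tendsto_principal.2 (Eventually.of_forall fun x => by
    simp [closedLowerHalfPlane])⟩
  rw [← tendsto_norm_atTop_iff_cobounded]
  simp_rw [Complex.norm_real]
  exact tendsto_norm_cocompact_atTop

/-- The interface angle is well defined. -/
theorem existsUnique_interfaceAngle {ζ : ℝ → ℂ} (hc : Continuous ζ) (h0 : ∀ α, ζ α ≠ 0) {C : ℝ}
    (hC : ∀ x, ‖ζ x‖ ≤ C) (hlim : Tendsto ζ (cocompact ℝ) (𝓝 1))
    (h1 : Tendsto (poissonExtension ζ) (Bornology.cobounded ℂ ⊓ 𝓟 lowerHalfPlane) (𝓝 1))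
    (hne : ∀ z ∈ lowerHalfPlane, poissonExtension ζ z ≠ 0) :
    ∃! γ : ℝ → ℝ, IsInterfaceAngle ζ γ := by
  have hreal : ∀ z : ℂ, z.im = 0 → scaledPoisson ζ z = ζ z.re := fun z hz => by
    have : z = (z.re : ℂ) := Complex.ext rfl (by simp [hz])
    rw [this, scaledPoisson_ofReal, Complex.ofReal_re]
  obtain ⟨L, hLc, hL0, hL⟩ := exists_log (Ψ := scaledPoisson ζ)
    (continuous_scaledPoisson hc hC).continuousOn
    (fun z hz => by
      rcases (show z.im ≤ 0 from hz).lt_or_eq with h | h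
      · rw [← poissonExtension_eq_scaledPoisson ζ h]; exact hne z h
      · rw [hreal z h]; exact h0 _)
    (by
      rw [cobounded_inf_closed]
      refine tendsto_sup.2 ⟨h1.congr' ?_, (hlim.comp tendsto_re_realLine).congr' ?_⟩
      · filter_upwards [mem_inf_of_right (mem_principal_self _)] with z hz
        exact poissonExtension_eq_scaledPoisson ζ hz
      · filter_upwards [mem_inf_of_right (mem_principal_self _)] with z hz
        exact (hreal z hz).symm)
  refine ⟨fun α => (L α).im, ⟨L, hLc, hL0, fun z hz => ?_, fun α => ?_, fun α => rfl⟩, ?_⟩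
  · rw [hL z (lowerHalfPlane_subset hz), poissonExtension_eq_scaledPoisson ζ hz]
  · rw [hL _ (by simp [closedLowerHalfPlane]), scaledPoisson_ofReal]
  · rintro γ ⟨L', hLc', hL0', he1, he2, hγ⟩
    have := neBot_infinity
    have h2 := eqOn_of_exp_eq (l := Bornology.cobounded ℂ ⊓ 𝓟 closedLowerHalfPlane) isPreconnected_closedLowerHalfPlane hLc' hLc (fun z hz => by
      rw [hL z hz]
      rcases (show z.im ≤ 0 from hz).lt_or_eq with h | h
      · rw [← poissonExtension_eq_scaledPoisson ζ h]; exact he1 z h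
      · rw [hreal z h, ← he2 z.re]
        congr 2
        exact Complex.ext rfl (by simp [h]))
      (mem_inf_of_right (mem_principal_self _)) (by simpa using hL0'.sub hL0)
    funext α
    rw [hγ, h2 (show (α : ℂ) ∈ closedLowerHalfPlane by simp [closedLowerHalfPlane])]

/-! ### Differentiability of continuous logarithms -/

/-- Near `a` the imaginary part of `L y - a` is less than `π`, so the principal branch recovers the
difference. A continuous logarithm thus locally inherits the differentiability of its exponential.
-/
theorem eventually_log_exp_sub {X : Type*} {l : Filter X} {L : X → ℂ} {a : ℂ}
    (h : Tendsto L l (𝓝 a)) : ∀ᶠ y in l, L y = a + Complex.log (Complex.exp (L y) / Complex.exp a) := by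
  have h1 : Tendsto (fun y => ‖L y - a‖) l (𝓝 0) := by
    have := (h.sub_const a).norm
    rwa [sub_self, norm_zero] at this
  filter_upwards [h1.eventually_lt_const (show (0 : ℝ) < 1 by norm_num)] with y hy
  have h2 := (Complex.abs_im_le_norm (L y - a)).trans hy.le
  rw [abs_le] at h2
  rw [← Complex.exp_sub, Complex.log_exp (by linarith [Real.pi_gt_three])
    (by linarith [Real.pi_gt_three])]
  ring

/-- A continuous logarithm of a differentiable function is differentiable. -/
theorem hasDerivWithinAt_of_exp {L u : ℝ → ℂ} {s : Set ℝ} {x : ℝ} {d : ℂ}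
    (hx : x ∈ s) (hL : ContinuousWithinAt L s x) (hu : ∀ y ∈ s, Complex.exp (L y) = u y)
    (hd : HasDerivWithinAt u d s x) : HasDerivWithinAt L (d / u x) s x := by
  have hux : u x ≠ 0 := by rw [← hu x hx]; exact Complex.exp_ne_zero _
  have h1 : HasDerivWithinAt (fun y => L x + Complex.log (u y / u x)) (d / u x) s x := by
    have h2 := ((hd.div_const (u x)).clog_real (by
      rw [div_self hux]; exact Complex.one_mem_slitPlane)).const_add (L x)
    refine h2.congr_deriv ?_
    rw [div_self hux, div_one]
  refine h1.congr_of_eventuallyEq ?_ (by simp [div_self hux])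
  filter_upwards [eventually_log_exp_sub hL, self_mem_nhdsWithin] with y hy hys
  rw [hy, hu x hx, hu y hys]

theorem differentiableOn_of_exp {L : ℂ → ℂ} {U : Set ℂ} (hU : IsOpen U) (hL : ContinuousOn L U)
    (hd : DifferentiableOn ℂ (fun z => Complex.exp (L z)) U) : DifferentiableOn ℂ L U := by
  intro x hx
  have h1 : DifferentiableAt ℂ (fun y => L x + Complex.log (Complex.exp (L y) / Complex.exp (L x))) x := by
    have h2 := (hd x hx).differentiableAt (hU.mem_nhds hx)
    refine ((h2.div_const _).clog ?_).const_add _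
    rw [div_self (Complex.exp_ne_zero _)]
    exact Complex.one_mem_slitPlane
  refine (h1.congr_of_eventuallyEq ?_).differentiableWithinAt
  filter_upwards [eventually_log_exp_sub (hL.continuousAt (hU.mem_nhds hx))] with y hy
  exact hy

theorem isOpen_lowerHalfPlane : IsOpen lowerHalfPlane :=
  isOpen_lt Complex.continuous_im continuous_const

/-- The boundary value of the logarithm and what holomorphy gives for it. -/
theorem IsInterfaceAngle.exists_boundary {ζ : ℝ → ℂ} {γ : ℝ → ℝ} (h : IsInterfaceAngle ζ γ)
    (hd : DifferentiableOn ℂ (poissonExtension ζ) lowerHalfPlane) :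
    ∃ l : ℝ → ℂ, Continuous l ∧ Tendsto l (cocompact ℝ) (𝓝 0) ∧ (∀ α, Complex.exp (l α) = ζ α) ∧
      (∀ α, γ α = (l α).im) ∧ (MemLp l 2 → CauchyVanishing l) ∧
      ∀ φ' : ℝ → ℂ, (∀ x, HasDerivAt (fun x => 1 / ζ x - 1) (φ' x) x) →
        MemLp (fun x => 1 / ζ x - 1) 2 → MemLp φ' 2 → CauchyVanishing φ' := by
  obtain ⟨L, hLc, hL0, he1, he2, hγ⟩ := h
  have hreal : Continuous fun x : ℝ => L x :=
    hLc.comp_continuous Complex.continuous_ofReal fun x => by simp [closedLowerHalfPlane]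
  have hLd : DifferentiableOn ℂ L lowerHalfPlane :=
    differentiableOn_of_exp isOpen_lowerHalfPlane (hLc.mono lowerHalfPlane_subset) (hd.congr he1)
  have hH : IsHolomorphicDecaying L := ⟨hLc, hLd, hL0⟩
  -- This is the holomorphic extension of `1/ζ - 1`; it is built from `L`, so no separate extension
  -- of `1/ζ` is needed.
  have hF : IsHolomorphicDecaying fun z => Complex.exp (-L z) - 1 := by
    refine ⟨(Complex.continuous_exp.comp_continuousOn hLc.neg).sub continuousOn_const,
      (hLd.neg.cexp).sub_const 1, ?_⟩
    have := (Complex.continuous_exp.tendsto _).comp hL0.neg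
    simpa using this.sub_const 1
  have hFe : ∀ x : ℝ, Complex.exp (-L x) - 1 = 1 / ζ x - 1 := fun x => by
    rw [Complex.exp_neg, he2, one_div]
  refine ⟨fun x => L x, hreal, hL0.comp tendsto_ofReal_infinity, he2, hγ,
    fun h2 => hH.cauchyVanishing h2, fun φ' hφ h2 h2' => ?_⟩
  refine hF.cauchyVanishing_deriv ?_ (φ' := φ') ?_ h2'
  · simpa only [hFe] using h2
  · simpa only [hFe] using hφ

/-! ### The principal value integral -/

/-- The symmetrized kernel of the principal value integral. -/
def symKernel (q : ℝ → ℂ) (α u : ℝ) : ℂ := (q (α - u) - q (α + u)) / (u : ℂ)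

/-- `p.v. ∫ q(β) / (α - β) dβ` -/
def pvIntegral (q : ℝ → ℂ) (α : ℝ) : ℂ := 1 / 2 * ∫ u, symKernel q α u

/-- Functions for which the principal value integral converges absolutely after symmetrization. -/
structure PVAdmissible (C : ℝ) (q : ℝ → ℂ) (c : ℂ) : Prop where
  continuous : Continuous q
  norm_le : ∀ x, ‖q x‖ ≤ C
  holder : ∀ x y, ‖q x - q y‖ ≤ C * |x - y| ^ (1 / 4 : ℝ)
  memLp : MemLp (fun x => q x - c) 2
  integral_sq_le : ∫ x, ‖q x - c‖ ^ 2 ≤ C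

/-- The singular part of the dominating function for `symKernel`. -/
def singularWeight (u : ℝ) : ℝ := (Icc (-1) 1).indicator (fun u : ℝ => |u| ^ (-(3 / 4) : ℝ)) u

theorem integrable_singularWeight : Integrable singularWeight := by
  have h1 : IntervalIntegrable (fun u : ℝ => |u| ^ (-(3 / 4) : ℝ)) volume 0 1 := by
    refine (intervalIntegral.intervalIntegrable_rpow' (r := -(3 / 4)) (by norm_num)).congr ?_
    intro u hu
    rw [uIoc_of_le zero_le_one] at hu
    simp only [abs_of_pos hu.1]
  have h2 : IntervalIntegrable (fun u : ℝ => |u| ^ (-(3 / 4) : ℝ)) volume (-1) 0 := by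
    have := (IntervalIntegrable.iff_comp_neg).1 h1
    simp only [abs_neg, neg_zero] at this
    exact this.symm
  have h3 := h2.trans h1
  rw [intervalIntegrable_iff_integrableOn_Icc_of_le (by norm_num)] at h3
  exact (integrable_indicator_iff measurableSet_Icc).2 h3

theorem singularWeight_nonneg (u : ℝ) : 0 ≤ singularWeight u :=
  indicator_nonneg (fun u _ => by positivity) u

variable {C : ℝ} {q : ℝ → ℂ} {c : ℂ}

theorem PVAdmissible.nonneg (h : PVAdmissible C q c) : 0 ≤ C := (norm_nonneg _).trans (h.norm_le 0)

/-- For `|u| ≤ 1` the Hölder bound leaves the integrable singularity `|u|^(-3/4)`. For `|u| > 1` the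
constant `c` cancels in the difference, and each product `|q - c| · |u|⁻¹` is split into squares.
All terms have integrals that are uniform in `α`. -/
theorem PVAdmissible.norm_symKernel_le (h : PVAdmissible C q c) (α u : ℝ) :
    ‖symKernel q α u‖ ≤ 2 * C * singularWeight u + 2 * (1 + u ^ 2)⁻¹ +
      (‖q (α - u) - c‖ ^ 2 + ‖q (α + u) - c‖ ^ 2) := by
  have hC := h.nonneg
  have hw := singularWeight_nonneg u
  rw [symKernel, norm_div, Complex.norm_real, Real.norm_eq_abs]
  rcases eq_or_ne u 0 with rfl | hu
  · simp only [abs_zero, div_zero]; positivity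
  have hu' : 0 < |u| := abs_pos.2 hu
  rcases le_or_gt |u| 1 with h1 | h1
  · have h2 : ‖q (α - u) - q (α + u)‖ / |u| ≤ 2 * C * singularWeight u := by
      have hmem : u ∈ Icc (-1 : ℝ) 1 := abs_le.1 h1
      rw [singularWeight, indicator_of_mem hmem, div_le_iff₀ hu', mul_assoc]
      have e : |u| ^ (-(3 / 4) : ℝ) * |u| = |u| ^ (1 / 4 : ℝ) := by
        nth_rewrite 2 [← Real.rpow_one |u|]
        rw [← Real.rpow_add hu']; norm_num
      rw [e]
      refine (h.holder _ _).trans ?_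
      have e2 : |α - u - (α + u)| = 2 * |u| := by
        rw [show α - u - (α + u) = -(2 * u) by ring, abs_neg, abs_mul, abs_two]
      rw [e2, Real.mul_rpow (by norm_num) hu'.le]
      have h3 : (2 : ℝ) ^ (1 / 4 : ℝ) ≤ 2 := by
        have := Real.rpow_le_rpow_of_exponent_le (x := 2) (by norm_num)
          (show (1 / 4 : ℝ) ≤ 1 by norm_num)
        rwa [Real.rpow_one] at this
      have h4 : 0 ≤ |u| ^ (1 / 4 : ℝ) := by positivity
      calc C * (2 ^ (1 / 4 : ℝ) * |u| ^ (1 / 4 : ℝ)) ≤ C * (2 * |u| ^ (1 / 4 : ℝ)) := by gcongr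
        _ = _ := by ring
    have : 0 ≤ 2 * (1 + u ^ 2)⁻¹ + (‖q (α - u) - c‖ ^ 2 + ‖q (α + u) - c‖ ^ 2) := by positivity
    linarith
  · set a := ‖q (α - u) - c‖
    set b := ‖q (α + u) - c‖
    have hab : ‖q (α - u) - q (α + u)‖ ≤ a + b := by
      have := norm_sub_le (q (α - u) - c) (q (α + u) - c)
      simpa using this
    have h2 : ‖q (α - u) - q (α + u)‖ / |u| ≤ (a + b) * |u|⁻¹ := by
      rw [div_eq_mul_inv]; gcongr
    have h3 : |u|⁻¹ ^ 2 ≤ 2 * (1 + u ^ 2)⁻¹ := by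
      rw [inv_pow, sq_abs, ← div_eq_mul_inv, inv_eq_one_div, div_le_div_iff₀ (by positivity)
        (by positivity)]
      have : 1 < u ^ 2 := by rw [← sq_abs]; nlinarith
      linarith
    have h4 : (a + b) * |u|⁻¹ ≤ a ^ 2 + b ^ 2 + |u|⁻¹ ^ 2 := by
      nlinarith [sq_nonneg (a - |u|⁻¹), sq_nonneg (b - |u|⁻¹), sq_nonneg a, sq_nonneg b]
    have h5 : 0 ≤ 2 * C * singularWeight u := by positivity
    linarith

theorem PVAdmissible.integrable_sq (h : PVAdmissible C q c) : Integrable fun x => ‖q x - c‖ ^ 2 :=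
  (memLp_two_iff_integrable_sq_norm h.memLp.1).1 h.memLp

theorem measurable_symKernel (hq : Continuous q) : Measurable fun p : ℝ × ℝ => symKernel q p.1 p.2 := by
  unfold symKernel
  have h1 : Measurable fun p : ℝ × ℝ => q (p.1 - p.2) - q (p.1 + p.2) :=
    (by fun_prop : Continuous fun p : ℝ × ℝ => q (p.1 - p.2) - q (p.1 + p.2)).measurable
  exact h1.div (by fun_prop)

theorem PVAdmissible.integrable_symKernel (h : PVAdmissible C q c) (α : ℝ) :
    Integrable (symKernel q α) ∧
      ∫ u, ‖symKernel q α u‖ ≤ 2 * C * (∫ u, singularWeight u) + 2 * Real.pi + 2 * C := by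
  have h1 := h.integrable_sq
  have i1 : Integrable fun u => ‖q (α - u) - c‖ ^ 2 := h1.comp_sub_left α
  have i2 : Integrable fun u => ‖q (α + u) - c‖ ^ 2 := h1.comp_add_left α
  have iw : Integrable fun u => 2 * C * singularWeight u := integrable_singularWeight.const_mul _
  have iv : Integrable fun u : ℝ => 2 * (1 + u ^ 2)⁻¹ := integrable_inv_one_add_sq.const_mul _
  have hdom := (iw.add iv).add (i1.add i2)
  have hm : AEStronglyMeasurable (symKernel q α) volume :=
    ((measurable_symKernel h.continuous).comp (measurable_prodMk_left (x := α))).aestronglyMeasurable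
  have hi : Integrable (symKernel q α) :=
    hdom.mono' hm (Eventually.of_forall fun u => h.norm_symKernel_le α u)
  refine ⟨hi, (integral_mono hi.norm hdom fun u => h.norm_symKernel_le α u).trans ?_⟩
  rw [integral_add' (iw.add iv) (i1.add i2), integral_add' iw iv, integral_add' i1 i2,
    integral_const_mul, integral_const_mul, integral_univ_inv_one_add_sq,
    integral_sub_left_eq_self (fun x => ‖q x - c‖ ^ 2) volume α,
    integral_add_left_eq_self (fun x => ‖q x - c‖ ^ 2) α]
  linarith [h.integral_sq_le]

/-- The bound for principal value integrals of admissible functions. -/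
def pvBound (C : ℝ) : ℝ := 2 * C * (∫ u, singularWeight u) + 2 * Real.pi + 2 * C

theorem PVAdmissible.pvBound_nonneg (h : PVAdmissible C q c) : 0 ≤ pvBound C :=
  (integral_nonneg fun _ => norm_nonneg _).trans (h.integrable_symKernel 0).2

theorem PVAdmissible.norm_pvIntegral_le (h : PVAdmissible C q c) (α : ℝ) :
    ‖pvIntegral q α‖ ≤ pvBound C := by
  have h1 := (norm_integral_le_integral_norm (symKernel q α)).trans (h.integrable_symKernel α).2
  have h2 : ‖pvIntegral q α‖ = 1 / 2 * ‖∫ u, symKernel q α u‖ := by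
    rw [pvIntegral, norm_mul]; norm_num
  have h3 := h.pvBound_nonneg
  have h4 : ‖∫ u, symKernel q α u‖ ≤ pvBound C := h1
  rw [h2]
  linarith

theorem measurable_pvIntegral (hq : Continuous q) : Measurable (pvIntegral q) := by
  have := (measurable_symKernel hq).stronglyMeasurable.integral_prod_right' (ν := volume)
  exact this.measurable.const_mul _

/-- The Hilbert transform of an admissible function. -/
theorem PVAdmissible.hilbert_eq (h : PVAdmissible C q c) (α : ℝ) :
    hilbert q α = 1 / (Complex.I * Real.pi) * pvIntegral q α := by
  have hC := h.nonneg
  rw [hilbert]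
  congr 1
  refine Tendsto.limUnder_eq ?_
  set A : ℝ → Set ℝ := fun ε => {u : ℝ | ε < |u| ∧ |u| < ε⁻¹} with hA
  have hAm : ∀ ε, MeasurableSet (A ε) := fun ε =>
    (measurableSet_lt measurable_const continuous_abs.measurable).inter
      (measurableSet_lt continuous_abs.measurable measurable_const)
  have key : ∀ ε > 0, ∫ β in {β : ℝ | ε < |α - β| ∧ |α - β| < ε⁻¹}, q β / ((α - β : ℝ) : ℂ) =
      1 / 2 * ∫ u, (A ε).indicator (symKernel q α) u := by
    intro ε hε
    have hA' : MeasurableSet {β : ℝ | ε < |α - β| ∧ |α - β| < ε⁻¹} :=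
      (hAm ε).preimage (measurable_const.sub measurable_id)
    set F : ℝ → ℂ := (A ε).indicator fun u => q (α - u) / (u : ℂ) with hF
    have e1 : ∫ β in {β : ℝ | ε < |α - β| ∧ |α - β| < ε⁻¹}, q β / ((α - β : ℝ) : ℂ) = ∫ u, F u := by
      rw [← integral_indicator hA', ← integral_sub_left_eq_self F volume α]
      congr 1
      ext β
      by_cases hβ : α - β ∈ A ε
      · rw [hF, indicator_of_mem hβ,
            indicator_of_mem (show β ∈ {β : ℝ | ε < |α - β| ∧ |α - β| < ε⁻¹} from hβ), sub_sub_cancel]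
      · rw [hF, indicator_of_notMem hβ,
            indicator_of_notMem (show β ∉ {β : ℝ | ε < |α - β| ∧ |α - β| < ε⁻¹} from hβ)]
    have hFi : Integrable F := by
      rw [hF, integrable_indicator_iff (hAm ε)]
      refine Measure.integrableOn_of_bounded (M := C / ε) ?_ ?_ ?_
      · refine ne_top_of_le_ne_top ?_ (measure_mono (t := Icc (-ε⁻¹) ε⁻¹) fun u hu =>
          abs_le.1 hu.2.le)
        simp
      · have h1 : Measurable fun u => q (α - u) / (u : ℂ) :=
          (h.continuous.comp (continuous_const.sub continuous_id)).measurable.div (by fun_prop)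
        exact h1.aestronglyMeasurable
      · filter_upwards [ae_restrict_mem (hAm ε)] with u hu
        rw [norm_div, Complex.norm_real, Real.norm_eq_abs]
        exact div_le_div₀ hC (h.norm_le _) hε hu.1.le
    -- The truncated region is invariant under `u ↦ -u`, so averaging over the reflection replaces
    -- the integrand by half the symmetrized kernel.
    have hsym : ∫ u, F u = ∫ u, F (-u) := (integral_neg_eq_self F volume).symm
    have e2 : ∀ u, F u + F (-u) = (A ε).indicator (symKernel q α) u := by
      intro u
      have hiff : -u ∈ A ε ↔ u ∈ A ε := by simp [hA]
      by_cases hu : u ∈ A ε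
      · rw [hF, indicator_of_mem hu, indicator_of_mem (hiff.2 hu), indicator_of_mem hu, symKernel]
        push_cast
        rw [sub_neg_eq_add, div_neg, sub_div]
        ring
      · rw [hF, indicator_of_notMem hu, indicator_of_notMem (mt hiff.1 hu), indicator_of_notMem hu,
          add_zero]
    simp_rw [e1, ← e2]
    rw [integral_add hFi hFi.comp_neg, ← hsym]
    ring
  -- After symmetrization the integral converges absolutely, so dominated convergence removes the
  -- truncations at the singularity and at infinity together.
  have hlim : Tendsto (fun ε => ∫ u, (A ε).indicator (symKernel q α) u) (𝓝[>] 0)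
      (𝓝 (∫ u, symKernel q α u)) := by
    refine tendsto_integral_filter_of_dominated_convergence (fun u => ‖symKernel q α u‖)
      (Eventually.of_forall fun ε => (h.integrable_symKernel α).1.1.indicator (hAm ε))
      (Eventually.of_forall fun ε => Eventually.of_forall fun u => norm_indicator_le_norm_self _ _)
      (h.integrable_symKernel α).1.norm ?_
    have hne : ∀ᵐ u : ℝ, u ≠ 0 := by simp [ae_iff, measure_singleton]
    filter_upwards [hne] with u hu
    have hu' : 0 < |u| := abs_pos.2 hu
    refine tendsto_const_nhds.congr' ?_
    have h1 : ∀ᶠ ε : ℝ in 𝓝[>] 0, ε < |u| := (eventually_lt_nhds hu').filter_mono nhdsWithin_le_nhds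
    have h2 : ∀ᶠ ε : ℝ in 𝓝[>] 0, |u| < ε⁻¹ := tendsto_inv_nhdsGT_zero.eventually_gt_atTop _
    filter_upwards [h1, h2] with ε h1 h2
    rw [indicator_of_mem (show u ∈ A ε from ⟨h1, h2⟩)]
  refine (hlim.const_mul (1 / 2)).congr' ?_
  filter_upwards [self_mem_nhdsWithin] with ε hε
  exact (key ε hε).symm

/-- The `L¹` norm of the symmetrized kernel in `u` is bounded uniformly in `α`, so integrability of
`H` is enough for Fubini. -/
theorem PVAdmissible.integrable_prod (h : PVAdmissible C q c) {H : ℝ → ℂ} (hH : Integrable H) :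
    Integrable (fun p : ℝ × ℝ => symKernel q p.1 p.2 * H p.1) (volume.prod volume) := by
  have hm : AEStronglyMeasurable (fun p : ℝ × ℝ => symKernel q p.1 p.2 * H p.1)
      (volume.prod volume) :=
    (measurable_symKernel h.continuous).aestronglyMeasurable.mul hH.1.comp_fst
  rw [integrable_prod_iff hm]
  refine ⟨Eventually.of_forall fun α => (h.integrable_symKernel α).1.mul_const (H α), ?_⟩
  refine (hH.norm.const_mul (pvBound C)).mono' hm.norm.integral_prod_right'
    (Eventually.of_forall fun α => ?_)
  simp only [norm_mul]
  rw [integral_mul_const, Real.norm_of_nonneg (by positivity)]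
  gcongr
  exact (h.integrable_symKernel α).2

/-- Integration by parts for principal value integrals. -/
theorem integral_pvIntegral_mul_deriv {C' : ℝ} {c' : ℂ} {q' H H' : ℝ → ℂ} (h : PVAdmissible C q c)
    (h' : PVAdmissible C' q' c') (hq : ∀ x, HasDerivAt q (q' x) x) (hH : Integrable H)
    (hH' : Integrable H') (hd : ∀ x, HasDerivAt H (H' x) x) :
    ∫ α, pvIntegral q α * H' α = -∫ α, pvIntegral q' α * H α := by
  have e : ∀ (p G : ℝ → ℂ), ∫ α, pvIntegral p α * G α =
      1 / 2 * ∫ α, ∫ u, symKernel p α u * G α := by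
    intro p G
    rw [← integral_const_mul]
    congr 1
    ext α
    rw [pvIntegral, integral_mul_const, mul_assoc]
  have s1 : ∫ α, ∫ u, symKernel q α u * H' α = ∫ u, ∫ α, symKernel q α u * H' α :=
    integral_integral_swap (h.integrable_prod hH')
  have s2 : ∫ α, ∫ u, symKernel q' α u * H α = ∫ u, ∫ α, symKernel q' α u * H α :=
    integral_integral_swap (h'.integrable_prod hH)
  -- For fixed `u` the symmetrized kernel is differentiable in `α`, so the parts formula is an
  -- ordinary one; the principal value integral itself is never differentiated.
  rw [e, e, s1, s2, ← mul_neg, ← integral_neg]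
  congr 2
  ext u
  have bd : ∀ {C : ℝ} {c : ℂ} {p G : ℝ → ℂ}, PVAdmissible C p c → Integrable G →
      Integrable ((fun α => symKernel p α u) * G) := by
    intro C c p G hp hG
    refine hG.bdd_mul (c := (C + C) / |u|) ?_ (Eventually.of_forall fun α => ?_)
    · exact ((measurable_symKernel hp.continuous).comp
        (measurable_prodMk_right (y := u))).aestronglyMeasurable
    · rw [symKernel, norm_div, Complex.norm_real, Real.norm_eq_abs]
      gcongr
      exact (norm_sub_le _ _).trans (add_le_add (hp.norm_le _) (hp.norm_le _))
  refine integral_mul_deriv_eq_deriv_mul_of_integrable (fun α _ => ?_) (fun α _ => hd α)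
    (bd h hH') (bd h' hH) (bd h hH)
  exact (((hq (α - u)).comp_sub_const α u).sub ((hq (α + u)).comp_add_const α u)).div_const _

/-- Boundary values of holomorphic functions in the lower half plane are fixed by the Hilbert
transform. -/
theorem PVAdmissible.pvIntegral_eq_of_cauchyVanishing (h : PVAdmissible C q 0)
    (hq : CauchyVanishing q) (α : ℝ) : pvIntegral q α = Complex.I * Real.pi * q α := by
  have hq2 : MemLp q 2 := by simpa using h.memLp
  have hq2' : MemLp (fun u => q (α - u)) 2 :=
    hq2.comp_measurePreserving (Measure.measurePreserving_sub_left volume α)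
  -- With `r = 1/(u + iy)` and `r' = 1/(u - iy)`, the regularized kernel `u/(u² + y²)` is `(r +
  -- r')/2` and the Poisson kernel is `(r' - r)/(2πi)`. The `r` integral vanishes by the Cauchy
  -- condition at `α + iy`, so both sides are the same multiple of the `r'` integral; then `y → 0`.
  have hS : ∀ y : ℝ, 0 < y → 1 / 2 * ∫ u : ℝ, symKernel q α u * ((u ^ 2 / (u ^ 2 + y ^ 2) : ℝ) : ℂ) =
      Complex.I * Real.pi * scaledPoisson q (α - y * Complex.I) := by
    intro y hy
    set r : ℝ → ℂ := fun u => ((u : ℂ) - -(y * Complex.I))⁻¹ with hr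
    set r' : ℝ → ℂ := fun u => ((u : ℂ) - (y * Complex.I))⁻¹ with hr'
    have hrm : MemLp r 2 := memLp_inv_sub (by simp [hy.ne'])
    have hrm' : MemLp r' 2 := memLp_inv_sub (by simp [hy.ne'])
    have i1 : Integrable fun u => q (α - u) * r u := MemLp.integrable_mul hq2' hrm
    have i2 : Integrable fun u => q (α - u) * r' u := MemLp.integrable_mul hq2' hrm'
    have hns : ∀ u : ℝ, (u : ℂ) ^ 2 + (y : ℂ) ^ 2 ≠ 0 := fun u => by
      have : (0 : ℝ) < u ^ 2 + y ^ 2 := by positivity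
      exact_mod_cast this.ne'
    have hrv : ∀ u : ℝ, r u = (u - y * Complex.I) / (u ^ 2 + y ^ 2) := fun u => by
      have : (u : ℂ) - -(y * Complex.I) ≠ 0 := by
        intro h0
        have := congrArg Complex.im h0
        simp at this
        exact hy.ne' this
      rw [hr, inv_eq_iff_eq_inv, inv_div, eq_div_iff]
      · linear_combination (-(y : ℂ) ^ 2) * Complex.I_sq
      · intro h0
        have := congrArg Complex.im h0
        simp at this
        exact hy.ne' this
    have hrv' : ∀ u : ℝ, r' u = (u + y * Complex.I) / (u ^ 2 + y ^ 2) := fun u => by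
      rw [hr', inv_eq_iff_eq_inv, inv_div, eq_div_iff]
      · linear_combination (-(y : ℂ) ^ 2) * Complex.I_sq
      · intro h0
        have := congrArg Complex.im h0
        simp at this
        exact hy.ne' this
    have h0 : ∫ u, q (α - u) * r u = 0 := by
      have := hq (α + y * Complex.I) (by simp [hy])
      rw [← integral_sub_left_eq_self _ volume α] at this
      rw [← neg_eq_zero, ← integral_neg, ← this]
      congr 1
      ext u
      rw [← mul_neg, hr, ← inv_neg]
      congr 2
      push_cast
      ring
    have hP : scaledPoisson q (α - y * Complex.I) =
        1 / (2 * Complex.I * Real.pi) * ∫ u, (q (α - u) * r' u - q (α - u) * r u) := by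
      rw [← poissonExtension_eq_scaledPoisson q (by simp [hy]), poissonExtension,
        ← integral_const_mul, ← integral_sub_left_eq_self
        (fun u => 1 / (2 * Complex.I * Real.pi) * (q (α - u) * r' u - q (α - u) * r u)) volume α]
      congr 1
      ext β
      rw [sub_sub_cancel, hrv, hrv', poissonKernel]
      have := hns (α - β)
      push_cast at this
      have hpi : (Real.pi : ℂ) ≠ 0 := by exact_mod_cast Real.pi_ne_zero
      have h3 : (y : ℂ) ^ 2 + (α - β : ℂ) ^ 2 ≠ 0 := by rw [add_comm]; exact this
      simp only [Complex.sub_im, Complex.ofReal_im, Complex.mul_im, Complex.ofReal_re, Complex.I_im,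
        mul_one, Complex.I_re, mul_zero, add_zero, zero_sub, neg_neg, Complex.sub_re,
        Complex.mul_re, sub_zero]
      push_cast
      have hI := Complex.I_ne_zero
      field_simp
      ring
    have hK : ∫ u : ℝ, symKernel q α u * ((u ^ 2 / (u ^ 2 + y ^ 2) : ℝ) : ℂ) =
        ∫ u, (q (α - u) * r u + q (α - u) * r' u) := by
      have i3 : Integrable fun u => (q (α - u) * r u + q (α - u) * r' u) / 2 := (i1.add i2).div_const _
      have e : ∀ u : ℝ, symKernel q α u * ((u ^ 2 / (u ^ 2 + y ^ 2) : ℝ) : ℂ) =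
          (q (α - u) * r u + q (α - u) * r' u) / 2 +
          (q (α - -u) * r (-u) + q (α - -u) * r' (-u)) / 2 := fun u => by
        rcases eq_or_ne u 0 with rfl | hu
        · simp [symKernel, hr, hr']
        rw [hrv, hrv', hrv, hrv', symKernel]
        have := hns u
        have hu' : (u : ℂ) ≠ 0 := by exact_mod_cast hu
        push_cast
        rw [sub_neg_eq_add, neg_sq]
        field_simp
        ring
      simp_rw [e]
      rw [integral_add i3 i3.comp_neg, integral_neg_eq_self
        (fun u => (q (α - u) * r u + q (α - u) * r' u) / 2) volume, integral_div]
      ring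
    rw [hK, hP, integral_add i1 i2, integral_sub i2 i1, h0]
    have hpi : (Real.pi : ℂ) ≠ 0 := by exact_mod_cast Real.pi_ne_zero
    have hI := Complex.I_ne_zero
    field_simp
    ring
  have hl1 : Tendsto (fun y : ℝ => 1 / 2 * ∫ u : ℝ, symKernel q α u * ((u ^ 2 / (u ^ 2 + y ^ 2) : ℝ) : ℂ))
      (𝓝[>] 0) (𝓝 (pvIntegral q α)) := by
    refine Tendsto.const_mul _ ?_
    refine tendsto_integral_filter_of_dominated_convergence (fun u => ‖symKernel q α u‖)
      (Eventually.of_forall fun y => (h.integrable_symKernel α).1.1.mul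
        (Measurable.aestronglyMeasurable (by fun_prop)))
      (Eventually.of_forall fun y => Eventually.of_forall fun u => ?_)
      (h.integrable_symKernel α).1.norm ?_
    · rw [norm_mul, Complex.norm_real, Real.norm_of_nonneg (by positivity)]
      exact mul_le_of_le_one_right (norm_nonneg _)
        (div_le_one_of_le₀ (by nlinarith [sq_nonneg y]) (by positivity))
    · have hne : ∀ᵐ u : ℝ, u ≠ 0 := by simp [ae_iff, measure_singleton]
      filter_upwards [hne] with u hu
      have h1 : Tendsto (fun y : ℝ => u ^ 2 / (u ^ 2 + y ^ 2)) (𝓝 0) (𝓝 (u ^ 2 / (u ^ 2 + 0 ^ 2))) :=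
        (tendsto_const_nhds).div (tendsto_const_nhds.add (tendsto_id.pow 2)) (by positivity)
      have h2 : u ^ 2 / (u ^ 2 + 0 ^ 2) = 1 := by
        rw [zero_pow two_ne_zero, add_zero, div_self (by positivity)]
      rw [h2] at h1
      have h3 := ((Complex.continuous_ofReal.tendsto 1).comp h1).const_mul (symKernel q α u)
      rw [Complex.ofReal_one, mul_one] at h3
      exact h3.mono_left nhdsWithin_le_nhds
  have hl2 : Tendsto (fun y : ℝ => Complex.I * Real.pi * scaledPoisson q (α - y * Complex.I)) (𝓝[>] 0)
      (𝓝 (Complex.I * Real.pi * q α)) := by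
    have hc : Continuous fun y : ℝ => Complex.I * Real.pi * scaledPoisson q (α - y * Complex.I) :=
      continuous_const.mul ((continuous_scaledPoisson h.continuous h.norm_le).comp (by fun_prop))
    have := hc.tendsto 0
    simp only [Complex.ofReal_zero, zero_mul, sub_zero, scaledPoisson_ofReal] at this
    exact this.mono_left nhdsWithin_le_nhds
  refine tendsto_nhds_unique hl1 (hl2.congr' ?_)
  filter_upwards [self_mem_nhdsWithin] with y hy
  exact (hS y hy).symm

/-! ### The coefficient `B₁` -/

theorem HTwoBound.nonneg {A : ℝ} {φ : ℝ → ℂ} (h : HTwoBound A φ) : 0 ≤ A :=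
  (norm_nonneg _).trans (h.norm_le 0)

section

variable {A : ℝ} {f : ℝ → ℂ}

theorem HTwoBound.deriv_sub_one (x : ℝ) : deriv (fun x => f x - 1) x = deriv f x :=
  deriv_sub_const 1

theorem HTwoBound.hasDerivAt' (h : HTwoBound A fun x => f x - 1) (x : ℝ) :
    HasDerivAt f (deriv f x) x := by
  have := (h.hasDerivAt x).add_const 1
  rw [deriv_sub_one] at this
  simpa using this

theorem HTwoBound.continuous (h : HTwoBound A fun x => f x - 1) : Continuous f :=
  continuous_iff_continuousAt.2 fun x => (h.hasDerivAt' x).continuousAt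

theorem HTwoBound.norm_le' (h : HTwoBound A fun x => f x - 1) (x : ℝ) : ‖f x‖ ≤ A + 1 := by
  have h1 := h.norm_le x
  have h2 := norm_add_le (f x - 1) 1
  rw [sub_add_cancel, norm_one] at h2
  linarith

theorem HTwoBound.norm_deriv_le' (h : HTwoBound A fun x => f x - 1) (x : ℝ) : ‖deriv f x‖ ≤ A := by
  have := h.norm_deriv_le x
  rwa [deriv_sub_one] at this

theorem HTwoBound.holder' (h : HTwoBound A fun x => f x - 1) (x y : ℝ) :
    ‖f x - f y‖ ≤ A * |x - y| ^ (1 / 4 : ℝ) := by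
  simpa using h.holder x y

theorem HTwoBound.holder_deriv' (h : HTwoBound A fun x => f x - 1) (x y : ℝ) :
    ‖deriv f x - deriv f y‖ ≤ A * |x - y| ^ (1 / 4 : ℝ) := by
  have := h.holder_deriv x y
  rwa [deriv_sub_one, deriv_sub_one] at this

theorem HTwoBound.deriv_eq : deriv (fun x => f x - 1) = deriv f := funext fun x => deriv_sub_one x

theorem HTwoBound.memLp_deriv' (h : HTwoBound A fun x => f x - 1) : MemLp (deriv f) 2 := by
  have := h.memLp_deriv
  rwa [deriv_eq] at this

theorem HTwoBound.integral_deriv_sq_le' (h : HTwoBound A fun x => f x - 1) :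
    ∫ x, ‖deriv f x‖ ^ 2 ≤ A := by
  have := h.integral_deriv_sq_le
  rwa [deriv_eq] at this

theorem continuous_of_holder {C : ℝ} {q : ℝ → ℂ} (h : ∀ x y, ‖q x - q y‖ ≤ C * |x - y| ^ (1 / 4 : ℝ)) :
    Continuous q := by
  refine continuous_iff_continuousAt.2 fun x => tendsto_iff_norm_sub_tendsto_zero.2 ?_
  refine squeeze_zero (fun y => norm_nonneg _) (fun y => h y x) ?_
  have hc : Continuous fun y : ℝ => C * |y - x| ^ (1 / 4 : ℝ) :=
    continuous_const.mul ((continuous_abs.comp (continuous_sub_right x)).rpow_const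
      fun _ => Or.inr (by norm_num))
  have := hc.tendsto x
  simpa using this

theorem HTwoBound.continuous_deriv (h : HTwoBound A fun x => f x - 1) : Continuous (deriv f) :=
  continuous_of_holder h.holder_deriv'

theorem HTwoBound.norm_sub_le (h : HTwoBound A fun x => f x - 1) (x y : ℝ) :
    ‖f x - f y‖ ≤ A * |x - y| :=
  Convex.norm_image_sub_le_of_norm_hasDerivWithin_le
    (fun z _ => (h.hasDerivAt' z).hasDerivWithinAt) (fun z _ => h.norm_deriv_le' z) convex_univ
    (mem_univ y) (mem_univ x)

/-- A criterion for admissibility in terms of bounds by `f` and its derivative. -/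
theorem pvAdmissible_of_le {C : ℝ} {q g : ℝ → ℂ} {c : ℂ} (hC : ∀ x, ‖q x‖ ≤ C)
    (hh : ∀ x y, ‖q x - q y‖ ≤ C * |x - y| ^ (1 / 4 : ℝ)) {a : ℝ} (hg : MemLp g 2)
    (hqg : ∀ x, ‖q x - c‖ ≤ a * ‖g x‖) (hi : a ^ 2 * ∫ x, ‖g x‖ ^ 2 ≤ C) : PVAdmissible C q c := by
  have hc := continuous_of_holder hh
  have hm : MemLp (fun x => q x - c) 2 :=
    MemLp.of_le_mul hg (hc.sub continuous_const).aestronglyMeasurable (Eventually.of_forall hqg)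
  refine ⟨hc, hC, hh, hm, le_trans ?_ hi⟩
  rw [← integral_const_mul]
  refine integral_mono ((memLp_two_iff_integrable_sq_norm hm.1).1 hm)
    (((memLp_two_iff_integrable_sq_norm hg.1).1 hg).const_mul _) fun x => ?_
  simp only
  rw [← mul_pow]
  exact pow_le_pow_left₀ (norm_nonneg _) (hqg x) 2

/-- The constant of admissibility for the quadratic expressions below. -/
def quadBound (A : ℝ) : ℝ := 8 * (A + 1) ^ 3

theorem HTwoBound.pvAdmissible_deriv (h : HTwoBound A fun x => f x - 1) :
    PVAdmissible A (deriv f) 0 :=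
  pvAdmissible_of_le (a := 1) h.norm_deriv_le' h.holder_deriv' h.memLp_deriv' (fun x => by simp)
    (by simpa using h.integral_deriv_sq_le')

/-- The function `|f|²` tends to `1` and is not square integrable, but `|f|² - 1 = (|f| - 1)(|f| +
1)` is. This is why admissibility allows subtraction of a constant. -/
theorem HTwoBound.pvAdmissible_sq (h : HTwoBound A fun x => f x - 1) :
    PVAdmissible (quadBound A) (fun x => ((‖f x‖ ^ 2 : ℝ) : ℂ)) 1 := by
  have hA := h.nonneg
  have h3 : 0 ≤ A ^ 2 := by positivity
  have h4 : 0 ≤ A ^ 3 := by positivity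
  refine pvAdmissible_of_le (a := A + 2) (fun x => ?_) (fun x y => ?_) h.memLp (fun x => ?_) ?_
  · rw [Complex.norm_real, Real.norm_of_nonneg (by positivity), quadBound]
    have := pow_le_pow_left₀ (norm_nonneg _) (h.norm_le' x) 2
    nlinarith
  · rw [← Complex.ofReal_sub, Complex.norm_real, Real.norm_eq_abs, sq_sub_sq, abs_mul,
      abs_of_nonneg (by positivity : 0 ≤ ‖f x‖ + ‖f y‖)]
    have h1 := (abs_norm_sub_norm_le (f x) (f y)).trans (h.holder' x y)
    have h2 : ‖f x‖ + ‖f y‖ ≤ 2 * (A + 1) := by linarith [h.norm_le' x, h.norm_le' y]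
    calc _ ≤ 2 * (A + 1) * (A * |x - y| ^ (1 / 4 : ℝ)) := by gcongr
      _ = (2 * (A + 1) * A) * |x - y| ^ (1 / 4 : ℝ) := by ring
      _ ≤ _ := by
        gcongr
        rw [quadBound]; nlinarith
  · have e : ((‖f x‖ ^ 2 : ℝ) : ℂ) - 1 = (((‖f x‖ - 1) * (‖f x‖ + 1) : ℝ) : ℂ) := by push_cast; ring
    rw [e, Complex.norm_real, Real.norm_eq_abs, abs_mul, mul_comm,
      abs_of_nonneg (by positivity : 0 ≤ ‖f x‖ + 1)]
    have h1 := abs_norm_sub_norm_le (f x) 1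
    rw [norm_one] at h1
    exact mul_le_mul (by linarith [h.norm_le' x]) h1 (abs_nonneg _) (by linarith)
  · calc (A + 2) ^ 2 * _ ≤ (A + 2) ^ 2 * A := by gcongr; exact h.integral_sq_le
      _ ≤ quadBound A := by rw [quadBound]; nlinarith

theorem HTwoBound.pvAdmissible_conj_mul (h : HTwoBound A fun x => f x - 1) :
    PVAdmissible (quadBound A) (fun x => (starRingEnd ℂ) (f x) * deriv f x) 0 := by
  have hA := h.nonneg
  have h3 : 0 ≤ A ^ 2 := by positivity
  have h4 : 0 ≤ A ^ 3 := by positivity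
  refine pvAdmissible_of_le (a := A + 1) (fun x => ?_) (fun x y => ?_) h.memLp_deriv' (fun x => ?_) ?_
  · rw [norm_mul, RCLike.norm_conj, quadBound]
    calc _ ≤ (A + 1) * A := by gcongr; exacts [h.norm_le' x, h.norm_deriv_le' x]
      _ ≤ _ := by nlinarith
  · have e : (starRingEnd ℂ) (f x) * deriv f x - (starRingEnd ℂ) (f y) * deriv f y =
        (starRingEnd ℂ) (f x) * (deriv f x - deriv f y) +
          (starRingEnd ℂ) (f x - f y) * deriv f y := by rw [map_sub]; ring
    rw [e]
    refine (norm_add_le _ _).trans ?_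
    rw [norm_mul, norm_mul, RCLike.norm_conj, RCLike.norm_conj]
    calc _ ≤ (A + 1) * (A * |x - y| ^ (1 / 4 : ℝ)) + (A * |x - y| ^ (1 / 4 : ℝ)) * A := by
          gcongr
          exacts [h.norm_le' x, h.holder_deriv' x y, h.holder' x y, h.norm_deriv_le' y]
      _ = ((A + 1) * A + A * A) * |x - y| ^ (1 / 4 : ℝ) := by ring
      _ ≤ _ := by
        gcongr
        rw [quadBound]; nlinarith
  · rw [sub_zero, norm_mul, RCLike.norm_conj]
    gcongr
    exact h.norm_le' x
  · calc (A + 1) ^ 2 * _ ≤ (A + 1) ^ 2 * A := by gcongr; exact h.integral_deriv_sq_le'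
      _ ≤ quadBound A := by rw [quadBound]; nlinarith

/-- Used for `p = f̄ f'`, where `2 Re p` is the derivative of `|f|²` and so governs the derivative
of the drift. -/
theorem PVAdmissible.two_re {C : ℝ} {p : ℝ → ℂ} (h : PVAdmissible C p 0) :
    PVAdmissible (4 * C) (fun x => ((2 * (p x).re : ℝ) : ℂ)) 0 := by
  have hC := h.nonneg
  refine pvAdmissible_of_le (a := 2) (g := p) (fun x => ?_) (fun x y => ?_) (by simpa using h.memLp)
    (fun x => ?_) ?_
  · rw [Complex.norm_real, Real.norm_eq_abs, abs_mul, abs_two]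
    linarith [Complex.abs_re_le_norm (p x), h.norm_le x]
  · rw [← Complex.ofReal_sub, Complex.norm_real, Real.norm_eq_abs, ← mul_sub, abs_mul, abs_two,
      ← Complex.sub_re]
    have := (Complex.abs_re_le_norm (p x - p y)).trans (h.holder x y)
    have h2 : 0 ≤ C * |x - y| ^ (1 / 4 : ℝ) := by positivity
    linarith
  · rw [sub_zero, Complex.norm_real, Real.norm_eq_abs, abs_mul, abs_two]
    linarith [Complex.abs_re_le_norm (p x)]
  · have := h.integral_sq_le
    simp only [sub_zero] at this
    linarith

theorem symKernel_two_re (p : ℝ → ℂ) (α u : ℝ) :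
    symKernel (fun x => ((2 * (p x).re : ℝ) : ℂ)) α u = ((2 * (symKernel p α u).re : ℝ) : ℂ) := by
  simp only [symKernel, Complex.div_ofReal_re, Complex.sub_re]
  push_cast
  ring

theorem PVAdmissible.pvIntegral_two_re {C : ℝ} {p : ℝ → ℂ} (h : PVAdmissible C p 0) (α : ℝ) :
    pvIntegral (fun x => ((2 * (p x).re : ℝ) : ℂ)) α = ((2 * (pvIntegral p α).re : ℝ) : ℂ) := by
  have hr := integral_re (h.integrable_symKernel α).1
  simp only [pvIntegral]
  simp_rw [symKernel_two_re]
  simp only [RCLike.re_to_complex] at hr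
  rw [integral_complex_ofReal, integral_const_mul, hr]
  have e : (1 / 2 : ℂ) = ((1 / 2 : ℝ) : ℂ) := by norm_num
  rw [e, Complex.re_ofReal_mul]
  push_cast
  ring

theorem HTwoBound.hasDerivAt_sq (h : HTwoBound A fun x => f x - 1) (x : ℝ) :
    HasDerivAt (fun x => ((‖f x‖ ^ 2 : ℝ) : ℂ))
      ((2 * ((starRingEnd ℂ) (f x) * deriv f x).re : ℝ) : ℂ) x := by
  have h1 := (h.hasDerivAt' x).norm_sq
  refine h1.ofReal_comp.congr_deriv ?_
  rw [Complex.inner, mul_comm (deriv f x)]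

/-- The integrand of the Gagliardo form of `B₁`. -/
def gagliardoKernel (f : ℝ → ℂ) (α u : ℝ) : ℝ :=
  (‖f α - f (α - u)‖ ^ 2 + ‖f α - f (α + u)‖ ^ 2) / u ^ 2

/-- The Gagliardo form of `B₁`. -/
def gagliardo (f : ℝ → ℂ) (α : ℝ) : ℝ := 1 / (2 * Real.pi) * ∫ u, gagliardoKernel f α u

theorem gagliardoKernel_nonneg (f : ℝ → ℂ) (α u : ℝ) : 0 ≤ gagliardoKernel f α u := by
  unfold gagliardoKernel; positivity

theorem gagliardo_nonneg (f : ℝ → ℂ) (α : ℝ) : 0 ≤ gagliardo f α :=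
  mul_nonneg (by positivity) (integral_nonneg fun u => gagliardoKernel_nonneg f α u)

/-- The quadratic bound serves near `u = 0` and the constant bound for large `u`; together they give
an integrable majorant. -/
theorem div_sq_le {a b u : ℝ} (ha : 0 ≤ a) (hb : 0 ≤ b) (h1 : a ≤ b * u ^ 2) (h2 : a ≤ 4 * b) :
    a / u ^ 2 ≤ 8 * b * (1 + u ^ 2)⁻¹ := by
  rcases eq_or_ne u 0 with rfl | hu
  · simp; positivity
  have hu2 : 0 < u ^ 2 := by positivity
  rw [← div_eq_mul_inv, div_le_div_iff₀ hu2 (by positivity)]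
  nlinarith

theorem HTwoBound.gagliardoKernel_le (h : HTwoBound A fun x => f x - 1) (α u : ℝ) :
    gagliardoKernel f α u ≤ 16 * (A + 1) ^ 2 * (1 + u ^ 2)⁻¹ := by
  have hA := h.nonneg
  have key : ∀ v, |α - v| = |u| → ‖f α - f v‖ ^ 2 / u ^ 2 ≤ 8 * (A + 1) ^ 2 * (1 + u ^ 2)⁻¹ := by
    intro v hv
    refine div_sq_le (by positivity) (by positivity) ?_ ?_
    · have h1 := h.norm_sub_le α v
      rw [hv] at h1
      calc ‖f α - f v‖ ^ 2 ≤ (A * |u|) ^ 2 := by gcongr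
        _ = A ^ 2 * u ^ 2 := by rw [mul_pow, sq_abs]
        _ ≤ _ := by gcongr; linarith
    · have h1 := _root_.norm_sub_le (f α) (f v)
      have h2 : ‖f α - f v‖ ≤ 2 * (A + 1) := by linarith [h.norm_le' α, h.norm_le' v]
      calc ‖f α - f v‖ ^ 2 ≤ (2 * (A + 1)) ^ 2 := by gcongr
        _ = _ := by ring
  rw [gagliardoKernel, add_div]
  have h1 := key (α - u) (by simp)
  have h2 := key (α + u) (by simp)
  linarith

theorem measurable_gagliardoKernel (hf : Continuous f) :
    Measurable fun p : ℝ × ℝ => gagliardoKernel f p.1 p.2 := by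
  unfold gagliardoKernel
  have h1 : Continuous fun p : ℝ × ℝ => ‖f p.1 - f (p.1 - p.2)‖ ^ 2 + ‖f p.1 - f (p.1 + p.2)‖ ^ 2 := by
    fun_prop
  exact h1.measurable.div (by fun_prop)

theorem HTwoBound.integrable_gagliardoKernel (h : HTwoBound A fun x => f x - 1) (α : ℝ) :
    Integrable (gagliardoKernel f α) := by
  refine (integrable_inv_one_add_sq.const_mul (16 * (A + 1) ^ 2)).mono'
    ((measurable_gagliardoKernel h.continuous).comp
      (measurable_prodMk_left (x := α))).aestronglyMeasurable (Eventually.of_forall fun u => ?_)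
  rw [Real.norm_of_nonneg (gagliardoKernel_nonneg f α u)]
  exact h.gagliardoKernel_le α u

theorem HTwoBound.gagliardo_le (h : HTwoBound A fun x => f x - 1) (α : ℝ) :
    gagliardo f α ≤ 8 * (A + 1) ^ 2 := by
  have h1 := integral_mono (h.integrable_gagliardoKernel α)
    (integrable_inv_one_add_sq.const_mul (16 * (A + 1) ^ 2)) fun u => h.gagliardoKernel_le α u
  rw [integral_const_mul, integral_univ_inv_one_add_sq] at h1
  have hpi := Real.pi_pos
  rw [gagliardo, one_div, inv_mul_le_iff₀ (by positivity)]
  linarith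

theorem measurable_gagliardo (hf : Continuous f) : Measurable (gagliardo f) := by
  have := (measurable_gagliardoKernel hf).stronglyMeasurable.integral_prod_right' (ν := volume)
  exact this.measurable.const_mul _

/-- Integration by parts in the commutator. -/
theorem HTwoBound.re_commutator (h : HTwoBound A fun x => f x - 1) (α : ℝ) :
    4 * ((starRingEnd ℂ) (f α) * pvIntegral (deriv f) α -
      pvIntegral (fun x => (starRingEnd ℂ) (f x) * deriv f x) α).re = ∫ u, gagliardoKernel f α u := by
  have hA := h.nonneg
  set p : ℝ → ℂ := fun x => (starRingEnd ℂ) (f x) * deriv f x with hp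
  set κ : ℝ → ℂ := fun u => (starRingEnd ℂ) (f α) * symKernel (deriv f) α u - symKernel p α u with hκ
  have i1 := (h.pvAdmissible_deriv.integrable_symKernel α).1
  have i2 := (h.pvAdmissible_conj_mul.integrable_symKernel α).1
  have hκi : Integrable κ := (i1.const_mul _).sub i2
  have hκre : Integrable fun u => 2 * (κ u).re := hκi.re.const_mul 2
  have e1 : ∫ u, 2 * (κ u).re = 4 * ((starRingEnd ℂ) (f α) * pvIntegral (deriv f) α -
      pvIntegral p α).re := by
    have h1 := integral_re hκi
    simp only [RCLike.re_to_complex] at h1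
    rw [integral_const_mul, h1, hκ, integral_sub (i1.const_mul _) i2, integral_const_mul]
    have e : (starRingEnd ℂ) (f α) * pvIntegral (deriv f) α - pvIntegral p α =
        ((1 / 2 : ℝ) : ℂ) * ((starRingEnd ℂ) (f α) * (∫ u, symKernel (deriv f) α u) -
          ∫ u, symKernel p α u) := by
      simp only [pvIntegral]; push_cast; ring
    rw [e, Complex.re_ofReal_mul]
    ring
  rw [← e1]
  have hgi := h.integrable_gagliardoKernel α
  set D : ℝ → ℝ := fun u => ‖f α - f (α - u)‖ ^ 2 + ‖f α - f (α + u)‖ ^ 2 with hD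
  have hDb : ∀ u, D u ≤ 2 * A ^ 2 * u ^ 2 ∧ D u ≤ 8 * (A + 1) ^ 2 := by
    intro u
    have k1 : ‖f α - f (α - u)‖ ≤ A * |u| := by simpa using h.norm_sub_le α (α - u)
    have k2 : ‖f α - f (α + u)‖ ≤ A * |u| := by simpa using h.norm_sub_le α (α + u)
    have k3 : ‖f α - f (α - u)‖ ≤ 2 * (A + 1) := by
      linarith [_root_.norm_sub_le (f α) (f (α - u)), h.norm_le' α, h.norm_le' (α - u)]
    have k4 : ‖f α - f (α + u)‖ ≤ 2 * (A + 1) := by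
      linarith [_root_.norm_sub_le (f α) (f (α + u)), h.norm_le' α, h.norm_le' (α + u)]
    have l1 := pow_le_pow_left₀ (norm_nonneg _) k1 2
    have l2 := pow_le_pow_left₀ (norm_nonneg _) k2 2
    have l3 := pow_le_pow_left₀ (norm_nonneg _) k3 2
    have l4 := pow_le_pow_left₀ (norm_nonneg _) k4 2
    rw [mul_pow, sq_abs] at l1 l2
    constructor <;> simp only [hD] <;> linarith
  have hDn : ∀ u, 0 ≤ D u := fun u => by simp only [hD]; positivity
  -- Since `D'(u)/u` is `2 Re κ` and `D(u)/u²` is the Gagliardo kernel, the two integrals differ by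
  -- boundary values of `D(u)/u`. These vanish at `0`, where `D = O(u²)`, and at `±∞`, where `D` is
  -- bounded.
  have hP : ∀ u : ℝ, u ≠ 0 → HasDerivAt (fun u => D u / u) (2 * (κ u).re - gagliardoKernel f α u) u := by
    intro u hu
    have d1 : HasDerivAt (fun u => f α - f (α - u)) (deriv f (α - u)) u := by
      have := ((h.hasDerivAt' (α - u)).comp_const_sub α u).const_sub (f α)
      simpa using this
    have d2 : HasDerivAt (fun u => f α - f (α + u)) (-deriv f (α + u)) u :=
      ((h.hasDerivAt' (α + u)).comp_const_add α u).const_sub (f α)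
    refine ((d1.norm_sq.add d2.norm_sq).div (hasDerivAt_id u) hu).congr_deriv ?_
    rw [Complex.inner, Complex.inner]
    have hre : (κ u).re = ((deriv f (α - u) * (starRingEnd ℂ) (f α - f (α - u))).re +
        (-deriv f (α + u) * (starRingEnd ℂ) (f α - f (α + u))).re) / u := by
      have : κ u = (deriv f (α - u) * (starRingEnd ℂ) (f α - f (α - u)) +
        (-deriv f (α + u) * (starRingEnd ℂ) (f α - f (α + u)))) / (u : ℂ) := by
        simp only [hκ, hp, symKernel, map_sub]
        ring
      rw [this, Complex.div_ofReal_re, Complex.add_re]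
    rw [hre, gagliardoKernel]
    simp only [Pi.add_apply, id]
    field_simp
  have hPi : Integrable fun u => 2 * (κ u).re - gagliardoKernel f α u := hκre.sub hgi
  have hPa : ∀ u, |D u / u| ≤ 2 * A ^ 2 * |u| := fun u => by
    rcases eq_or_ne u 0 with rfl | hu
    · simp
    rw [abs_div, abs_of_nonneg (hDn u), div_le_iff₀ (abs_pos.2 hu), mul_assoc, ← sq, sq_abs]
    exact (hDb u).1
  -- The conventional value of a quotient by zero is `0`, which here is the true limit, so the
  -- function is continuous across the singular point.
  have hPc : ContinuousAt (fun u => D u / u) 0 := by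
    rw [ContinuousAt, div_zero]
    refine squeeze_zero_norm hPa ?_
    have : Continuous fun u : ℝ => 2 * A ^ 2 * |u| := by fun_prop
    simpa using this.tendsto 0
  have hPb : ∀ u, |D u / u| ≤ 8 * (A + 1) ^ 2 * |u|⁻¹ := fun u => by
    rw [abs_div, abs_of_nonneg (hDn u), div_eq_mul_inv]
    gcongr
    exact (hDb u).2
  have hinf : ∀ l : Filter ℝ, Tendsto (fun u : ℝ => |u|) l atTop →
      Tendsto (fun u => D u / u) l (𝓝 0) := fun l hl => by
    refine squeeze_zero_norm hPb ?_
    simpa using (tendsto_inv_atTop_zero.comp hl).const_mul (8 * (A + 1) ^ 2)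
  have r1 := integral_Ioi_of_hasDerivAt_of_tendsto (a := 0) (f := fun u => D u / u)
    hPc.continuousWithinAt (fun u hu => hP u (ne_of_gt hu)) hPi.integrableOn
    (hinf _ tendsto_abs_atTop_atTop)
  have r2 := integral_Iic_of_hasDerivAt_of_tendsto (a := 0) (f := fun u => D u / u)
    hPc.continuousWithinAt (fun u hu => hP u (ne_of_lt hu)) hPi.integrableOn
    (hinf _ tendsto_abs_atBot_atTop)
  have r3 := intervalIntegral.integral_Iic_add_Ioi (b := (0 : ℝ)) hPi.integrableOn hPi.integrableOn
  rw [r1, r2, integral_sub hκre hgi] at r3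
  simp only [div_zero] at r3
  linarith

end

variable {A : ℝ} {ζ : ℝ → ℂ}

/-- `B₁` in Gagliardo form; in particular it is nonnegative. -/
theorem coeffB1_eq_gagliardo (h : HTwoBound A fun x => 1 / ζ x - 1) (α : ℝ) :
    coeffB1 ζ α = gagliardo (fun x => 1 / ζ x) α := by
  have h1 := h.re_commutator α
  have hc : ∀ β, 1 / (starRingEnd ℂ) (ζ β) = (starRingEnd ℂ) (1 / ζ β) := fun β => by simp
  simp only [coeffB1, hilbertCommutator, hc]
  change -2 * ((starRingEnd ℂ) (1 / ζ α) * hilbert (deriv fun x => 1 / ζ x) α -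
    hilbert (fun β => (starRingEnd ℂ) (1 / ζ β) * deriv (fun x => 1 / ζ x) β) α).im = _
  rw [h.pvAdmissible_deriv.hilbert_eq, h.pvAdmissible_conj_mul.hilbert_eq, gagliardo, ← h1]
  set X := pvIntegral (deriv fun x => 1 / ζ x) α
  set Y := pvIntegral (fun β => (starRingEnd ℂ) (1 / ζ β) * deriv (fun x => 1 / ζ x) β) α
  set a := (starRingEnd ℂ) (1 / ζ α)
  -- Since `1/(iπ) = -i/π`, the operation `-2 Im` turns the commutator into `(2/π) Re (a X - Y)`,
  -- which is `1/(2π)` times the quantity in `re_commutator`.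
  have e : a * (1 / (Complex.I * Real.pi) * X) - 1 / (Complex.I * Real.pi) * Y =
      ((Real.pi⁻¹ : ℝ) : ℂ) * (-Complex.I * (a * X - Y)) := by
    have hI := Complex.I_ne_zero
    have hpi : (Real.pi : ℂ) ≠ 0 := by exact_mod_cast Real.pi_ne_zero
    push_cast
    field_simp
    linear_combination (a * X - Y) * Complex.I_sq
  rw [e, Complex.im_ofReal_mul]
  have hpi := Real.pi_ne_zero
  simp only [Complex.neg_im, Complex.neg_re, Complex.mul_im, Complex.I_re, Complex.I_im]
  field_simp
  ring

/-- The derivative of the drift, up to the factor `-1/π`. -/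
theorem two_re_pvIntegral (h : HTwoBound A fun x => 1 / ζ x - 1)
    (hc : CauchyVanishing (deriv fun x => 1 / ζ x)) (α : ℝ) :
    2 * (pvIntegral (fun x => (starRingEnd ℂ) (1 / ζ x) * deriv (fun x => 1 / ζ x) x) α).re =
      -Real.pi * (coeffB1 ζ α + 2 * ((starRingEnd ℂ) (1 / ζ α) * deriv (fun x => 1 / ζ x) α).im) := by
  have h1 := h.re_commutator α
  -- Holomorphy enters here: the first term of the commutator becomes the local expression `iπ f̄
  -- f'`, and the identity can be solved for the nonlocal one.
  rw [h.pvAdmissible_deriv.pvIntegral_eq_of_cauchyVanishing hc α] at h1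
  rw [coeffB1_eq_gagliardo h, gagliardo, ← h1]
  set Y := pvIntegral (fun x => (starRingEnd ℂ) (1 / ζ x) * deriv (fun x => 1 / ζ x) x) α
  set a := (starRingEnd ℂ) (1 / ζ α)
  set d := deriv (fun x => 1 / ζ x) α
  have e : a * (Complex.I * Real.pi * d) = ((Real.pi : ℝ) : ℂ) * (Complex.I * (a * d)) := by ring
  rw [e, Complex.sub_re, Complex.re_ofReal_mul, Complex.I_mul_re]
  have hpi := Real.pi_ne_zero
  field_simp
  ring

theorem driftB_eq (h : HTwoBound A fun x => 1 / ζ x - 1) (α : ℝ) :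
    driftB ζ α = ((-(1 / Real.pi) : ℝ) : ℂ) *
      pvIntegral (fun x => ((‖1 / ζ x‖ ^ 2 : ℝ) : ℂ)) α := by
  have hc : (fun β => 1 / ((‖ζ β‖ ^ 2 : ℝ) : ℂ)) = fun x => ((‖1 / ζ x‖ ^ 2 : ℝ) : ℂ) := by
    ext β; simp
  rw [driftB, hc, h.pvAdmissible_sq.hilbert_eq]
  have hI := Complex.I_ne_zero
  have hpi : (Real.pi : ℂ) ≠ 0 := by exact_mod_cast Real.pi_ne_zero
  push_cast
  field_simp

/-! ### Integrability of `B₁` -/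

/-- Jensen's inequality on a unit interval, from the nonnegativity of the variance of `‖v‖`. -/
theorem sq_norm_intervalIntegral_le {v : ℝ → ℂ} (hv : Continuous v) :
    ‖∫ θ in (0 : ℝ)..1, v θ‖ ^ 2 ≤ ∫ θ in (0 : ℝ)..1, ‖v θ‖ ^ 2 := by
  set m := ∫ θ in (0 : ℝ)..1, ‖v θ‖ with hm
  have h1 : ‖∫ θ in (0 : ℝ)..1, v θ‖ ≤ m :=
    intervalIntegral.norm_integral_le_integral_norm zero_le_one
  have h2 : 0 ≤ ∫ θ in (0 : ℝ)..1, (‖v θ‖ - m) ^ 2 :=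
    intervalIntegral.integral_nonneg zero_le_one fun θ _ => sq_nonneg _
  have h3 : ∫ θ in (0 : ℝ)..1, (‖v θ‖ - m) ^ 2 = (∫ θ in (0 : ℝ)..1, ‖v θ‖ ^ 2) - m ^ 2 := by
    have e : ∀ θ, (‖v θ‖ - m) ^ 2 = ‖v θ‖ ^ 2 - (2 * m * ‖v θ‖ - m ^ 2) := fun θ => by ring
    simp_rw [e]
    rw [intervalIntegral.integral_sub (Continuous.intervalIntegrable (by fun_prop) _ _)
      (Continuous.intervalIntegrable (by fun_prop) _ _),
      intervalIntegral.integral_sub (Continuous.intervalIntegrable (by fun_prop) _ _)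
      (Continuous.intervalIntegrable (by fun_prop) _ _), intervalIntegral.integral_const_mul, ← hm]
    simp
    ring
  have h4 := pow_le_pow_left₀ (norm_nonneg _) h1 2
  linarith

variable {A : ℝ} {f : ℝ → ℂ}

theorem HTwoBound.integrable_sq (h : HTwoBound A fun x => f x - 1) :
    Integrable fun x => ‖f x - 1‖ ^ 2 :=
  (memLp_two_iff_integrable_sq_norm h.memLp.1).1 h.memLp

theorem HTwoBound.integrable_deriv_sq (h : HTwoBound A fun x => f x - 1) :
    Integrable fun x => ‖deriv f x‖ ^ 2 :=
  (memLp_two_iff_integrable_sq_norm h.memLp_deriv'.1).1 h.memLp_deriv'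

/-- Write the increment as `u ∫₀¹ f'(α + θu) dθ`, apply Jensen, and use translation invariance after
Fubini; this gives the bound for small `u`. The second bound ignores the cancellation and serves
large `u`. -/
theorem HTwoBound.integral_translate_le (h : HTwoBound A fun x => f x - 1) (u : ℝ) :
    Integrable (fun α => ‖f α - f (α + u)‖ ^ 2) ∧
      ∫ α, ‖f α - f (α + u)‖ ^ 2 ≤ A * u ^ 2 ∧ ∫ α, ‖f α - f (α + u)‖ ^ 2 ≤ 4 * A := by
  have hc := h.continuous
  have hcd := h.continuous_deriv
  have hA := h.nonneg
  have i1 := h.integrable_sq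
  have i2 : Integrable fun α => ‖f (α + u) - 1‖ ^ 2 := i1.comp_add_right u
  have hb : ∀ α, ‖f α - f (α + u)‖ ^ 2 ≤ 2 * ‖f α - 1‖ ^ 2 + 2 * ‖f (α + u) - 1‖ ^ 2 := by
    intro α
    have h1 := _root_.norm_sub_le (f α - 1) (f (α + u) - 1)
    rw [sub_sub_sub_cancel_right] at h1
    nlinarith [norm_nonneg (f α - f (α + u)), sq_nonneg (‖f α - 1‖ - ‖f (α + u) - 1‖)]
  have hi : Integrable fun α => ‖f α - f (α + u)‖ ^ 2 :=
    ((i1.const_mul 2).add (i2.const_mul 2)).mono' (Continuous.aestronglyMeasurable (by fun_prop))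
      (Eventually.of_forall fun α => by
        rw [Real.norm_of_nonneg (by positivity)]; exact hb α)
  refine ⟨hi, ?_, ?_⟩
  · set μ : Measure ℝ := volume.restrict (Ioc 0 1) with hμ
    have hd2 := h.integrable_deriv_sq
    have hpm : AEStronglyMeasurable (fun p : ℝ × ℝ => ‖deriv f (p.1 + p.2 * u)‖ ^ 2)
        (volume.prod μ) := Continuous.aestronglyMeasurable (by fun_prop)
    have hsl : ∀ θ : ℝ, ∫ α, ‖deriv f (α + θ * u)‖ ^ 2 = ∫ α, ‖deriv f α‖ ^ 2 := fun θ =>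
      integral_add_right_eq_self (fun α => ‖deriv f α‖ ^ 2) (θ * u)
    have hprod : Integrable (fun p : ℝ × ℝ => ‖deriv f (p.1 + p.2 * u)‖ ^ 2) (volume.prod μ) := by
      rw [integrable_prod_iff' hpm]
      refine ⟨Eventually.of_forall fun θ => hd2.comp_add_right (θ * u), ?_⟩
      simp only [norm_pow, norm_norm]
      simp_rw [hsl]
      exact integrable_const _
    have hpt : ∀ α, ‖f α - f (α + u)‖ ^ 2 ≤ u ^ 2 * ∫ θ, ‖deriv f (α + θ * u)‖ ^ 2 ∂μ := by
      intro α
      have hder : ∀ θ ∈ uIcc (0 : ℝ) 1, HasDerivAt (fun θ => f (α + θ * u))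
          (u • deriv f (α + θ * u)) θ := fun θ _ => by
        have h1 : HasDerivAt (fun θ => α + θ * u) u θ := by
          simpa using ((hasDerivAt_id θ).mul_const u).const_add α
        exact (h.hasDerivAt' (α + θ * u)).scomp θ h1
      have hF := intervalIntegral.integral_eq_sub_of_hasDerivAt hder
        (Continuous.intervalIntegrable (by fun_prop) _ _)
      rw [intervalIntegral.integral_smul] at hF
      simp only [one_mul, zero_mul, add_zero] at hF
      rw [norm_sub_rev, ← hF, norm_smul, mul_pow, Real.norm_eq_abs, sq_abs]
      gcongr
      refine (sq_norm_intervalIntegral_le (by fun_prop)).trans (le_of_eq ?_)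
      rw [intervalIntegral.integral_of_le zero_le_one]
    calc ∫ α, ‖f α - f (α + u)‖ ^ 2
        ≤ ∫ α, u ^ 2 * ∫ θ, ‖deriv f (α + θ * u)‖ ^ 2 ∂μ :=
          integral_mono hi (hprod.integral_prod_left.const_mul _) hpt
      _ = u ^ 2 * ∫ θ, (∫ α, ‖deriv f (α + θ * u)‖ ^ 2) ∂μ := by
          rw [integral_const_mul, integral_integral_swap hprod]
      _ = u ^ 2 * ∫ α, ‖deriv f α‖ ^ 2 := by
          simp_rw [hsl]; simp [hμ]
      _ ≤ A * u ^ 2 := by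
          rw [mul_comm]; gcongr; exact h.integral_deriv_sq_le'
  · refine (integral_mono hi ((i1.const_mul 2).add (i2.const_mul 2)) hb).trans ?_
    rw [integral_add' (i1.const_mul 2) (i2.const_mul 2), integral_const_mul, integral_const_mul,
      integral_add_right_eq_self (fun α => ‖f α - 1‖ ^ 2) u]
    linarith [h.integral_sq_le]

/-- Integrate in `α` first: each slice is at most `16A/(1 + u²)`, whose integral `16Aπ` is divided
by `2π`. Integrability of `B₁` is needed because the source term `B₁/ζ` must have an integrable
product with the merely bounded difference of inverses in the `L²` continuity estimate. -/
theorem HTwoBound.integrable_gagliardo (h : HTwoBound A fun x => f x - 1) :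
    Integrable (gagliardo f) ∧ ∫ α, gagliardo f α ≤ 8 * A := by
  have hA := h.nonneg
  have hslice : ∀ u, Integrable (fun α => gagliardoKernel f α u) ∧
      ∫ α, gagliardoKernel f α u ≤ 16 * A * (1 + u ^ 2)⁻¹ := by
    intro u
    obtain ⟨i1, b1, c1⟩ := h.integral_translate_le (-u)
    obtain ⟨i2, b2, c2⟩ := h.integral_translate_le u
    simp only [← sub_eq_add_neg, neg_sq] at i1 b1 c1
    refine ⟨(i1.add i2).div_const _, ?_⟩
    have e : ∫ α, gagliardoKernel f α u = (∫ α, ‖f α - f (α - u)‖ ^ 2) / u ^ 2 +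
        (∫ α, ‖f α - f (α + u)‖ ^ 2) / u ^ 2 := by
      simp only [gagliardoKernel]
      rw [integral_div, integral_add i1 i2, add_div]
    rw [e]
    have k1 := div_sq_le (integral_nonneg fun α => by positivity) hA b1 c1
    have k2 := div_sq_le (integral_nonneg fun α => by positivity) hA b2 c2
    linarith
  have hm : AEStronglyMeasurable (fun p : ℝ × ℝ => gagliardoKernel f p.1 p.2)
      (volume.prod volume) := (measurable_gagliardoKernel h.continuous).aestronglyMeasurable
  have hprod : Integrable (fun p : ℝ × ℝ => gagliardoKernel f p.1 p.2) (volume.prod volume) := by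
    rw [integrable_prod_iff' hm]
    refine ⟨Eventually.of_forall fun u => (hslice u).1, ?_⟩
    refine (integrable_inv_one_add_sq.const_mul (16 * A)).mono'
      hm.norm.prod_swap.integral_prod_right' (Eventually.of_forall fun u => ?_)
    simp only [Real.norm_of_nonneg (gagliardoKernel_nonneg f _ _)]
    rw [Real.norm_of_nonneg (integral_nonneg fun α => gagliardoKernel_nonneg f α u)]
    exact (hslice u).2
  refine ⟨hprod.integral_prod_left.const_mul _, ?_⟩
  have hpi := Real.pi_pos
  have e : ∫ α, gagliardo f α = 1 / (2 * Real.pi) * ∫ u, ∫ α, gagliardoKernel f α u := by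
    simp only [gagliardo]
    rw [integral_const_mul, integral_integral_swap hprod]
  have h1 := integral_mono hprod.integral_prod_right
    (integrable_inv_one_add_sq.const_mul (16 * A)) fun u => (hslice u).2
  rw [integral_const_mul, integral_univ_inv_one_add_sq] at h1
  rw [e, one_div, inv_mul_le_iff₀ (by positivity)]
  linarith

/-- `B₁` depends continuously on the solution. -/
theorem tendsto_gagliardo {ι : Type*} {l : Filter ι} [l.IsCountablyGenerated] {F : ι → ℝ → ℂ}
    (hF : ∀ᶠ i in l, HTwoBound A fun x => F i x - 1) (hlim : ∀ x, Tendsto (fun i => F i x) l (𝓝 (f x)))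
    (α : ℝ) : Tendsto (fun i => gagliardo (F i) α) l (𝓝 (gagliardo f α)) := by
  refine Tendsto.const_mul _ ?_
  refine tendsto_integral_filter_of_dominated_convergence
    (fun u => 16 * (A + 1) ^ 2 * (1 + u ^ 2)⁻¹) ?_ ?_ (integrable_inv_one_add_sq.const_mul _) ?_
  · filter_upwards [hF] with i hi
    exact (hi.integrable_gagliardoKernel α).1
  · filter_upwards [hF] with i hi
    refine Eventually.of_forall fun u => ?_
    rw [Real.norm_of_nonneg (gagliardoKernel_nonneg _ α u)]
    exact hi.gagliardoKernel_le α u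
  · refine Eventually.of_forall fun u => ?_
    exact (((((hlim α).sub (hlim (α - u))).norm).pow 2).add
      ((((hlim α).sub (hlim (α + u))).norm).pow 2)).div_const _

/-! ### Differentiation under the integral sign -/

section

variable {T C : ℝ} {h R : ℝ → ℝ → ℝ}

/-- A Lipschitz bound in time uniform in `α`, together with continuity in `α`, gives joint
continuity. Clamping the time to `[0, T]` makes the function globally defined, as required for
measurability of its time derivative. -/
theorem continuous_uncurry_projIcc (hT : 0 ≤ T) (hc : ∀ t ∈ Icc 0 T, Continuous (h t))
    (hb : ∀ t ∈ Icc 0 T, ∀ α, ‖R t α‖ ≤ C)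
    (hd : ∀ t ∈ Icc 0 T, ∀ α, HasDerivWithinAt (fun s => h s α) (R t α) (Icc 0 T) t) :
    Continuous (fun p : ℝ × ℝ => h (projIcc 0 T hT p.2) p.1) := by
  refine continuous_iff_continuousAt.2 fun ⟨α, t⟩ => ?_
  rw [ContinuousAt, tendsto_iff_norm_sub_tendsto_zero]
  have hl : ∀ p : ℝ × ℝ, ‖h (projIcc 0 T hT p.2) p.1 - h (projIcc 0 T hT t) α‖ ≤
      C * ‖(projIcc 0 T hT p.2 : ℝ) - projIcc 0 T hT t‖ +
        ‖h (projIcc 0 T hT t) p.1 - h (projIcc 0 T hT t) α‖ := fun p => by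
    have h1 := Convex.norm_image_sub_le_of_norm_hasDerivWithin_le (f := fun s => h s p.1)
      (fun s hs => hd s hs p.1) (fun s hs => hb s hs p.1) (convex_Icc 0 T)
      (projIcc 0 T hT t).2 (projIcc 0 T hT p.2).2
    exact (norm_sub_le_norm_sub_add_norm_sub _ (h (projIcc 0 T hT t) p.1) _).trans
      (by gcongr)
  refine squeeze_zero (fun p => norm_nonneg _) hl ?_
  have h2 : Continuous fun p : ℝ × ℝ => (projIcc 0 T hT p.2 : ℝ) :=
    continuous_subtype_val.comp (continuous_projIcc.comp continuous_snd)
  have h3 := hc _ (projIcc 0 T hT t).2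
  have h4 : Continuous fun p : ℝ × ℝ => C * ‖(projIcc 0 T hT p.2 : ℝ) - projIcc 0 T hT t‖ +
        ‖h (projIcc 0 T hT t) p.1 - h (projIcc 0 T hT t) α‖ := by fun_prop
  simpa using h4.tendsto (α, t)

/-- The space-time derivative, as a measurable function, and its basic properties. -/
theorem exists_integrable_rate (hT : 0 ≤ T) (hc : ∀ t ∈ Icc 0 T, Continuous (h t))
    (hR : ∀ t ∈ Icc 0 T, Integrable (R t))
    (hC : ∀ t ∈ Icc 0 T, ∫ α, ‖R t α‖ ≤ C) (hb : ∀ t ∈ Icc 0 T, ∀ α, ‖R t α‖ ≤ C)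
    (hd : ∀ t ∈ Icc 0 T, ∀ α, HasDerivWithinAt (fun s => h s α) (R t α) (Icc 0 T) t)
    {s t : ℝ} (hs : 0 ≤ s) (hst : s ≤ t) (ht : t ≤ T) :
    ∃ D : ℝ × ℝ → ℝ, Integrable D (volume.prod (volume.restrict (Ioo s t))) ∧
      (∀ α, ∀ τ ∈ Ioo s t, D (α, τ) = R τ α) ∧
      ∀ α, h t α - h s α = ∫ τ in Ioo s t, D (α, τ) := by
  have hJ := continuous_uncurry_projIcc hT hc hb hd
  -- No joint measurability of `R` is assumed; the derivative of a jointly continuous function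
  -- supplies a measurable version agreeing with `R` at interior times.
  set D : ℝ × ℝ → ℝ := fun p => deriv (fun τ => h (projIcc 0 T hT τ) p.1) p.2 with hD
  have hDm : Measurable D :=
    measurable_deriv_with_param (f := fun α τ => h (projIcc 0 T hT τ) α) hJ
  have hsub : ∀ τ ∈ Ioo s t, τ ∈ Icc 0 T := fun τ hτ => ⟨hs.trans hτ.1.le, hτ.2.le.trans ht⟩
  have hder : ∀ α, ∀ τ ∈ Ioo s t,
      HasDerivAt (fun τ => h (projIcc 0 T hT τ) α) (R τ α) τ := fun α τ hτ => by
    have hm : Icc 0 T ∈ 𝓝 τ := Icc_mem_nhds (hs.trans_lt hτ.1) (hτ.2.trans_le ht)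
    refine ((hd τ (hsub τ hτ) α).hasDerivAt hm).congr_of_eventuallyEq ?_
    filter_upwards [hm] with σ hσ
    rw [projIcc_of_mem hT hσ]
  have hDR : ∀ α, ∀ τ ∈ Ioo s t, D (α, τ) = R τ α := fun α τ hτ => (hder α τ hτ).deriv
  set μ : Measure ℝ := volume.restrict (Ioo s t) with hμ
  have hint : Integrable D (volume.prod μ) := by
    rw [integrable_prod_iff' hDm.aestronglyMeasurable]
    constructor
    · filter_upwards [ae_restrict_mem measurableSet_Ioo] with τ hτ
      exact (hR τ (hsub τ hτ)).congr (Eventually.of_forall fun α => (hDR α τ hτ).symm)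
    · have hm : AEStronglyMeasurable (fun τ => ∫ α, ‖D (α, τ)‖) μ :=
        (hDm.norm.stronglyMeasurable.integral_prod_left (μ := volume)).aestronglyMeasurable
      refine Integrable.mono' (integrable_const C) hm ?_
      filter_upwards [ae_restrict_mem measurableSet_Ioo] with τ hτ
      rw [Real.norm_of_nonneg (integral_nonneg fun α => norm_nonneg _)]
      simp_rw [hDR _ τ hτ]
      exact hC τ (hsub τ hτ)
  have hftc : ∀ α, h t α - h s α = ∫ τ, D (α, τ) ∂μ := fun α => by
    have hcα : Continuous fun τ => h (projIcc 0 T hT τ) α :=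
      hJ.comp (continuous_const.prodMk continuous_id)
    have hDi : IntervalIntegrable (fun τ => D (α, τ)) volume s t := by
      rw [intervalIntegrable_iff_integrableOn_Ioo_of_le hst]
      refine Integrable.mono' (integrable_const C)
        (hDm.comp measurable_prodMk_left).aestronglyMeasurable ?_
      filter_upwards [ae_restrict_mem measurableSet_Ioo] with τ hτ
      rw [hDR α τ hτ]
      exact hb τ (hsub τ hτ) α
    have h1 := intervalIntegral.integral_eq_sub_of_hasDeriv_right_of_le hst hcα.continuousOn
      (fun τ hτ => by
        rw [hDR α τ hτ]
        exact (hder α τ hτ).hasDerivWithinAt) hDi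
    rw [projIcc_of_mem hT ⟨hs.trans hst, ht⟩, projIcc_of_mem hT ⟨hs, hst.trans ht⟩,
      intervalIntegral.integral_of_le hst, integral_Ioc_eq_integral_Ioo] at h1
    exact h1.symm
  exact ⟨D, hint, hDR, hftc⟩

/-- The sup bound of the rate makes the fundamental theorem of calculus available for each `α`, and
the `L¹` bound allows the two integrations to be exchanged. -/
theorem integral_sub_integral_eq (hT : 0 ≤ T) (hc : ∀ t ∈ Icc 0 T, Continuous (h t))
    (hi : ∀ t ∈ Icc 0 T, Integrable (h t)) (hR : ∀ t ∈ Icc 0 T, Integrable (R t))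
    (hC : ∀ t ∈ Icc 0 T, ∫ α, ‖R t α‖ ≤ C) (hb : ∀ t ∈ Icc 0 T, ∀ α, ‖R t α‖ ≤ C)
    (hd : ∀ t ∈ Icc 0 T, ∀ α, HasDerivWithinAt (fun s => h s α) (R t α) (Icc 0 T) t)
    {s t : ℝ} (hs : 0 ≤ s) (hst : s ≤ t) (ht : t ≤ T) :
    (∫ α, h t α) - ∫ α, h s α = ∫ τ in s..t, ∫ α, R τ α := by
  obtain ⟨D, hint, hDR, hftc⟩ := exists_integrable_rate hT hc hR hC hb hd hs hst ht
  rw [← integral_sub (hi t ⟨hs.trans hst, ht⟩) (hi s ⟨hs, hst.trans ht⟩)]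
  simp_rw [hftc]
  rw [integral_integral_swap (f := fun α τ => D (α, τ)) hint, intervalIntegral.integral_of_le hst,
    integral_Ioc_eq_integral_Ioo]
  refine setIntegral_congr_fun (E := ℝ) measurableSet_Ioo fun τ hτ => ?_
  simp only [hDR _ τ hτ]

/-- Used twice: with the energy density, and with the squared difference of two time slices of
`1/ζ`, which yields continuity in `L²`. -/
theorem integral_norm_sub_le (hT : 0 ≤ T) (hc : ∀ t ∈ Icc 0 T, Continuous (h t))
    (hR : ∀ t ∈ Icc 0 T, Integrable (R t))
    (hC : ∀ t ∈ Icc 0 T, ∫ α, ‖R t α‖ ≤ C) (hb : ∀ t ∈ Icc 0 T, ∀ α, ‖R t α‖ ≤ C)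
    (hd : ∀ t ∈ Icc 0 T, ∀ α, HasDerivWithinAt (fun s => h s α) (R t α) (Icc 0 T) t)
    {s t : ℝ} (hs : s ∈ Icc 0 T) (ht : t ∈ Icc 0 T) :
    ∫ α, ‖h t α - h s α‖ ≤ C * |t - s| := by
  wlog hst : s ≤ t generalizing s t
  · simp_rw [norm_sub_rev (h t _)]
    rw [abs_sub_comm t]
    exact this ht hs (le_of_not_ge hst)
  obtain ⟨D, hint, hDR, hftc⟩ := exists_integrable_rate hT hc hR hC hb hd hs.1 hst ht.2
  simp_rw [hftc]
  refine (integral_mono_of_nonneg (Eventually.of_forall fun α => norm_nonneg _)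
    hint.norm.integral_prod_left
    (Eventually.of_forall fun α => norm_integral_le_integral_norm _)).trans ?_
  rw [integral_integral_swap (f := fun α τ => ‖D (α, τ)‖) hint.norm]
  have h1 : ∫ τ in Ioo s t, ∫ α, ‖D (α, τ)‖ = ∫ τ in Ioo s t, ∫ α, ‖R τ α‖ :=
    setIntegral_congr_fun measurableSet_Ioo fun τ hτ => by simp only [hDR _ τ hτ]
  rw [h1]
  have h2 := norm_setIntegral_le_of_norm_le_const (μ := volume) (s := Ioo s t)
    (f := fun τ => ∫ α, ‖R τ α‖) (C := C) (by simp) (fun τ hτ => by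
      rw [Real.norm_of_nonneg (integral_nonneg fun _ => norm_nonneg _)]
      exact hC τ ⟨hs.1.trans hτ.1.le, hτ.2.le.trans ht.2⟩)
  refine (le_abs_self _).trans (h2.trans_eq ?_)
  rw [abs_of_nonneg (sub_nonneg.2 hst)]
  simp [Measure.real, hst]

end

/-! ### Products of functions converging in `L²` -/

theorem integrable_mul_of_memLp {a b : ℝ → ℝ} (ha : MemLp a 2) (hb : MemLp b 2) :
    Integrable fun x => a x * b x := ha.integrable_mul hb

/-- Cauchy–Schwarz, from the discriminant of the nonnegative polynomial `y ↦ ∫ (a y + b)²`. -/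
theorem abs_integral_mul_le {a b : ℝ → ℝ} (ha : MemLp a 2) (hb : MemLp b 2) :
    |∫ x, a x * b x| ≤ √(∫ x, a x ^ 2) * √(∫ x, b x ^ 2) := by
  have ia := ha.integrable_sq
  have ib := hb.integrable_sq
  have iab := integrable_mul_of_memLp ha hb
  have h1 : ∀ y : ℝ, 0 ≤ (∫ x, a x ^ 2) * (y * y) + 2 * (∫ x, a x * b x) * y + ∫ x, b x ^ 2 := by
    intro y
    have h2 : 0 ≤ ∫ x, (a x * y + b x) ^ 2 := integral_nonneg fun x => sq_nonneg _
    have e : ∀ x, (a x * y + b x) ^ 2 = y * y * a x ^ 2 + 2 * y * (a x * b x) + b x ^ 2 :=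
      fun x => by ring
    simp_rw [e] at h2
    have s1 : Integrable fun x => y * y * a x ^ 2 + 2 * y * (a x * b x) :=
      (ia.const_mul _).add (iab.const_mul _)
    rw [integral_add s1 ib,
      integral_add (ia.const_mul _) (iab.const_mul _), integral_const_mul, integral_const_mul] at h2
    linarith
  have h3 := discrim_le_zero h1
  rw [discrim] at h3
  rw [← Real.sqrt_mul (integral_nonneg fun x => sq_nonneg _)]
  refine Real.abs_le_sqrt ?_
  linarith

theorem tendsto_integral_mul {ι : Type*} {l : Filter ι} {φ ψ : ι → ℝ → ℝ} {φ₀ ψ₀ : ℝ → ℝ}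
    (hφ : ∀ᶠ i in l, MemLp (φ i) 2) (hψ : ∀ᶠ i in l, MemLp (ψ i) 2) (hφ₀ : MemLp φ₀ 2)
    (hψ₀ : MemLp ψ₀ 2) (h1 : Tendsto (fun i => ∫ x, (φ i x - φ₀ x) ^ 2) l (𝓝 0))
    (h2 : Tendsto (fun i => ∫ x, (ψ i x - ψ₀ x) ^ 2) l (𝓝 0)) :
    Tendsto (fun i => ∫ x, φ i x * ψ i x) l (𝓝 (∫ x, φ₀ x * ψ₀ x)) := by
  rw [tendsto_iff_norm_sub_tendsto_zero]
  have hlim : Tendsto (fun i => √(∫ x, (φ i x - φ₀ x) ^ 2) * √(∫ x, (ψ i x - ψ₀ x) ^ 2) +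
      √(∫ x, (φ i x - φ₀ x) ^ 2) * √(∫ x, ψ₀ x ^ 2) +
      √(∫ x, φ₀ x ^ 2) * √(∫ x, (ψ i x - ψ₀ x) ^ 2)) l (𝓝 0) := by
    have := ((h1.sqrt.mul h2.sqrt).add (h1.sqrt.mul_const √(∫ x, ψ₀ x ^ 2))).add
      (h2.sqrt.const_mul √(∫ x, φ₀ x ^ 2))
    simpa using this
  refine squeeze_zero' (Eventually.of_forall fun i => norm_nonneg _) ?_ hlim
  filter_upwards [hφ, hψ] with i hφ hψ
  have d1 : MemLp (fun x => φ i x - φ₀ x) 2 := hφ.sub hφ₀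
  have d2 : MemLp (fun x => ψ i x - ψ₀ x) 2 := hψ.sub hψ₀
  have s1 : Integrable fun x => (φ i x - φ₀ x) * (ψ i x - ψ₀ x) + (φ i x - φ₀ x) * ψ₀ x :=
    (integrable_mul_of_memLp d1 d2).add (integrable_mul_of_memLp d1 hψ₀)
  have e : (∫ x, φ i x * ψ i x) - ∫ x, φ₀ x * ψ₀ x =
      (∫ x, (φ i x - φ₀ x) * (ψ i x - ψ₀ x)) + (∫ x, (φ i x - φ₀ x) * ψ₀ x) +
        ∫ x, φ₀ x * (ψ i x - ψ₀ x) := by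
    rw [← integral_add (integrable_mul_of_memLp d1 d2) (integrable_mul_of_memLp d1 hψ₀),
      ← integral_add s1 (integrable_mul_of_memLp hφ₀ d2),
      ← integral_sub (integrable_mul_of_memLp hφ hψ) (integrable_mul_of_memLp hφ₀ hψ₀)]
    refine integral_congr_ae (Eventually.of_forall fun x => ?_)
    simp only
    ring
  rw [e, Real.norm_eq_abs]
  exact (abs_add_three _ _ _).trans (add_le_add_three (abs_integral_mul_le d1 d2)
    (abs_integral_mul_le d1 hψ₀) (abs_integral_mul_le hφ₀ d2))

/-! ### Small logarithms -/

/-- The Taylor remainder gives `‖e^z - 1‖ ≥ ‖z‖ - ‖z‖² ≥ ‖z‖/2`. -/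
theorem norm_le_two_mul_norm_exp_sub_one {z : ℂ} (h : ‖z‖ ≤ 1 / 2) :
    ‖z‖ ≤ 2 * ‖Complex.exp z - 1‖ := by
  have h1 := Complex.norm_exp_sub_one_sub_id_le (x := z) (by linarith)
  have h2 := norm_sub_norm_le z (z - (Complex.exp z - 1))
  rw [sub_sub_cancel, norm_sub_rev z] at h2
  nlinarith [norm_nonneg z]

/-- If `‖D‖` exceeded `1/2` somewhere then, as it tends to `0` at infinity, it would equal `1/2` at
some point, where `‖e^D - 1‖ ≥ 1/4`. This excludes differences by multiples of `2πi` between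
logarithms selected independently at two times. -/
theorem norm_le_of_norm_exp_sub_one_lt {D : ℝ → ℂ} (hc : Continuous D)
    (hlim : Tendsto D (cocompact ℝ) (𝓝 0)) (he : ∀ x, ‖Complex.exp (D x) - 1‖ < 1 / 4) (x : ℝ) :
    ‖D x‖ ≤ 2 * ‖Complex.exp (D x) - 1‖ := by
  refine norm_le_two_mul_norm_exp_sub_one ?_
  by_contra! hx
  have hn : Tendsto (fun x => ‖D x‖) (cocompact ℝ) (𝓝 0) := by simpa using hlim.norm
  obtain ⟨y, hy⟩ := (hn.eventually_lt_const one_half_pos).exists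
  obtain ⟨z, hz⟩ := mem_range_of_exists_le_of_exists_ge hc.norm ⟨y, hy.le⟩ ⟨x, hx.le⟩
  have := norm_le_two_mul_norm_exp_sub_one hz.le
  linarith [he z]

/-- Near infinity `l` is small, so `|l| ≤ 2|ζ - 1|` there; on compact sets continuity suffices. -/
theorem memLp_of_exp {ζ l : ℝ → ℂ} (hc : Continuous l) (hlim : Tendsto l (cocompact ℝ) (𝓝 0))
    (he : ∀ x, Complex.exp (l x) = ζ x) (hζ : MemLp (fun x => ζ x - 1) 2) : MemLp l 2 := by
  rw [memLp_two_iff_integrable_sq_norm hc.aestronglyMeasurable]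
  have h1 := (memLp_two_iff_integrable_sq_norm hζ.1).1 hζ
  refine LocallyIntegrable.integrable_of_isBigO_cocompact (g := fun x => ‖ζ x - 1‖ ^ 2)
    (hc.norm.pow 2).locallyIntegrable ?_ (h1.integrableAtFilter _)
  refine Asymptotics.IsBigO.of_bound 4 ?_
  have hn : Tendsto (fun x => ‖l x‖) (cocompact ℝ) (𝓝 0) := by simpa using hlim.norm
  filter_upwards [hn.eventually_lt_const one_half_pos] with x hx
  have := norm_le_two_mul_norm_exp_sub_one hx.le
  rw [he x] at this
  rw [Real.norm_of_nonneg (by positivity), Real.norm_of_nonneg (by positivity)]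
  nlinarith [norm_nonneg (l x)]

/-! ### The energy balance at a fixed time -/

/-- Uniform bounds for `ζ = Z_{,α'}`, its inverse and its logarithm `l` at a fixed time. -/
structure LogSlice (A K : ℝ) (ζ l : ℝ → ℂ) : Prop where
  inv_bound : HTwoBound A fun x => 1 / ζ x - 1
  bound : HTwoBound A fun x => ζ x - 1
  continuous_log : Continuous l
  exp_log : ∀ x, Complex.exp (l x) = ζ x
  memLp_log : MemLp l 2
  norm_log_le : ∀ x, ‖l x‖ ≤ K
  integral_log_sq_le : ∫ x, ‖l x‖ ^ 2 ≤ K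
  vanishing_log : CauchyVanishing l
  vanishing_deriv : CauchyVanishing (deriv fun x => 1 / ζ x)

/-- The logarithmic derivative of `1 / ζ`. -/
def logDerivInv (ζ : ℝ → ℂ) (x : ℝ) : ℂ := deriv (fun y => 1 / ζ y) x * ζ x

/-- The density `|ζ|² (Im l)²` of the energy. -/
def energyDensity (ζ l : ℝ → ℂ) (x : ℝ) : ℝ := ‖ζ x‖ ^ 2 * (l x).im ^ 2

/-- The space derivative of the energy density. -/
def energyDensityDeriv (ζ l : ℝ → ℂ) (x : ℝ) : ℝ :=
  2 * ‖ζ x‖ ^ 2 * (-(logDerivInv ζ x).re * (l x).im ^ 2 - (l x).im * (logDerivInv ζ x).im)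

/-- The time derivative of the logarithm of `ζ`. -/
def logRate (ζ : ℝ → ℂ) (x : ℝ) : ℂ :=
  (driftB ζ x + Complex.I * ((‖1 / ζ x‖ ^ 2 : ℝ) : ℂ)) * logDerivInv ζ x - (coeffB1 ζ x : ℂ)

/-- The time derivative of the energy density. -/
def energyRate (ζ l : ℝ → ℂ) (x : ℝ) : ℝ :=
  2 * ‖ζ x‖ ^ 2 * ((logRate ζ x).re * (l x).im ^ 2 + (l x).im * (logRate ζ x).im)

theorem pvIntegral_ofReal_im (q : ℝ → ℝ) (α : ℝ) : (pvIntegral (fun x => (q x : ℂ)) α).im = 0 := by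
  have e : ∀ u, symKernel (fun x => (q x : ℂ)) α u = (((q (α - u) - q (α + u)) / u : ℝ) : ℂ) :=
    fun u => by rw [symKernel]; push_cast; rfl
  rw [pvIntegral]
  simp_rw [e]
  rw [integral_complex_ofReal]
  simp [← Complex.ofReal_ofNat, ← Complex.ofReal_inv]

/-- Rests on `|e^l|² = e^{2 Re l}`; one formula serves for both the space and the time derivative of
the energy density. -/
theorem hasDerivAt_norm_exp_sq {l : ℝ → ℂ} {l' : ℂ} {x : ℝ} {s : Set ℝ}
    (h : HasDerivWithinAt l l' s x) :
    HasDerivWithinAt (fun y => ‖Complex.exp (l y)‖ ^ 2 * (l y).im ^ 2)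
      (2 * ‖Complex.exp (l x)‖ ^ 2 * (l'.re * (l x).im ^ 2 + (l x).im * l'.im)) s x := by
  have hre : HasDerivWithinAt (fun y => (l y).re) l'.re s x :=
    Complex.reCLM.hasFDerivAt.comp_hasDerivWithinAt x h
  have him : HasDerivWithinAt (fun y => (l y).im) l'.im s x :=
    Complex.imCLM.hasFDerivAt.comp_hasDerivWithinAt x h
  simp only [Complex.norm_exp]
  exact ((hre.exp.pow 2).mul (him.pow 2)).congr_deriv (by simp; ring)

variable {A K : ℝ} {ζ l : ℝ → ℂ}

namespace LogSlice

theorem ne_zero (h : LogSlice A K ζ l) (x : ℝ) : ζ x ≠ 0 := by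
  rw [← h.exp_log]; exact Complex.exp_ne_zero _

theorem nonneg (h : LogSlice A K ζ l) : 0 ≤ A := h.bound.nonneg

theorem nonneg' (h : LogSlice A K ζ l) : 0 ≤ K := (norm_nonneg _).trans (h.norm_log_le 0)

theorem hasDerivAt_log (h : LogSlice A K ζ l) (x : ℝ) : HasDerivAt l (-logDerivInv ζ x) x := by
  have h1 := hasDerivWithinAt_of_exp (L := fun x => -l x) (u := fun x => 1 / ζ x) (s := univ)
    (mem_univ x) h.continuous_log.neg.continuousWithinAt (fun y _ => by rw [Complex.exp_neg, h.exp_log, one_div])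
    (h.inv_bound.hasDerivAt' x).hasDerivWithinAt
  rw [hasDerivWithinAt_univ] at h1
  have e : l = -fun x => -l x := by ext x; simp
  rw [e]
  refine h1.neg.congr_deriv ?_
  rw [logDerivInv, div_div_eq_mul_div, div_one]

theorem continuous_logDerivInv (h : LogSlice A K ζ l) : Continuous (logDerivInv ζ) :=
  h.inv_bound.continuous_deriv.mul h.bound.continuous

theorem norm_logDerivInv_le_mul (h : LogSlice A K ζ l) (x : ℝ) :
    ‖logDerivInv ζ x‖ ≤ (A + 1) * ‖deriv (fun y => 1 / ζ y) x‖ := by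
  rw [logDerivInv, norm_mul, mul_comm]
  exact mul_le_mul_of_nonneg_right (h.bound.norm_le' x) (norm_nonneg _)

theorem norm_logDerivInv_le (h : LogSlice A K ζ l) (x : ℝ) :
    ‖logDerivInv ζ x‖ ≤ (A + 1) * A :=
  (h.norm_logDerivInv_le_mul x).trans
    (mul_le_mul_of_nonneg_left (h.inv_bound.norm_deriv_le' x) (by linarith [h.nonneg]))

theorem memLp_logDerivInv (h : LogSlice A K ζ l) : MemLp (logDerivInv ζ) 2 :=
  h.inv_bound.memLp_deriv'.of_le_mul h.continuous_logDerivInv.aestronglyMeasurable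
    (Eventually.of_forall h.norm_logDerivInv_le_mul)

theorem integrable_logDerivInv_sq (h : LogSlice A K ζ l) :
    Integrable fun x => ‖logDerivInv ζ x‖ ^ 2 :=
  (memLp_two_iff_integrable_sq_norm h.memLp_logDerivInv.1).1 h.memLp_logDerivInv

theorem integral_logDerivInv_sq_le (h : LogSlice A K ζ l) :
    ∫ x, ‖logDerivInv ζ x‖ ^ 2 ≤ (A + 1) ^ 2 * A := by
  refine le_trans ?_ (mul_le_mul_of_nonneg_left h.inv_bound.integral_deriv_sq_le' (sq_nonneg _))
  rw [← integral_const_mul]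
  refine integral_mono h.integrable_logDerivInv_sq (h.inv_bound.integrable_deriv_sq.const_mul _)
    fun x => ?_
  simp only [← mul_pow]
  exact pow_le_pow_left₀ (norm_nonneg _) (h.norm_logDerivInv_le_mul x) 2

theorem integrable_log_sq (h : LogSlice A K ζ l) : Integrable fun x => ‖l x‖ ^ 2 :=
  (memLp_two_iff_integrable_sq_norm h.memLp_log.1).1 h.memLp_log

theorem sq_im_le (l : ℝ → ℂ) (x : ℝ) : (l x).im ^ 2 ≤ ‖l x‖ ^ 2 :=
  sq_le_sq' (by linarith [neg_abs_le (l x).im, Complex.abs_im_le_norm (l x)])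
    ((le_abs_self _).trans (Complex.abs_im_le_norm _))

theorem sq_norm_le (h : LogSlice A K ζ l) (x : ℝ) : ‖ζ x‖ ^ 2 ≤ (A + 1) ^ 2 :=
  pow_le_pow_left₀ (norm_nonneg _) (h.bound.norm_le' x) 2

theorem continuous_energyDensity (h : LogSlice A K ζ l) : Continuous (energyDensity ζ l) := by
  have h1 := h.bound.continuous
  have h2 := h.continuous_log
  unfold energyDensity
  fun_prop

theorem energyDensity_le (h : LogSlice A K ζ l) (x : ℝ) :
    energyDensity ζ l x ≤ (A + 1) ^ 2 * ‖l x‖ ^ 2 :=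
  mul_le_mul (h.sq_norm_le x) (sq_im_le l x) (sq_nonneg _) (sq_nonneg _)

theorem energyDensity_nonneg (ζ l : ℝ → ℂ) (x : ℝ) : 0 ≤ energyDensity ζ l x := by
  unfold energyDensity; positivity

theorem integrable_energyDensity (h : LogSlice A K ζ l) : Integrable (energyDensity ζ l) :=
  (h.integrable_log_sq.const_mul ((A + 1) ^ 2)).mono'
    h.continuous_energyDensity.aestronglyMeasurable (Eventually.of_forall fun x => by
      rw [Real.norm_of_nonneg (energyDensity_nonneg ζ l x)]; exact h.energyDensity_le x)

/-- The form of the rates in the two estimates below. -/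
theorem abs_rate_le (h : LogSlice A K ζ l) {a b c : ℝ} (x : ℝ) {p : ℝ}
    (ha : |a| ≤ c) (hb : |b| ≤ c * p) :
    |2 * ‖ζ x‖ ^ 2 * (a * (l x).im ^ 2 + (l x).im * b)| ≤
      4 * (A + 1) ^ 2 * c * (‖l x‖ ^ 2 + p ^ 2) := by
  have hc : 0 ≤ c := (abs_nonneg _).trans ha
  rw [abs_mul, abs_of_nonneg (by positivity : 0 ≤ 2 * ‖ζ x‖ ^ 2)]
  have h1 := h.sq_norm_le x
  have h2 := sq_im_le l x
  have h3 : |a * (l x).im ^ 2 + (l x).im * b| ≤ 2 * c * (‖l x‖ ^ 2 + p ^ 2) := by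
    refine (abs_add_le _ _).trans ?_
    rw [abs_mul, abs_mul, abs_of_nonneg (sq_nonneg (l x).im)]
    have h4 : |a| * (l x).im ^ 2 ≤ c * ‖l x‖ ^ 2 := mul_le_mul ha h2 (sq_nonneg _) hc
    have h5 : |(l x).im| * |b| ≤ ‖l x‖ * (c * p) :=
      mul_le_mul (Complex.abs_im_le_norm _) hb (abs_nonneg _) (norm_nonneg _)
    nlinarith [mul_nonneg hc (sq_nonneg (‖l x‖ - p)), mul_nonneg hc (sq_nonneg ‖l x‖),
      mul_nonneg hc (sq_nonneg p)]
  calc _ ≤ 2 * (A + 1) ^ 2 * (2 * c * (‖l x‖ ^ 2 + p ^ 2)) := by gcongr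
    _ = _ := by ring

theorem hasDerivAt_energyDensity (h : LogSlice A K ζ l) (x : ℝ) :
    HasDerivAt (energyDensity ζ l) (energyDensityDeriv ζ l x) x := by
  have h1 := hasDerivAt_norm_exp_sq (h.hasDerivAt_log x).hasDerivWithinAt (s := univ)
  simp only [h.exp_log, hasDerivWithinAt_univ] at h1
  refine h1.congr_deriv ?_
  rw [energyDensityDeriv, Complex.neg_re, Complex.neg_im]
  ring

theorem integrable_energyDensityDeriv (h : LogSlice A K ζ l) :
    Integrable (energyDensityDeriv ζ l) := by
  have hA := h.nonneg
  have hc : Continuous (energyDensityDeriv ζ l) := by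
    have h1 := h.bound.continuous
    have h2 := h.continuous_log
    have h3 := h.continuous_logDerivInv
    have h4 := Complex.continuous_im.comp h2
    have h5 := Complex.continuous_re.comp h3
    have h6 := Complex.continuous_im.comp h3
    simp only [Function.comp_def] at h4 h5 h6
    unfold energyDensityDeriv
    fun_prop
  refine ((h.integrable_log_sq.add h.integrable_logDerivInv_sq).const_mul
    (4 * (A + 1) ^ 2 * ((A + 1) * A + 1))).mono' hc.aestronglyMeasurable
    (Eventually.of_forall fun x => ?_)
  have h1 := h.abs_rate_le (a := -(logDerivInv ζ x).re) (b := -(logDerivInv ζ x).im)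
    (c := (A + 1) * A + 1) x (p := ‖logDerivInv ζ x‖)
    (by
      rw [abs_neg]
      linarith [Complex.abs_re_le_norm (logDerivInv ζ x), h.norm_logDerivInv_le x])
    (by
      rw [abs_neg]
      have := Complex.abs_im_le_norm (logDerivInv ζ x)
      nlinarith [norm_nonneg (logDerivInv ζ x), mul_nonneg hA (norm_nonneg (logDerivInv ζ x)),
        mul_nonneg (mul_nonneg hA hA) (norm_nonneg (logDerivInv ζ x))])
  have e : energyDensityDeriv ζ l x = 2 * ‖ζ x‖ ^ 2 * (-(logDerivInv ζ x).re * (l x).im ^ 2 +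
      (l x).im * -(logDerivInv ζ x).im) := by rw [energyDensityDeriv]; ring
  rw [e]
  exact h1

theorem coeffB1_nonneg (h : LogSlice A K ζ l) (x : ℝ) : 0 ≤ coeffB1 ζ x := by
  rw [coeffB1_eq_gagliardo h.inv_bound]; exact gagliardo_nonneg _ x

theorem coeffB1_le (h : LogSlice A K ζ l) (x : ℝ) : coeffB1 ζ x ≤ 8 * (A + 1) ^ 2 := by
  rw [coeffB1_eq_gagliardo h.inv_bound]; exact h.inv_bound.gagliardo_le x

theorem coeffB1_eq (h : LogSlice A K ζ l) : coeffB1 ζ = gagliardo fun x => 1 / ζ x :=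
  funext fun x => coeffB1_eq_gagliardo h.inv_bound x

theorem measurable_coeffB1 (h : LogSlice A K ζ l) : Measurable (coeffB1 ζ) := by
  rw [h.coeffB1_eq]
  exact measurable_gagliardo h.inv_bound.continuous

theorem driftB_im (h : LogSlice A K ζ l) (x : ℝ) : (driftB ζ x).im = 0 := by
  rw [driftB_eq h.inv_bound, Complex.im_ofReal_mul, pvIntegral_ofReal_im, mul_zero]

theorem norm_driftB_le (h : LogSlice A K ζ l) (x : ℝ) :
    ‖driftB ζ x‖ ≤ pvBound (quadBound A) := by
  have h1 := h.inv_bound.pvAdmissible_sq.norm_pvIntegral_le x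
  rw [driftB_eq h.inv_bound, norm_mul, Complex.norm_real, norm_neg,
    Real.norm_of_nonneg (by positivity)]
  have h2 : 1 / Real.pi ≤ 1 := by
    rw [div_le_one Real.pi_pos]; linarith [Real.pi_gt_three]
  calc _ ≤ 1 * pvBound (quadBound A) := by gcongr
    _ = _ := one_mul _

theorem measurable_driftB (h : LogSlice A K ζ l) : Measurable (driftB ζ) := by
  have e : driftB ζ = fun α => _ := funext fun α => driftB_eq h.inv_bound α
  rw [e]
  exact (measurable_pvIntegral h.inv_bound.pvAdmissible_sq.continuous).const_mul _

theorem integrable_energyDensity_mul_coeffB1 (h : LogSlice A K ζ l) :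
    Integrable fun x => energyDensity ζ l x * coeffB1 ζ x :=
  h.integrable_energyDensity.mul_bdd (c := 8 * (A + 1) ^ 2)
    h.measurable_coeffB1.aestronglyMeasurable (Eventually.of_forall fun x => by
      rw [Real.norm_of_nonneg (h.coeffB1_nonneg x)]; exact h.coeffB1_le x)

/-- Because `|ζ|² · conj (1/ζ) = ζ`, the energy weight turns the local part of the derivative of the
drift into the logarithmic derivative. -/
theorem conj_mul_deriv_mul (h : LogSlice A K ζ l) (x : ℝ) :
    ‖ζ x‖ ^ 2 * ((starRingEnd ℂ) (1 / ζ x) * deriv (fun y => 1 / ζ y) x).im =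
      (logDerivInv ζ x).im := by
  rw [← Complex.im_ofReal_mul, logDerivInv]
  congr 1
  have h1 : (starRingEnd ℂ) (ζ x) ≠ 0 := by simpa using h.ne_zero x
  push_cast
  rw [← Complex.mul_conj', map_div₀, map_one]
  field_simp

/-- The contribution of the transport term. -/
theorem integral_driftB_mul (h : LogSlice A K ζ l) :
    ∫ x, (driftB ζ x).re * energyDensityDeriv ζ l x =
      -∫ x, (energyDensity ζ l x * coeffB1 ζ x + 2 * ((l x).im ^ 2 * (logDerivInv ζ x).im)) := by
  have hpi := Real.pi_ne_zero
  have i1 : Integrable fun x => (energyDensity ζ l x : ℂ) := h.integrable_energyDensity.ofReal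
  have i2 : Integrable fun x => (energyDensityDeriv ζ l x : ℂ) :=
    h.integrable_energyDensityDeriv.ofReal
  -- The derivative of the drift is used only in this weak form, tested against the energy density.
  have h1 := integral_pvIntegral_mul_deriv h.inv_bound.pvAdmissible_sq
    h.inv_bound.pvAdmissible_conj_mul.two_re h.inv_bound.hasDerivAt_sq
    i1 i2 (fun x => (h.hasDerivAt_energyDensity x).ofReal_comp)
  have e1 : ∀ x, pvIntegral (fun x => ((‖1 / ζ x‖ ^ 2 : ℝ) : ℂ)) x * (energyDensityDeriv ζ l x : ℂ) =
      ((-Real.pi * ((driftB ζ x).re * energyDensityDeriv ζ l x) : ℝ) : ℂ) := fun x => by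
    have e : pvIntegral (fun x => ((‖1 / ζ x‖ ^ 2 : ℝ) : ℂ)) x =
        ((-Real.pi * (driftB ζ x).re : ℝ) : ℂ) := by
      apply Complex.ext
      · rw [driftB_eq h.inv_bound, Complex.re_ofReal_mul, Complex.ofReal_re]
        field_simp
      · rw [pvIntegral_ofReal_im, Complex.ofReal_im]
    rw [e]
    push_cast
    ring
  have e2 : ∀ x, pvIntegral
      (fun x => ((2 * ((starRingEnd ℂ) (1 / ζ x) * deriv (fun x => 1 / ζ x) x).re : ℝ) : ℂ)) x *
        (energyDensity ζ l x : ℂ) = ((-Real.pi * (energyDensity ζ l x * coeffB1 ζ x +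
          2 * ((l x).im ^ 2 * (logDerivInv ζ x).im)) : ℝ) : ℂ) := fun x => by
    rw [h.inv_bound.pvAdmissible_conj_mul.pvIntegral_two_re,
      two_re_pvIntegral h.inv_bound h.vanishing_deriv, ← h.conj_mul_deriv_mul, energyDensity]
    push_cast
    ring
  simp_rw [e1, e2] at h1
  rw [integral_complex_ofReal, integral_complex_ofReal, integral_const_mul, integral_const_mul,
    ← Complex.ofReal_neg, Complex.ofReal_inj, ← mul_neg] at h1
  exact mul_left_cancel₀ (neg_ne_zero.2 hpi) h1

theorem memLp_im (h : LogSlice A K ζ l) : MemLp (fun x => (l x).im) 2 := h.memLp_log.im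

theorem memLp_re_logDerivInv (h : LogSlice A K ζ l) : MemLp (fun x => (logDerivInv ζ x).re) 2 :=
  h.memLp_logDerivInv.re

/-- Applied with `v = Re l`, whose derivative is `-Re` of the logarithmic derivative of `1/ζ`. The
norm becomes an `L²` pairing without fractional powers. -/
theorem halfNormSq_eq (h : LogSlice A K ζ l) :
    homHalfNorm (fun x => ((l x).im : ℂ)) ≠ ⊤ ∧
      halfNormSq (fun x => (l x).im) = ∫ x, (l x).im * -(logDerivInv ζ x).re := by
  refine homHalfNorm_im (v := fun x => (l x).re) h.memLp_im.ofReal h.memLp_log.re.ofReal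
    h.memLp_re_logDerivInv.neg.ofReal (fun x => ?_) ?_
  · refine (Complex.reCLM.hasFDerivAt.comp_hasDerivAt x (h.hasDerivAt_log x)).congr_deriv ?_
    simp
  · have e : (fun x => ((l x).re : ℂ) + Complex.I * (l x).im) = l := by
      ext x
      rw [mul_comm]
      exact Complex.re_add_im _
    rw [e]
    exact h.vanishing_log

/-- The drift is real, so its terms assemble into `-b` times the space derivative of the density. In
the terms from `i|1/ζ|²` the weight disappears because `|ζ|²|1/ζ|² = 1`. -/
theorem energyRate_eq (h : LogSlice A K ζ l) (x : ℝ) : energyRate ζ l x =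
    -((driftB ζ x).re * energyDensityDeriv ζ l x) - 2 * ((l x).im ^ 2 * (logDerivInv ζ x).im) -
      2 * ((l x).im * -(logDerivInv ζ x).re) - 2 * (energyDensity ζ l x * coeffB1 ζ x) := by
  have h0 := h.driftB_im x
  have h1 : ‖ζ x‖ ≠ 0 := norm_ne_zero_iff.2 (h.ne_zero x)
  have h2 : ‖1 / ζ x‖ = 1 / ‖ζ x‖ := by simp
  rw [energyRate, logRate, energyDensityDeriv, energyDensity, h2]
  simp only [Complex.sub_re, Complex.sub_im, Complex.mul_re, Complex.mul_im, Complex.add_re,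
    Complex.add_im, Complex.I_re, Complex.I_im, Complex.ofReal_re, Complex.ofReal_im, h0]
  field_simp
  ring

theorem integrable_sq_im_mul (h : LogSlice A K ζ l) :
    Integrable fun x => (l x).im ^ 2 * (logDerivInv ζ x).im :=
  h.memLp_im.integrable_sq.mul_bdd (c := (A + 1) * A)
    (Complex.continuous_im.comp h.continuous_logDerivInv).aestronglyMeasurable
    (Eventually.of_forall fun x =>
      (Complex.abs_im_le_norm _).trans (h.norm_logDerivInv_le x))

theorem integrable_driftB_mul (h : LogSlice A K ζ l) :
    Integrable fun x => (driftB ζ x).re * energyDensityDeriv ζ l x :=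
  h.integrable_energyDensityDeriv.bdd_mul (c := pvBound (quadBound A))
    h.measurable_driftB.re.aestronglyMeasurable (Eventually.of_forall fun x =>
      (Complex.abs_re_le_norm _).trans (h.norm_driftB_le x))

theorem integrable_im_mul_re (h : LogSlice A K ζ l) :
    Integrable fun x => (l x).im * -(logDerivInv ζ x).re :=
  integrable_mul_of_memLp h.memLp_im h.memLp_re_logDerivInv.neg

theorem integrable_energyRate (h : LogSlice A K ζ l) : Integrable (energyRate ζ l) := by
  have e : energyRate ζ l = fun x => _ := funext h.energyRate_eq
  rw [e]
  exact ((h.integrable_driftB_mul.neg.sub (h.integrable_sq_im_mul.const_mul 2)).sub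
    (h.integrable_im_mul_re.const_mul 2)).sub (h.integrable_energyDensity_mul_coeffB1.const_mul 2)

/-- The energy balance. -/
theorem integral_energyRate (h : LogSlice A K ζ l) : ∫ x, energyRate ζ l x =
    -(dissipationB1 ζ (fun x => (l x).im) + 2 * halfNormSq fun x => (l x).im) := by
  have e : energyRate ζ l = fun x => _ := funext h.energyRate_eq
  have i1 := h.integrable_driftB_mul
  have i2 := h.integrable_sq_im_mul.const_mul 2
  have i3 := h.integrable_im_mul_re.const_mul 2
  have i4 := h.integrable_energyDensity_mul_coeffB1
  have i12 : Integrable fun x => -((driftB ζ x).re * energyDensityDeriv ζ l x) -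
    2 * ((l x).im ^ 2 * (logDerivInv ζ x).im) := i1.neg.sub i2
  have i123 : Integrable fun x => -((driftB ζ x).re * energyDensityDeriv ζ l x) -
    2 * ((l x).im ^ 2 * (logDerivInv ζ x).im) - 2 * ((l x).im * -(logDerivInv ζ x).re) :=
    i12.sub i3
  -- The transport term contributes `+∫|ζ|²g²B₁ + 2∫g² Im p`. The second part cancels the cubic
  -- term, and the first leaves one of the two copies of `-∫|ζ|²g²B₁`.
  rw [e, integral_sub i123 (i4.const_mul 2), integral_sub i12 i3, integral_sub i1.fun_neg i2,
    integral_neg, h.integral_driftB_mul, integral_add i4 i2, integral_const_mul,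
    integral_const_mul, integral_const_mul, h.halfNormSq_eq.2]
  have e1 : dissipationB1 ζ (fun x => (l x).im) = ∫ x, energyDensity ζ l x * coeffB1 ζ x := rfl
  rw [e1]
  ring

end LogSlice

/-! ### Uniform bounds for the energy rate -/

/-- A bound for the coefficient of the space derivative in the evolution equation. -/
def speedBound (A : ℝ) : ℝ := pvBound (quadBound A) + (A + 1) ^ 2

/-- A bound for the time derivative of the energy density. -/
def rateBound (A K : ℝ) : ℝ :=
  4 * (A + 1) ^ 2 * (speedBound A * ((A + 1) * A + 1) + 8 * (A + 1) ^ 2) *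
    ((K + K ^ 2) + ((A + 1) ^ 2 * A + ((A + 1) * A) ^ 2))

namespace LogSlice

theorem norm_speed_le (h : LogSlice A K ζ l) (x : ℝ) :
    ‖driftB ζ x + Complex.I * ((‖1 / ζ x‖ ^ 2 : ℝ) : ℂ)‖ ≤ speedBound A := by
  refine (norm_add_le _ _).trans (add_le_add (h.norm_driftB_le x) ?_)
  rw [norm_mul, Complex.norm_I, one_mul, Complex.norm_real, Real.norm_of_nonneg (by positivity)]
  exact pow_le_pow_left₀ (norm_nonneg _) (h.inv_bound.norm_le' x) 2

theorem speedBound_nonneg (h : LogSlice A K ζ l) : 0 ≤ speedBound A :=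
  (norm_nonneg _).trans (h.norm_speed_le 0)

theorem abs_energyRate_le (h : LogSlice A K ζ l) (x : ℝ) : |energyRate ζ l x| ≤
    4 * (A + 1) ^ 2 * (speedBound A * ((A + 1) * A + 1) + 8 * (A + 1) ^ 2) *
      (‖l x‖ ^ 2 + ‖logDerivInv ζ x‖ ^ 2) := by
  have hA := h.nonneg
  have hs := h.speedBound_nonneg
  have hp := h.norm_logDerivInv_le x
  set m := (driftB ζ x + Complex.I * ((‖1 / ζ x‖ ^ 2 : ℝ) : ℂ)) * logDerivInv ζ x with hm
  have hm1 : ‖m‖ ≤ speedBound A * ‖logDerivInv ζ x‖ := by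
    rw [hm, norm_mul]; gcongr; exact h.norm_speed_le x
  refine h.abs_rate_le x ?_ ?_
  · rw [logRate, ← hm, Complex.sub_re, Complex.ofReal_re]
    refine (abs_sub _ _).trans ?_
    rw [abs_of_nonneg (h.coeffB1_nonneg x)]
    refine add_le_add ((Complex.abs_re_le_norm m).trans (hm1.trans ?_)) (h.coeffB1_le x)
    gcongr
    linarith
  · rw [logRate, ← hm, Complex.sub_im, Complex.ofReal_im, sub_zero]
    refine (Complex.abs_im_le_norm m).trans (hm1.trans ?_)
    gcongr
    nlinarith [mul_nonneg hs (mul_nonneg (by linarith : 0 ≤ A + 1) hA), sq_nonneg (A + 1)]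

theorem norm_energyRate_le (h : LogSlice A K ζ l) (x : ℝ) : ‖energyRate ζ l x‖ ≤ rateBound A K := by
  have hA := h.nonneg
  have hK := h.nonneg'
  have hs := h.speedBound_nonneg
  have h1 := pow_le_pow_left₀ (norm_nonneg _) (h.norm_log_le x) 2
  have h2 := pow_le_pow_left₀ (norm_nonneg _) (h.norm_logDerivInv_le x) 2
  refine (h.abs_energyRate_le x).trans ?_
  -- `rateBound` serves as both the sup and the `L¹` bound: `K²` and `((A+1)A)²` bound the squares
  -- pointwise, while `K` and `(A+1)²A` bound their integrals.
  rw [rateBound]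
  gcongr
  · linarith
  · have : 0 ≤ (A + 1) ^ 2 * A := by positivity
    linarith

theorem integral_norm_energyRate_le (h : LogSlice A K ζ l) :
    ∫ x, ‖energyRate ζ l x‖ ≤ rateBound A K := by
  have hA := h.nonneg
  have hK := h.nonneg'
  have hs := h.speedBound_nonneg
  have h1 := h.integral_log_sq_le
  have h2 := h.integral_logDerivInv_sq_le
  have h3 := integral_mono h.integrable_energyRate.norm
    ((h.integrable_log_sq.add h.integrable_logDerivInv_sq).const_mul _)
    fun x => h.abs_energyRate_le x
  rw [integral_const_mul] at h3
  refine h3.trans ?_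
  have e : ∫ x, ((fun x => ‖l x‖ ^ 2) + fun x => ‖logDerivInv ζ x‖ ^ 2) x =
      (∫ x, ‖l x‖ ^ 2) + ∫ x, ‖logDerivInv ζ x‖ ^ 2 :=
    integral_add h.integrable_log_sq h.integrable_logDerivInv_sq
  rw [e, rateBound]
  gcongr
  · nlinarith
  · nlinarith [sq_nonneg ((A + 1) * A)]

end LogSlice

/-! ### Continuity in time -/

/-- A solution together with the logarithms of `Z_{,α'}`. -/
structure LogFamily (T A : ℝ) (M : ℝ≥0) (ζ l : ℝ → ℝ → ℂ) : Prop where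
  slice : ∀ t ∈ Icc 0 T, ∃ K, LogSlice A K (ζ t) (l t)
  tendsto_log : ∀ t ∈ Icc 0 T, Tendsto (l t) (cocompact ℝ) (𝓝 0)
  sobolev : ∀ t ∈ Icc 0 T, sobolevNorm 2 (fun x => 1 / ζ t x - 1) ≤ M
  evolution : ∀ t ∈ Icc 0 T, ∀ x, HasDerivWithinAt (fun s => 1 / ζ s x)
    (-(logRate (ζ t) x * (1 / ζ t x))) (Icc 0 T) t

/-- A Lipschitz constant in time for `1 / ζ`. -/
def invRateBound (A : ℝ) : ℝ := speedBound A * A + 8 * (A + 1) ^ 3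

/-- A bound for the time derivative of `‖1 / ζ t - 1 / ζ s‖²`. -/
def sqDiffRateBound (A : ℝ) : ℝ := speedBound A * (5 * A + 5 * A ^ 2) + 32 * A * (A + 1) ^ 3

namespace LogSlice

variable {A K : ℝ} {ζ l : ℝ → ℂ}

/-- The coefficient `B₁` is kept explicit, since both its sup bound and its integral are needed
later. -/
theorem norm_invRate_le_add (h : LogSlice A K ζ l) (x : ℝ) :
    ‖-(logRate ζ x * (1 / ζ x))‖ ≤
      speedBound A * ‖deriv (fun y => 1 / ζ y) x‖ + (A + 1) * coeffB1 ζ x := by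
  have e : -(logRate ζ x * (1 / ζ x)) = -((driftB ζ x + Complex.I * ((‖1 / ζ x‖ ^ 2 : ℝ) : ℂ)) *
      deriv (fun y => 1 / ζ y) x) + coeffB1 ζ x * (1 / ζ x) := by
    have h0 := h.ne_zero x
    rw [logRate, logDerivInv, sub_mul, neg_sub, sub_eq_neg_add]
    congr 2
    field_simp
  rw [e]
  refine (norm_add_le _ _).trans ?_
  rw [norm_neg, norm_mul, norm_mul, Complex.norm_real, Real.norm_of_nonneg (h.coeffB1_nonneg x),
    mul_comm (A + 1)]
  exact add_le_add (mul_le_mul_of_nonneg_right (h.norm_speed_le x) (norm_nonneg _))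
    (mul_le_mul_of_nonneg_left (h.inv_bound.norm_le' x) (h.coeffB1_nonneg x))

theorem norm_invRate_le (h : LogSlice A K ζ l) (x : ℝ) :
    ‖-(logRate ζ x * (1 / ζ x))‖ ≤ invRateBound A := by
  have hA := h.nonneg
  have hs := h.speedBound_nonneg
  refine (h.norm_invRate_le_add x).trans ?_
  calc _ ≤ speedBound A * A + (A + 1) * (8 * (A + 1) ^ 2) := by
        gcongr
        exacts [h.inv_bound.norm_deriv_le' x, h.coeffB1_le x]
    _ = _ := by rw [invRateBound]; ring

theorem measurable_logRate (h : LogSlice A K ζ l) : Measurable (logRate ζ) := by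
  have h1 := h.measurable_driftB
  have h2 := h.continuous_logDerivInv.measurable
  have h3 := Complex.measurable_ofReal.comp h.measurable_coeffB1
  have h4 : Measurable fun x => ((‖1 / ζ x‖ ^ 2 : ℝ) : ℂ) :=
    h.inv_bound.pvAdmissible_sq.continuous.measurable
  exact ((h1.add (h4.const_mul _)).mul h2).sub h3

theorem integrable_coeffB1 (h : LogSlice A K ζ l) :
    Integrable (coeffB1 ζ) ∧ ∫ x, coeffB1 ζ x ≤ 8 * A := by
  rw [h.coeffB1_eq]
  exact h.inv_bound.integrable_gagliardo

theorem mono (h : LogSlice A K ζ l) {K' : ℝ} (h1 : ∀ x, ‖l x‖ ≤ K') (h2 : ∫ x, ‖l x‖ ^ 2 ≤ K') :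
    LogSlice A K' ζ l := { h with norm_log_le := h1, integral_log_sq_le := h2 }

variable {K' : ℝ} {ζ' l' : ℝ → ℂ}

theorem norm_inv_sub_le (h : LogSlice A K ζ l) (h' : LogSlice A K' ζ' l') (x : ℝ) :
    ‖1 / ζ x - 1 / ζ' x‖ ≤ 2 * A := by
  have h1 := norm_sub_le (1 / ζ x - 1) (1 / ζ' x - 1)
  rw [sub_sub_sub_cancel_right] at h1
  linarith [h.inv_bound.norm_le x, h'.inv_bound.norm_le x]

theorem memLp_inv_sub (h : LogSlice A K ζ l) (h' : LogSlice A K' ζ' l') :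
    MemLp (fun x => 1 / ζ x - 1 / ζ' x) 2 := by
  have := h.inv_bound.memLp.sub h'.inv_bound.memLp
  refine this.congr_norm (h.inv_bound.continuous.sub h'.inv_bound.continuous).aestronglyMeasurable
    (Eventually.of_forall fun x => ?_)
  simp

theorem integrable_inv_sub_sq (h : LogSlice A K ζ l) (h' : LogSlice A K' ζ' l') :
    Integrable fun x => ‖1 / ζ x - 1 / ζ' x‖ ^ 2 :=
  (memLp_two_iff_integrable_sq_norm (h.memLp_inv_sub h').1).1 (h.memLp_inv_sub h')

theorem integral_inv_sub_sq_le (h : LogSlice A K ζ l) (h' : LogSlice A K' ζ' l') :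
    ∫ x, ‖1 / ζ x - 1 / ζ' x‖ ^ 2 ≤ 4 * A := by
  have h1 : ∫ x, ‖1 / ζ x - 1 / ζ' x‖ ^ 2 ≤
      ∫ x, (2 * ‖1 / ζ x - 1‖ ^ 2 + 2 * ‖1 / ζ' x - 1‖ ^ 2) := by
    refine integral_mono (h.integrable_inv_sub_sq h')
      ((h.inv_bound.integrable_sq.const_mul 2).add (h'.inv_bound.integrable_sq.const_mul 2))
      fun x => ?_
    have h1 := norm_sub_le (1 / ζ x - 1) (1 / ζ' x - 1)
    rw [sub_sub_sub_cancel_right] at h1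
    simp only
    nlinarith [norm_nonneg (1 / ζ x - 1 / ζ' x), sq_nonneg (‖1 / ζ x - 1‖ - ‖1 / ζ' x - 1‖)]
  rw [integral_add (h.inv_bound.integrable_sq.const_mul 2)
    (h'.inv_bound.integrable_sq.const_mul 2), integral_const_mul, integral_const_mul] at h1
  linarith [h.inv_bound.integral_sq_le, h'.inv_bound.integral_sq_le]

/-- The time derivative of the squared difference of two slices. -/
theorem abs_sqDiffRate_le (h : LogSlice A K ζ l) (h' : LogSlice A K' ζ' l') (x : ℝ) :
    ‖2 * inner ℝ (1 / ζ x - 1 / ζ' x) (-(logRate ζ x * (1 / ζ x)))‖ ≤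
      speedBound A * (‖1 / ζ x - 1 / ζ' x‖ ^ 2 + ‖deriv (fun y => 1 / ζ y) x‖ ^ 2) +
        4 * A * (A + 1) * coeffB1 ζ x := by
  have hA := h.nonneg
  have hs := h.speedBound_nonneg
  have hB := h.coeffB1_nonneg x
  have h1 := h.norm_inv_sub_le h' x
  rw [norm_mul, Real.norm_ofNat]
  have h2 := norm_inner_le_norm (𝕜 := ℝ) (1 / ζ x - 1 / ζ' x) (-(logRate ζ x * (1 / ζ x)))
  have h3 := mul_le_mul_of_nonneg_left (h.norm_invRate_le_add x) (norm_nonneg (1 / ζ x - 1 / ζ' x))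
  set F := ‖1 / ζ x - 1 / ζ' x‖
  set p := ‖deriv (fun y => 1 / ζ y) x‖
  -- In the `B₁` term the difference is bounded by its supremum and integrability comes from `B₁`;
  -- in the transport term the product of two square integrable factors is split into squares.
  have h4 : F * ((A + 1) * coeffB1 ζ x) ≤ 2 * A * ((A + 1) * coeffB1 ζ x) := by gcongr
  have h5 : speedBound A * (2 * F * p) ≤ speedBound A * (F ^ 2 + p ^ 2) := by
    gcongr; nlinarith [sq_nonneg (F - p)]
  linarith

theorem sqDiffRate_bounds (h : LogSlice A K ζ l) (h' : LogSlice A K' ζ' l') :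
    Integrable (fun x => 2 * inner ℝ (1 / ζ x - 1 / ζ' x) (-(logRate ζ x * (1 / ζ x)))) ∧
      (∫ x, ‖2 * inner ℝ (1 / ζ x - 1 / ζ' x) (-(logRate ζ x * (1 / ζ x)))‖ ≤ sqDiffRateBound A) ∧
      ∀ x, ‖2 * inner ℝ (1 / ζ x - 1 / ζ' x) (-(logRate ζ x * (1 / ζ x)))‖ ≤ sqDiffRateBound A := by
  have hA := h.nonneg
  have hs := h.speedBound_nonneg
  have i1 := h.integrable_inv_sub_sq h'
  have i2 := h.inv_bound.integrable_deriv_sq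
  have i3 := h.integrable_coeffB1
  have i12 : Integrable fun x => speedBound A * (‖1 / ζ x - 1 / ζ' x‖ ^ 2 +
      ‖deriv (fun y => 1 / ζ y) x‖ ^ 2) := (i1.add i2).const_mul _
  have ib := i12.add (i3.1.const_mul (4 * A * (A + 1)))
  have hm : Measurable fun x =>
      2 * inner ℝ (1 / ζ x - 1 / ζ' x) (-(logRate ζ x * (1 / ζ x))) :=
    ((h.inv_bound.continuous.sub h'.inv_bound.continuous).measurable.inner
      (h.measurable_logRate.mul h.inv_bound.continuous.measurable).neg).const_mul 2
  have hi := ib.mono' hm.aestronglyMeasurable (Eventually.of_forall (h.abs_sqDiffRate_le h'))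
  have hq : 4 * A * (A + 1) * (8 * (A + 1) ^ 2) = 32 * A * (A + 1) ^ 3 := by ring
  refine ⟨hi, ?_, fun x => ?_⟩
  · refine (integral_mono hi.norm ib (h.abs_sqDiffRate_le h')).trans ?_
    have e : ∫ x, ((fun x => speedBound A * (‖1 / ζ x - 1 / ζ' x‖ ^ 2 +
        ‖deriv (fun y => 1 / ζ y) x‖ ^ 2)) + fun x => 4 * A * (A + 1) * coeffB1 ζ x) x =
        speedBound A * ((∫ x, ‖1 / ζ x - 1 / ζ' x‖ ^ 2) +
          ∫ x, ‖deriv (fun y => 1 / ζ y) x‖ ^ 2) + 4 * A * (A + 1) * ∫ x, coeffB1 ζ x := by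
      rw [← integral_add i1 i2, ← integral_const_mul, ← integral_const_mul]
      exact integral_add i12 (i3.1.const_mul (4 * A * (A + 1)))
    -- One constant again covers both bounds: `5A` is `4A + A` for the integrals and `5A²` is `(2A)²
    -- + A²` for the pointwise estimate.
    rw [e, sqDiffRateBound, ← hq]
    have h2 := h.integral_inv_sub_sq_le h'
    have h3 := h.inv_bound.integral_deriv_sq_le'
    refine add_le_add (mul_le_mul_of_nonneg_left ?_ hs) (mul_le_mul_of_nonneg_left ?_ (by positivity))
    · nlinarith [sq_nonneg A]
    · refine i3.2.trans ?_
      nlinarith [sq_nonneg A]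
  · refine (h.abs_sqDiffRate_le h' x).trans ?_
    rw [sqDiffRateBound, ← hq]
    have h2 := pow_le_pow_left₀ (norm_nonneg _) (h.norm_inv_sub_le h' x) 2
    have h3 := pow_le_pow_left₀ (norm_nonneg _) (h.inv_bound.norm_deriv_le' x) 2
    refine add_le_add (mul_le_mul_of_nonneg_left ?_ hs) (mul_le_mul_of_nonneg_left ?_ (by positivity))
    · nlinarith
    · exact h.coeffB1_le x

theorem norm_sub_le_mul (h : LogSlice A K ζ l) (h' : LogSlice A K' ζ' l') (x : ℝ) :
    ‖ζ x - ζ' x‖ ≤ (A + 1) ^ 2 * ‖1 / ζ x - 1 / ζ' x‖ := by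
  have e : ζ x - ζ' x = -(ζ x * ζ' x) * (1 / ζ x - 1 / ζ' x) := by
    have h1 := h.ne_zero x
    have h2 := h'.ne_zero x
    field_simp
    ring
  rw [e, norm_mul, norm_neg, norm_mul, sq (A + 1)]
  have hA := h.nonneg
  gcongr
  exacts [h.bound.norm_le' x, h'.bound.norm_le' x]

/-- Here `e^{l - l'} - 1 = -ζ (1/ζ - 1/ζ')`, so closeness of the inverses passes to the logarithms
through `norm_le_of_norm_exp_sub_one_lt`. The threshold on `δ` puts the exponential in the range of
that lemma. -/
theorem norm_log_sub_le (h : LogSlice A K ζ l) (h' : LogSlice A K' ζ' l')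
    (h0 : Tendsto l (cocompact ℝ) (𝓝 0)) (h0' : Tendsto l' (cocompact ℝ) (𝓝 0)) {δ : ℝ}
    (hδ : ∀ x, ‖1 / ζ x - 1 / ζ' x‖ ≤ δ) (hδ' : (A + 1) * δ < 1 / 4) (x : ℝ) :
    ‖l x - l' x‖ ≤ 2 * (A + 1) * ‖1 / ζ x - 1 / ζ' x‖ := by
  have hA := h.nonneg
  have e : ∀ x, ‖Complex.exp (l x - l' x) - 1‖ ≤ (A + 1) * ‖1 / ζ x - 1 / ζ' x‖ := fun x => by
    have h1 := h.ne_zero x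
    have h2 := h'.ne_zero x
    have e : Complex.exp (l x - l' x) - 1 = -(ζ x * (1 / ζ x - 1 / ζ' x)) := by
      rw [Complex.exp_sub, h.exp_log, h'.exp_log]
      field_simp
      ring
    rw [e, norm_neg, norm_mul]
    exact mul_le_mul_of_nonneg_right (h.bound.norm_le' x) (norm_nonneg _)
  have h1 := norm_le_of_norm_exp_sub_one_lt (D := fun x => l x - l' x)
    (h.continuous_log.sub h'.continuous_log) (by simpa using h0.sub h0')
    (fun x => ((e x).trans (by gcongr; exact hδ x)).trans_lt hδ') x
  linarith [e x]

theorem norm_logDerivInv_sub_le (h : LogSlice A K ζ l) (h' : LogSlice A K' ζ' l') {δ : ℝ}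
    (hδ : ∀ x, ‖1 / ζ x - 1 / ζ' x‖ ≤ δ) (x : ℝ) :
    ‖logDerivInv ζ x - logDerivInv ζ' x‖ ^ 2 ≤
      2 * (A + 1) ^ 2 * ‖deriv (fun y => 1 / ζ y) x - deriv (fun y => 1 / ζ' y) x‖ ^ 2 +
        2 * ((A + 1) ^ 2 * δ) ^ 2 * ‖deriv (fun y => 1 / ζ' y) x‖ ^ 2 := by
  have hA := h.nonneg
  have e : logDerivInv ζ x - logDerivInv ζ' x =
      (deriv (fun y => 1 / ζ y) x - deriv (fun y => 1 / ζ' y) x) * ζ x +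
        deriv (fun y => 1 / ζ' y) x * (ζ x - ζ' x) := by
    rw [logDerivInv, logDerivInv]; ring
  have h1 := norm_add_le ((deriv (fun y => 1 / ζ y) x - deriv (fun y => 1 / ζ' y) x) * ζ x)
    (deriv (fun y => 1 / ζ' y) x * (ζ x - ζ' x))
  rw [← e, norm_mul, norm_mul] at h1
  set a := ‖deriv (fun y => 1 / ζ y) x - deriv (fun y => 1 / ζ' y) x‖
  set b := ‖deriv (fun y => 1 / ζ' y) x‖
  have h2 : a * ‖ζ x‖ ≤ a * (A + 1) := by gcongr; exact h.bound.norm_le' x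
  have h3 : b * ‖ζ x - ζ' x‖ ≤ b * ((A + 1) ^ 2 * δ) := by
    gcongr
    exact (h.norm_sub_le_mul h' x).trans (by gcongr; exact hδ x)
  have h4 := pow_le_pow_left₀ (norm_nonneg _) (h1.trans (add_le_add h2 h3)) 2
  nlinarith [sq_nonneg (a * (A + 1) - b * ((A + 1) ^ 2 * δ))]

end LogSlice

namespace LogFamily

variable {T A : ℝ} {M : ℝ≥0} {ζ l : ℝ → ℝ → ℂ} {s t : ℝ}

theorem norm_inv_sub_le (h : LogFamily T A M ζ l) (hs : s ∈ Icc 0 T) (ht : t ∈ Icc 0 T) (x : ℝ) :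
    ‖1 / ζ t x - 1 / ζ s x‖ ≤ invRateBound A * |t - s| :=
  Convex.norm_image_sub_le_of_norm_hasDerivWithin_le (f := fun τ => 1 / ζ τ x)
    (fun τ hτ => h.evolution τ hτ x) (fun τ hτ => (h.slice τ hτ).choose_spec.norm_invRate_le x)
    (convex_Icc 0 T) hs ht

/-- The `L¹` Lipschitz estimate is applied to `|1/ζ_τ - 1/ζ_s|²`, which vanishes at `τ = s`. -/
theorem integral_inv_sub_sq_le (h : LogFamily T A M ζ l) (hs : s ∈ Icc 0 T) (ht : t ∈ Icc 0 T) :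
    ∫ x, ‖1 / ζ t x - 1 / ζ s x‖ ^ 2 ≤ sqDiffRateBound A * |t - s| := by
  choose! K hK using h.slice
  have h1 := integral_norm_sub_le (T := T) (C := sqDiffRateBound A)
    (h := fun τ x => ‖1 / ζ τ x - 1 / ζ s x‖ ^ 2)
    (R := fun τ x => 2 * inner ℝ (1 / ζ τ x - 1 / ζ s x) (-(logRate (ζ τ) x * (1 / ζ τ x))))
    (hs.1.trans hs.2)
    (fun τ hτ => ((hK τ hτ).inv_bound.continuous.sub (hK s hs).inv_bound.continuous).norm.pow 2)
    (fun τ hτ => ((hK τ hτ).sqDiffRate_bounds (hK s hs)).1)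
    (fun τ hτ => ((hK τ hτ).sqDiffRate_bounds (hK s hs)).2.1)
    (fun τ hτ => ((hK τ hτ).sqDiffRate_bounds (hK s hs)).2.2)
    (fun τ hτ x => ((h.evolution τ hτ x).sub_const _).norm_sq) hs ht
  simpa using h1

theorem tendsto_abs_sub (s T : ℝ) : Tendsto (fun t => |t - s|) (𝓝[Icc 0 T] s) (𝓝 0) := by
  have : Continuous fun t => |t - s| := by fun_prop
  simpa using (this.tendsto s).mono_left nhdsWithin_le_nhds

theorem tendsto_inv (h : LogFamily T A M ζ l) (hs : s ∈ Icc 0 T) (x : ℝ) :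
    Tendsto (fun t => 1 / ζ t x) (𝓝[Icc 0 T] s) (𝓝 (1 / ζ s x)) :=
  (h.evolution s hs x).continuousWithinAt

theorem tendsto_integral_inv_sub_sq (h : LogFamily T A M ζ l) (hs : s ∈ Icc 0 T) :
    Tendsto (fun t => ∫ x, ‖1 / ζ t x - 1 / ζ s x‖ ^ 2) (𝓝[Icc 0 T] s) (𝓝 0) := by
  refine squeeze_zero' (Eventually.of_forall fun t => integral_nonneg fun x => sq_nonneg _)
    (eventually_mem_nhdsWithin.mono fun t ht => h.integral_inv_sub_sq_le hs ht) ?_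
  simpa using (tendsto_abs_sub s T).const_mul (sqDiffRateBound A)

theorem tendsto_integral_deriv_sub_sq (h : LogFamily T A M ζ l) (hs : s ∈ Icc 0 T) :
    Tendsto (fun t => ∫ x, ‖deriv (fun y => 1 / ζ t y) x - deriv (fun y => 1 / ζ s y) x‖ ^ 2)
      (𝓝[Icc 0 T] s) (𝓝 0) := by
  choose! K hK using h.slice
  rw [Metric.tendsto_nhds]
  intro η hη
  -- With this interpolation parameter the `H²` part is at most `η/2` for every `t`; the `L²` part
  -- falls below `η/2` as `t → s`.
  set ε := η / (8 * (M : ℝ) ^ 2 + 1) with hε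
  have hε0 : 0 < ε := by positivity
  have hε1 : 4 * (M : ℝ) ^ 2 * ε ≤ η / 2 := by
    rw [hε, mul_div_assoc', div_le_iff₀ (by positivity)]
    nlinarith [sq_nonneg (M : ℝ)]
  have h2 := (h.tendsto_integral_inv_sub_sq hs).const_mul (1 / (4 * ε))
  rw [mul_zero] at h2
  filter_upwards [h2.eventually_lt_const (half_pos hη), self_mem_nhdsWithin] with t h2 ht
  have h3 := integral_deriv_sub_sq_le (h.sobolev t ht) (h.sobolev s hs) (hK t ht).inv_bound
    (hK s hs).inv_bound hε0
  simp only [HTwoBound.deriv_eq (f := fun x => 1 / ζ t x),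
    HTwoBound.deriv_eq (f := fun x => 1 / ζ s x), sub_sub_sub_cancel_right] at h3
  rw [dist_zero_right, Real.norm_of_nonneg (integral_nonneg fun x => sq_nonneg _)]
  linarith

theorem tendsto_integral_logDerivInv_sub_sq (h : LogFamily T A M ζ l) (hs : s ∈ Icc 0 T) :
    Tendsto (fun t => ∫ x, ‖logDerivInv (ζ t) x - logDerivInv (ζ s) x‖ ^ 2)
      (𝓝[Icc 0 T] s) (𝓝 0) := by
  choose! K hK using h.slice
  have hlim : Tendsto (fun t => 2 * (A + 1) ^ 2 *
      (∫ x, ‖deriv (fun y => 1 / ζ t y) x - deriv (fun y => 1 / ζ s y) x‖ ^ 2) +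
        2 * ((A + 1) ^ 2 * (invRateBound A * |t - s|)) ^ 2 *
          ∫ x, ‖deriv (fun y => 1 / ζ s y) x‖ ^ 2) (𝓝[Icc 0 T] s) (𝓝 0) := by
    have h1 := (h.tendsto_integral_deriv_sub_sq hs).const_mul (2 * (A + 1) ^ 2)
    have h2 := ((((tendsto_abs_sub s T).const_mul (invRateBound A)).const_mul
      ((A + 1) ^ 2)).pow 2).const_mul 2
    have h3 := h2.mul_const (∫ x, ‖deriv (fun y => 1 / ζ s y) x‖ ^ 2)
    simpa using h1.add h3
  refine squeeze_zero' (Eventually.of_forall fun t => integral_nonneg fun x => sq_nonneg _) ?_ hlim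
  filter_upwards [self_mem_nhdsWithin] with t ht
  have m1 : MemLp (fun x => deriv (fun y => 1 / ζ t y) x - deriv (fun y => 1 / ζ s y) x) 2 :=
    (hK t ht).inv_bound.memLp_deriv'.sub (hK s hs).inv_bound.memLp_deriv'
  have i1 := (memLp_two_iff_integrable_sq_norm m1.1).1 m1
  have i2 := (hK s hs).inv_bound.integrable_deriv_sq
  rw [← integral_const_mul, ← integral_const_mul, ← integral_add (i1.const_mul _) (i2.const_mul _)]
  exact integral_mono_of_nonneg (Eventually.of_forall fun x => sq_nonneg _)
    ((i1.const_mul _).add (i2.const_mul _)) (Eventually.of_forall fun x =>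
      (hK t ht).norm_logDerivInv_sub_le (hK s hs) (h.norm_inv_sub_le hs ht) x)

/-- The time differences for which logarithms are controlled by the inverses. -/
theorem eventually_norm_log_sub_le (h : LogFamily T A M ζ l) (hs : s ∈ Icc 0 T) :
    ∀ᶠ t in 𝓝[Icc 0 T] s, t ∈ Icc 0 T ∧
      ∀ x, ‖l t x - l s x‖ ≤ 2 * (A + 1) * ‖1 / ζ t x - 1 / ζ s x‖ := by
  choose! K hK using h.slice
  have h1 := ((tendsto_abs_sub s T).const_mul (invRateBound A)).const_mul (A + 1)
  rw [mul_zero, mul_zero] at h1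
  filter_upwards [h1.eventually_lt_const (by norm_num : (0 : ℝ) < 1 / 4), self_mem_nhdsWithin]
    with t h1 ht
  exact ⟨ht, (hK t ht).norm_log_sub_le (hK s hs) (h.tendsto_log t ht) (h.tendsto_log s hs)
    (h.norm_inv_sub_le hs ht) h1⟩

theorem tendsto_log_time (h : LogFamily T A M ζ l) (hs : s ∈ Icc 0 T) (x : ℝ) :
    Tendsto (fun t => l t x) (𝓝[Icc 0 T] s) (𝓝 (l s x)) := by
  rw [tendsto_iff_norm_sub_tendsto_zero]
  refine squeeze_zero' (Eventually.of_forall fun t => norm_nonneg _)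
    ((h.eventually_norm_log_sub_le hs).mono fun t ht => ht.2 x) ?_
  have := (tendsto_iff_norm_sub_tendsto_zero.1 (h.tendsto_inv hs x)).const_mul (2 * (A + 1))
  simpa using this

theorem eventually_integral_log_sub_sq_le (h : LogFamily T A M ζ l) (hs : s ∈ Icc 0 T) :
    ∀ᶠ t in 𝓝[Icc 0 T] s, ∫ x, ‖l t x - l s x‖ ^ 2 ≤
      (2 * (A + 1)) ^ 2 * ∫ x, ‖1 / ζ t x - 1 / ζ s x‖ ^ 2 := by
  choose! K hK using h.slice
  filter_upwards [h.eventually_norm_log_sub_le hs] with t ⟨ht, h1⟩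
  rw [← integral_const_mul]
  refine integral_mono_of_nonneg (Eventually.of_forall fun x => sq_nonneg _)
    (((hK t ht).integrable_inv_sub_sq (hK s hs)).const_mul _) (Eventually.of_forall fun x => ?_)
  simp only
  rw [← mul_pow]
  exact pow_le_pow_left₀ (norm_nonneg _) (h1 x) 2

theorem tendsto_integral_log_sub_sq (h : LogFamily T A M ζ l) (hs : s ∈ Icc 0 T) :
    Tendsto (fun t => ∫ x, ‖l t x - l s x‖ ^ 2) (𝓝[Icc 0 T] s) (𝓝 0) := by
  refine squeeze_zero' (Eventually.of_forall fun t => integral_nonneg fun x => sq_nonneg _)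
    (h.eventually_integral_log_sub_sq_le hs) ?_
  simpa using (h.tendsto_integral_inv_sub_sq hs).const_mul ((2 * (A + 1)) ^ 2)

/-- The bounds for the logarithm are uniform in time. -/
theorem exists_slice (h : LogFamily T A M ζ l) :
    ∃ K, ∀ t ∈ Icc 0 T, LogSlice A K (ζ t) (l t) := by
  choose! K hK using h.slice
  suffices hb : ∃ B, ∀ t ∈ Icc 0 T, (∀ x, ‖l t x‖ ≤ B) ∧ ∫ x, ‖l t x‖ ^ 2 ≤ B by
    obtain ⟨B, hB⟩ := hb
    exact ⟨B, fun t ht => (hK t ht).mono (hB t ht).1 (hB t ht).2⟩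
  -- Boundedness holds near each time by comparison with the logarithm at that time; compactness of
  -- `[0, T]` makes it uniform.
  refine isCompact_Icc.induction_on
    (p := fun S => ∃ B, ∀ t ∈ S, (∀ x, ‖l t x‖ ≤ B) ∧ ∫ x, ‖l t x‖ ^ 2 ≤ B) ⟨0, by simp⟩
    (fun S S' hS ⟨B, hB⟩ => ⟨B, fun t ht => hB t (hS ht)⟩) ?_ ?_
  · rintro S S' ⟨B, hB⟩ ⟨B', hB'⟩
    refine ⟨max B B', fun t ht => ht.elim (fun ht => ?_) fun ht => ?_⟩
    · exact ⟨fun x => ((hB t ht).1 x).trans (le_max_left _ _), (hB t ht).2.trans (le_max_left _ _)⟩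
    · exact ⟨fun x => ((hB' t ht).1 x).trans (le_max_right _ _),
        (hB' t ht).2.trans (le_max_right _ _)⟩
  · intro s hs
    have hA := (hK s hs).nonneg
    have e2 := (h.tendsto_integral_log_sub_sq hs).eventually_le_const one_pos
    -- The inverses differ by at most `2A`, which gives the first entry. The second uses `‖l_t‖² ≤
    -- 2‖l_t - l_s‖² + 2‖l_s‖²` with the squared `L²` distance at most `1`.
    refine ⟨_, (h.eventually_norm_log_sub_le hs).and e2,
      max (2 * (A + 1) * (2 * A) + K s) (2 + 2 * K s), ?_⟩
    rintro t ⟨⟨ht, h1⟩, h2⟩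
    refine ⟨fun x => le_max_of_le_left ?_, le_max_of_le_right ?_⟩
    · have h3 : ‖l t x - l s x‖ ≤ 2 * (A + 1) * (2 * A) :=
        (h1 x).trans (by gcongr; exact (hK t ht).norm_inv_sub_le (hK s hs) x)
      have h4 := norm_add_le (l t x - l s x) (l s x)
      rw [sub_add_cancel] at h4
      linarith [(hK s hs).norm_log_le x]
    · have m1 : MemLp (fun x => l t x - l s x) 2 := (hK t ht).memLp_log.sub (hK s hs).memLp_log
      have i1 := (memLp_two_iff_integrable_sq_norm m1.1).1 m1
      have i2 := (hK s hs).integrable_log_sq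
      have h5 : ∫ x, ‖l t x‖ ^ 2 ≤ ∫ x, (2 * ‖l t x - l s x‖ ^ 2 + 2 * ‖l s x‖ ^ 2) := by
        refine integral_mono (hK t ht).integrable_log_sq ((i1.const_mul 2).add (i2.const_mul 2))
          fun x => ?_
        have h4 := norm_add_le (l t x - l s x) (l s x)
        rw [sub_add_cancel] at h4
        simp only
        nlinarith [norm_nonneg (l t x), sq_nonneg (‖l t x - l s x‖ - ‖l s x‖)]
      rw [integral_add (i1.const_mul 2) (i2.const_mul 2), integral_const_mul,
        integral_const_mul] at h5
      linarith [(hK s hs).integral_log_sq_le]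

/-- The logarithms were selected time by time, so continuity in `t` at fixed `x` has to be known
beforehand; differentiability then follows from that of `1/ζ = e^{-l}`. -/
theorem hasDerivWithinAt_log (h : LogFamily T A M ζ l) (hs : s ∈ Icc 0 T) (x : ℝ) :
    HasDerivWithinAt (fun t => l t x) (logRate (ζ s) x) (Icc 0 T) s := by
  choose! K hK using h.slice
  have h1 := hasDerivWithinAt_of_exp (L := fun t => -l t x) (u := fun t => 1 / ζ t x) hs
    (h.tendsto_log_time hs x).neg
    (fun t ht => by rw [Complex.exp_neg, (hK t ht).exp_log, one_div]) (h.evolution s hs x)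
  have h2 := h1.neg
  have e : (-fun t => -l t x) = fun t => l t x := by ext t; simp
  rw [e] at h2
  refine h2.congr_deriv ?_
  have := (hK s hs).ne_zero x
  field_simp

theorem hasDerivWithinAt_energyDensity (h : LogFamily T A M ζ l) (hs : s ∈ Icc 0 T) (x : ℝ) :
    HasDerivWithinAt (fun t => energyDensity (ζ t) (l t) x) (energyRate (ζ s) (l s) x)
      (Icc 0 T) s := by
  choose! K hK using h.slice
  have h1 := hasDerivAt_norm_exp_sq (h.hasDerivWithinAt_log hs x)
  rw [(hK s hs).exp_log] at h1
  exact h1.congr (fun t ht => by rw [energyDensity, (hK t ht).exp_log])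
    (by rw [energyDensity, (hK s hs).exp_log])

theorem energy_sub_energy (h : LogFamily T A M ζ l) (hs : 0 ≤ s) (hst : s ≤ t) (ht : t ≤ T) :
    energy (ζ t) (fun x => (l t x).im) - energy (ζ s) (fun x => (l s x).im) =
      ∫ τ in s..t, -(dissipationB1 (ζ τ) (fun x => (l τ x).im) +
        2 * halfNormSq fun x => (l τ x).im) := by
  obtain ⟨K, hK⟩ := h.exists_slice
  have h1 := integral_sub_integral_eq (hs.trans (hst.trans ht))
    (fun τ hτ => (hK τ hτ).continuous_energyDensity)
    (fun τ hτ => (hK τ hτ).integrable_energyDensity) (fun τ hτ => (hK τ hτ).integrable_energyRate)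
    (fun τ hτ => (hK τ hτ).integral_norm_energyRate_le)
    (fun τ hτ => (hK τ hτ).norm_energyRate_le)
    (fun τ hτ x => h.hasDerivWithinAt_energyDensity hτ x) hs hst ht
  refine h1.trans (intervalIntegral.integral_congr fun τ hτ => ?_)
  rw [uIcc_of_le hst] at hτ
  exact (hK τ ⟨hs.trans hτ.1, hτ.2.trans ht⟩).integral_energyRate

/-- Through the pairing of `g` with `∂ Re l` only `L²` continuity in time of `l` and of its space
derivative is needed, not continuity in a fractional space. -/
theorem continuousOn_halfNormSq (h : LogFamily T A M ζ l) :
    ContinuousOn (fun t => halfNormSq fun x => (l t x).im) (Icc 0 T) := by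
  choose! K hK using h.slice
  intro s hs
  have h1 : Tendsto (fun t => ∫ x, (l t x).im * -(logDerivInv (ζ t) x).re) (𝓝[Icc 0 T] s)
      (𝓝 (∫ x, (l s x).im * -(logDerivInv (ζ s) x).re)) := by
    refine tendsto_integral_mul (eventually_mem_nhdsWithin.mono fun t ht => (hK t ht).memLp_im)
      (eventually_mem_nhdsWithin.mono fun t ht => (hK t ht).memLp_re_logDerivInv.neg)
      (hK s hs).memLp_im (hK s hs).memLp_re_logDerivInv.neg ?_ ?_
    · refine squeeze_zero' (Eventually.of_forall fun t => integral_nonneg fun x => sq_nonneg _) ?_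
        (h.tendsto_integral_log_sub_sq hs)
      filter_upwards [self_mem_nhdsWithin] with t ht
      have m1 : MemLp (fun x => l t x - l s x) 2 := (hK t ht).memLp_log.sub (hK s hs).memLp_log
      refine integral_mono_of_nonneg (Eventually.of_forall fun x => sq_nonneg _)
        ((memLp_two_iff_integrable_sq_norm m1.1).1 m1) (Eventually.of_forall fun x => ?_)
      simp only
      rw [← Complex.sub_im, ← sq_abs]
      exact pow_le_pow_left₀ (abs_nonneg _) (Complex.abs_im_le_norm _) 2
    · refine squeeze_zero' (Eventually.of_forall fun t => integral_nonneg fun x => sq_nonneg _) ?_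
        (h.tendsto_integral_logDerivInv_sub_sq hs)
      filter_upwards [self_mem_nhdsWithin] with t ht
      have m1 : MemLp (fun x => logDerivInv (ζ t) x - logDerivInv (ζ s) x) 2 :=
        (hK t ht).memLp_logDerivInv.sub (hK s hs).memLp_logDerivInv
      refine integral_mono_of_nonneg (Eventually.of_forall fun x => sq_nonneg _)
        ((memLp_two_iff_integrable_sq_norm m1.1).1 m1) (Eventually.of_forall fun x => ?_)
      simp only
      rw [neg_sub_neg, ← Complex.sub_re, ← sq_abs, norm_sub_rev]
      exact pow_le_pow_left₀ (abs_nonneg _) (Complex.abs_re_le_norm _) 2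
  rw [ContinuousWithinAt, (hK s hs).halfNormSq_eq.2]
  refine h1.congr' ?_
  filter_upwards [self_mem_nhdsWithin] with t ht
  exact (hK t ht).halfNormSq_eq.2.symm

/-- The product is split: the density is Lipschitz in time with values in `L¹` while `B₁` is
uniformly bounded, and against the frozen density `B₁` converges pointwise with a constant majorant.
-/
theorem continuousOn_dissipationB1 (h : LogFamily T A M ζ l) :
    ContinuousOn (fun t => dissipationB1 (ζ t) fun x => (l t x).im) (Icc 0 T) := by
  obtain ⟨K, hK⟩ := h.exists_slice
  intro s hs
  have hd : Tendsto (fun t => ∫ x, ‖energyDensity (ζ t) (l t) x - energyDensity (ζ s) (l s) x‖)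
      (𝓝[Icc 0 T] s) (𝓝 0) := by
    refine squeeze_zero' (Eventually.of_forall fun t => integral_nonneg fun x => norm_nonneg _)
      (g := fun t => rateBound A K * |t - s|) ?_
      (by simpa using (tendsto_abs_sub s T).const_mul (rateBound A K))
    filter_upwards [self_mem_nhdsWithin] with t ht
    exact integral_norm_sub_le (hs.1.trans hs.2)
      (fun τ hτ => (hK τ hτ).continuous_energyDensity)
      (fun τ hτ => (hK τ hτ).integrable_energyRate)
      (fun τ hτ => (hK τ hτ).integral_norm_energyRate_le)
      (fun τ hτ => (hK τ hτ).norm_energyRate_le)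
      (fun τ hτ x => h.hasDerivWithinAt_energyDensity hτ x) hs ht
  have hB : ∀ x, Tendsto (fun t => coeffB1 (ζ t) x) (𝓝[Icc 0 T] s) (𝓝 (coeffB1 (ζ s) x)) := by
    intro x
    rw [(hK s hs).coeffB1_eq]
    refine (tendsto_gagliardo (F := fun t x => 1 / ζ t x)
      (eventually_mem_nhdsWithin.mono fun t ht => (hK t ht).inv_bound)
      (fun y => h.tendsto_inv hs y) x).congr' ?_
    filter_upwards [self_mem_nhdsWithin] with t ht
    rw [(hK t ht).coeffB1_eq]
  have h1 : Tendsto (fun t => ∫ x, energyDensity (ζ s) (l s) x * coeffB1 (ζ t) x) (𝓝[Icc 0 T] s)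
      (𝓝 (∫ x, energyDensity (ζ s) (l s) x * coeffB1 (ζ s) x)) := by
    refine tendsto_integral_filter_of_dominated_convergence
      (fun x => energyDensity (ζ s) (l s) x * (8 * (A + 1) ^ 2)) ?_ ?_
      ((hK s hs).integrable_energyDensity.mul_const _)
      (Eventually.of_forall fun x => (hB x).const_mul _)
    · filter_upwards [self_mem_nhdsWithin] with t ht
      exact (hK s hs).integrable_energyDensity.1.mul (hK t ht).measurable_coeffB1.aestronglyMeasurable
    · filter_upwards [self_mem_nhdsWithin] with t ht
      refine Eventually.of_forall fun x => ?_
      have h0 := LogSlice.energyDensity_nonneg (ζ s) (l s) x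
      rw [Real.norm_of_nonneg (mul_nonneg h0 ((hK t ht).coeffB1_nonneg x))]
      exact mul_le_mul_of_nonneg_left ((hK t ht).coeffB1_le x) h0
  have h2 : Tendsto (fun t => ∫ x, (energyDensity (ζ t) (l t) x - energyDensity (ζ s) (l s) x) *
      coeffB1 (ζ t) x) (𝓝[Icc 0 T] s) (𝓝 0) := by
    refine squeeze_zero_norm' (a := fun t => (∫ x, ‖energyDensity (ζ t) (l t) x -
      energyDensity (ζ s) (l s) x‖) * (8 * (A + 1) ^ 2)) ?_
      (by simpa using hd.mul_const (8 * (A + 1) ^ 2))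
    filter_upwards [self_mem_nhdsWithin] with t ht
    refine (norm_integral_le_integral_norm _).trans ?_
    rw [← integral_mul_const]
    have hi : Integrable fun x => energyDensity (ζ t) (l t) x - energyDensity (ζ s) (l s) x :=
      (hK t ht).integrable_energyDensity.sub (hK s hs).integrable_energyDensity
    refine integral_mono_of_nonneg (Eventually.of_forall fun x => norm_nonneg _)
      (hi.norm.mul_const _) (Eventually.of_forall fun x => ?_)
    simp only
    rw [norm_mul, Real.norm_of_nonneg ((hK t ht).coeffB1_nonneg x)]
    exact mul_le_mul_of_nonneg_left ((hK t ht).coeffB1_le x) (norm_nonneg _)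
  have h3 := h2.add h1
  rw [zero_add] at h3
  refine h3.congr' ?_
  filter_upwards [self_mem_nhdsWithin] with t ht
  have hb : ∀ {φ : ℝ → ℝ}, Integrable φ → Integrable fun x => φ x * coeffB1 (ζ t) x := fun hφ =>
    hφ.mul_bdd (c := 8 * (A + 1) ^ 2) (hK t ht).measurable_coeffB1.aestronglyMeasurable
      (Eventually.of_forall fun x => by
        rw [Real.norm_of_nonneg ((hK t ht).coeffB1_nonneg x)]; exact (hK t ht).coeffB1_le x)
  have hi : Integrable fun x => energyDensity (ζ t) (l t) x - energyDensity (ζ s) (l s) x :=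
    (hK t ht).integrable_energyDensity.sub (hK s hs).integrable_energyDensity
  rw [← integral_add (hb hi) (hb (hK s hs).integrable_energyDensity)]
  refine integral_congr_ae (Eventually.of_forall fun x => ?_)
  simp only [energyDensity]
  ring

end LogFamily

/-! ### The logarithms of a regular solution -/

theorem exists_norm_le_of_tendsto_zero {l : ℝ → ℂ} (hc : Continuous l)
    (h0 : Tendsto l (cocompact ℝ) (𝓝 0)) : ∃ K, ∀ x, ‖l x‖ ≤ K := by
  obtain ⟨C, hC⟩ := ZeroAtInftyContinuousMap.bounded (⟨⟨l, hc⟩, h0⟩ : ZeroAtInftyContinuousMap ℝ ℂ)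
  refine ⟨C + ‖l 0‖, fun x => ?_⟩
  have h1 : dist (l x) (l 0) ≤ C := hC x 0
  rw [dist_eq_norm] at h1
  linarith [norm_sub_norm_le (l x) (l 0)]

theorem IsRegularSolution.exists_hTwoBound {T : ℝ} {ζ : ℝ → ℝ → ℂ} (h : IsRegularSolution T ζ) :
    ∃ (A : ℝ) (M : ℝ≥0), ∀ t ∈ Icc 0 T, HTwoBound A (fun x => ζ t x - 1) ∧
      HTwoBound A (fun x => 1 / ζ t x - 1) ∧ sobolevNorm 2 (fun x => 1 / ζ t x - 1) ≤ M := by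
  obtain ⟨M, hM⟩ := h.sobolev
  obtain ⟨A, -, hA⟩ := Muskat.exists_hTwoBound M
  refine ⟨A, M, fun t ht => ⟨hA _ ((h.continuous t ht).sub continuous_const) (hM t ht).1,
    hA _ ?_ (hM t ht).2, (hM t ht).2⟩⟩
  exact (continuous_const.div (h.continuous t ht) (h.ne_zero t ht)).sub continuous_const

theorem IsRegularSolution.existsUnique {T : ℝ} {ζ : ℝ → ℝ → ℂ} (h : IsRegularSolution T ζ)
    {t : ℝ} (ht : t ∈ Icc 0 T) : ∃! γ : ℝ → ℝ, IsInterfaceAngle (ζ t) γ := by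
  obtain ⟨A, M, hA⟩ := h.exists_hTwoBound
  refine existsUnique_interfaceAngle (h.continuous t ht) (h.ne_zero t ht) (hA t ht).1.norm_le' ?_
    (h.tendsto_one t ht) (h.extension_ne_zero t ht)
  simpa using (hA t ht).1.tendsto_zero.add_const 1

theorem IsRegularSolution.exists_logFamily {T : ℝ} {ζ : ℝ → ℝ → ℂ} (h : IsRegularSolution T ζ)
    {g : ℝ → ℝ → ℝ} (hg : ∀ t ∈ Icc 0 T, IsInterfaceAngle (ζ t) (g t)) :
    ∃ A M l, LogFamily T A M ζ l ∧ ∀ t ∈ Icc 0 T, g t = fun x => (l t x).im := by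
  obtain ⟨A, M, hA⟩ := h.exists_hTwoBound
  have hl : ∀ t ∈ Icc 0 T, ∃ l : ℝ → ℂ, (∃ K, LogSlice A K (ζ t) l) ∧
      Tendsto l (cocompact ℝ) (𝓝 0) ∧ g t = fun x => (l x).im := by
    intro t ht
    obtain ⟨l, hlc, hl0, he, hgl, hv, hv'⟩ := (hg t ht).exists_boundary (h.holomorphic t ht)
    obtain ⟨hz, hf, -⟩ := hA t ht
    obtain ⟨K, hK⟩ := exists_norm_le_of_tendsto_zero hlc hl0
    have hm := memLp_of_exp hlc hl0 he hz.memLp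
    refine ⟨l, ⟨max K (∫ x, ‖l x‖ ^ 2), ?_⟩, hl0, funext hgl⟩
    exact
      { inv_bound := hf
        bound := hz
        continuous_log := hlc
        exp_log := he
        memLp_log := hm
        norm_log_le := fun x => (hK x).trans (le_max_left _ _)
        integral_log_sq_le := le_max_right _ _
        vanishing_log := hv hm
        vanishing_deriv := hv' _ (fun x => (hf.hasDerivAt' x).sub_const 1) hf.memLp hf.memLp_deriv' }
  choose! l hl using hl
  refine ⟨A, M, l, ⟨fun t ht => (hl t ht).1, fun t ht => (hl t ht).2.1,
    fun t ht => (hA t ht).2.2, fun t ht x => ?_⟩, fun t ht => (hl t ht).2.2⟩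
  obtain ⟨d, hd, he⟩ := h.evolution t ht x
  refine hd.congr_deriv ?_
  have h0 := h.ne_zero t ht x
  rw [dInv] at he
  -- Dividing the evolution equation by `-1/ζ` puts it in logarithmic form, with `logRate` as the
  -- time derivative of the logarithm.
  rw [eq_sub_of_add_eq he, logRate, logDerivInv]
  have e : ((‖1 / ζ t x‖ ^ 2 : ℝ) : ℂ) = 1 / ((‖ζ t x‖ ^ 2 : ℝ) : ℂ) := by simp
  rw [e]
  field_simp
  ring

end Muskat

end

/-! ### The energy identity -/

open Muskat
theorem mainTheorem8 (T : ℝ) (hT : 0 < T) (ζ : ℝ → ℝ → ℂ) (hζ : IsRegularSolution T ζ) :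
    -- the interface angle is well defined, and `B₁ ≥ 0`
    (∀ t ∈ Icc 0 T, ∃! γ : ℝ → ℝ, IsInterfaceAngle (ζ t) γ) ∧
    (∀ t ∈ Icc 0 T, ∀ α : ℝ, 0 ≤ coeffB1 (ζ t) α) ∧
    ∀ g : ℝ → ℝ → ℝ, (∀ t ∈ Icc 0 T, IsInterfaceAngle (ζ t) (g t)) →
      -- all terms are finite
      (∀ t ∈ Icc 0 T,
        Integrable (fun α : ℝ => ‖ζ t α‖ ^ 2 * g t α ^ 2) ∧
        Integrable (fun α : ℝ => ‖ζ t α‖ ^ 2 * g t α ^ 2 * coeffB1 (ζ t) α) ∧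
        homHalfNorm (fun α : ℝ => (g t α : ℂ)) ≠ ⊤) ∧
      -- the identity
      (∀ t ∈ Icc 0 T, ∃ e : ℝ,
        HasDerivWithinAt (fun s : ℝ => energy (ζ s) (g s)) e (Icc 0 T) t ∧
        e + dissipationB1 (ζ t) (g t) + 2 * halfNormSq (g t) = 0) ∧
      -- the identity integrated in time, and the bound that follows from it
      IntervalIntegrable (fun s : ℝ => dissipationB1 (ζ s) (g s)) volume 0 T ∧
      IntervalIntegrable (fun s : ℝ => halfNormSq (g s)) volume 0 T ∧
      (∀ t ∈ Icc 0 T,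
        energy (ζ t) (g t) + (∫ s in (0 : ℝ)..t, dissipationB1 (ζ s) (g s)) +
          2 * (∫ s in (0 : ℝ)..t, halfNormSq (g s)) = energy (ζ 0) (g 0)) ∧
      2 * (∫ s in (0 : ℝ)..T, halfNormSq (g s)) ≤ energy (ζ 0) (g 0) := by
  refine ⟨fun t ht => hζ.existsUnique ht, fun t ht α => ?_, fun g hg => ?_⟩
  · obtain ⟨A, M, hA⟩ := hζ.exists_hTwoBound
    rw [coeffB1_eq_gagliardo (hA t ht).2.1]
    exact gagliardo_nonneg _ α
  obtain ⟨A, M, l, hl, hgl⟩ := hζ.exists_logFamily hg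
  obtain ⟨K, hK⟩ := hl.exists_slice
  have h0 : (0 : ℝ) ∈ Icc 0 T := left_mem_Icc.2 hT.le
  have hc1 : ContinuousOn (fun t => dissipationB1 (ζ t) (g t)) (Icc 0 T) :=
    hl.continuousOn_dissipationB1.congr fun t ht => by rw [hgl t ht]
  have hc2 : ContinuousOn (fun t => halfNormSq (g t)) (Icc 0 T) :=
    hl.continuousOn_halfNormSq.congr fun t ht => by rw [hgl t ht]
  have hi1 : ∀ t ∈ Icc 0 T, IntervalIntegrable (fun s => dissipationB1 (ζ s) (g s)) volume 0 t :=
    fun t ht => (hc1.mono (Icc_subset_Icc_right ht.2)).intervalIntegrable_of_Icc ht.1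
  have hi2 : ∀ t ∈ Icc 0 T, IntervalIntegrable (fun s => halfNormSq (g s)) volume 0 t :=
    fun t ht => (hc2.mono (Icc_subset_Icc_right ht.2)).intervalIntegrable_of_Icc ht.1
  have hE : ∀ t ∈ Icc 0 T, energy (ζ t) (g t) = energy (ζ 0) (g 0) -
      ∫ s in (0 : ℝ)..t, (dissipationB1 (ζ s) (g s) + 2 * halfNormSq (g s)) := fun t ht => by
    have h1 := hl.energy_sub_energy le_rfl ht.1 ht.2
    rw [← hgl t ht, ← hgl 0 h0, intervalIntegral.integral_neg] at h1
    have h2 : ∫ s in (0 : ℝ)..t, (dissipationB1 (ζ s) (fun x => (l s x).im) +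
        2 * halfNormSq fun x => (l s x).im) =
        ∫ s in (0 : ℝ)..t, (dissipationB1 (ζ s) (g s) + 2 * halfNormSq (g s)) :=
      intervalIntegral.integral_congr fun s hs => by
        rw [uIcc_of_le ht.1] at hs
        simp only [hgl s ⟨hs.1, hs.2.trans ht.2⟩]
    linarith
  have hI : ∀ t ∈ Icc 0 T, energy (ζ t) (g t) + (∫ s in (0 : ℝ)..t, dissipationB1 (ζ s) (g s)) +
      2 * (∫ s in (0 : ℝ)..t, halfNormSq (g s)) = energy (ζ 0) (g 0) := fun t ht => by
    rw [hE t ht, intervalIntegral.integral_add (hi1 t ht) ((hi2 t ht).const_mul 2),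
      intervalIntegral.integral_const_mul]
    ring
  have hT' : T ∈ Icc 0 T := right_mem_Icc.2 hT.le
  refine ⟨fun t ht => ?_, fun t ht => ?_, hi1 T hT', hi2 T hT', hI, ?_⟩
  · rw [hgl t ht]
    exact ⟨(hK t ht).integrable_energyDensity, (hK t ht).integrable_energyDensity_mul_coeffB1,
      (hK t ht).halfNormSq_eq.1⟩
  · refine ⟨-(dissipationB1 (ζ t) (g t) + 2 * halfNormSq (g t)), ?_, by ring⟩
    have hc : ContinuousOn (fun s => dissipationB1 (ζ s) (g s) + 2 * halfNormSq (g s)) (Icc 0 T) :=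
      hc1.add (hc2.const_smul (2 : ℝ))
    -- This instance selects the version of the fundamental theorem of calculus relative to `[0,
    -- T]`, so that one-sided derivatives at both end points are included.
    have : Fact (t ∈ Icc 0 T) := ⟨ht⟩
    have h1 := intervalIntegral.integral_hasDerivWithinAt_right (s := Icc 0 T) (t := Icc 0 T)
      ((hi1 t ht).add ((hi2 t ht).const_mul 2))
      (hc.stronglyMeasurableAtFilter_nhdsWithin measurableSet_Icc t) (hc t ht)
    exact (h1.const_sub (energy (ζ 0) (g 0))).congr (fun s hs => hE s hs) (hE t ht)
  · have h1 := hI T hT'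
    -- The final bound drops the energy at time `T` and the `B₁` dissipation, both nonnegative.
    have h2 : 0 ≤ energy (ζ T) (g T) := integral_nonneg fun x => by positivity
    have h3 : 0 ≤ ∫ s in (0 : ℝ)..T, dissipationB1 (ζ s) (g s) := by
      refine intervalIntegral.integral_nonneg hT.le fun s hs => integral_nonneg fun x => ?_
      exact mul_nonneg (by positivity) ((hK s hs).coeffB1_nonneg x)
    linarith
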